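/- Let $n\ge 3$ and let $\Omega\subset\mathbb{R}^n$ be a bounded Lipschitz domain. Let $\mathbf A:\Omega\to\mathbb{R}^{n\times n}$ be measurable with $\lambda|\xi|^2\le \mathbf A(x)\xi\cdot\xi$ for all $x\in\Omega$, $\xi\in\mathbb{R}^n$, and $\|\mathbf A\|_{L^\infty(\Omega)}\le\Lambda$, where $\lambda,\Lambda>0$. Let $\mathbf b,\mathbf c\in L^n(\Omega)^n$ and $d\in L^{n/2}(\Omega)$. Assume that $$\int_\Omega \mathbf b\cdot\nabla\phi+d\,\phi\ \ge 0\quad\text{for every }\phi\in C_c^\infty(\mathbb{R}^n),\ \phi\ge 0,$$ or that $$\int_\Omega \mathbf c\cdot\nabla\phi+d\,\phi\ \ge 0\quad\text{for every }\phi\in C_c^\infty(\mathbb{R}^n),\ \phi\ge 0.$$ Let $Y_1^2(\Omega)$ be the completion of $C_c^\infty(\mathbb{R}^n)$ under the norm $\|u\|_{L^{2n/(n-2)}(\Omega)}+\|\nabla u\|_{L^2(\Omega)}$, regarded as a space of (classes of) functions on $\Omega$ with weak gradient in $L^2(\Omega)$. Say that $u\in Y_1^2(\Omega)$ solves the homogeneous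 Neumann problem $$-\operatorname{div}(\mathbf A\nabla u+\mathbf b u)+\mathbf c\cdot\nabla u+du=0\ \text{ in }\Omega,\qquad (\mathbf A\nabla u+\mathbf b u)\cdot\nu=0\ \text{ on }\partial\Omega,$$ if $$\int_\Omega \mathbf A\nabla u\cdot\nabla\phi+u\,\mathbf b\cdot\nabla\phi+\phi\,\mathbf c\cdot\nabla u+d\,u\,\phi=0\quad\text{for every }\phi\in C_c^\infty(\mathbb{R}^n).$$ Then every nonzero solution $u\in Y_1^2(\Omega)$ of this problem is either almost everywhere positive in $\Omega$ or almost everywhere negative in $\Omega$. In particular, the vector space of solutions in $Y_1^2(\Omega)$ has dimension at most one. -/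

import Mathlib

open MeasureTheory Filter Topology
open scoped ENNReal NNReal ContDiff Gradient

noncomputable section

namespace NeumannProblem

/-- Euclidean space `ℝⁿ`. -/
abbrev E (n : ℕ) : Type := EuclideanSpace ℝ (Fin n)

/-- `Ω` is an open connected Lipschitz domain with character `(M, N)`: the boundary is covered by
`N` balls of a common radius `r` centred at boundary points `q i`, and in the ball of radius
`10 (M + 1) r` around `q i` the set `Ω` is, in orthonormal coordinates `(x', xₙ) ∈ ℝⁿ⁻¹ × ℝ`
centred at `q i`, the part above the graph of an `M`-Lipschitz function vanishing at `0`. -/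
def IsLipschitzDomainWith {n : ℕ} (Ω : Set (E n)) (M : ℝ≥0) (N : ℕ) : Prop :=
  IsOpen Ω ∧ IsConnected Ω ∧
    ∃ r : ℝ, 0 < r ∧ ∃ q : Fin N → E n,
      (∀ i, q i ∈ frontier Ω) ∧
      frontier Ω ⊆ ⋃ i, Metric.ball (q i) r ∧
      ∀ i, ∃ ψ : E (n - 1) → ℝ, LipschitzWith M ψ ∧ ψ 0 = 0 ∧
        ∃ R : E n ≃ₗᵢ[ℝ] WithLp 2 (E (n - 1) × ℝ),
          ∀ x ∈ Metric.ball (q i) (10 * ((M : ℝ) + 1) * r),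
            x ∈ Ω ↔ ψ (R (x - q i)).fst < (R (x - q i)).snd

/-- Bounded Lipschitz domains. -/
def IsBoundedLipschitzDomain {n : ℕ} (Ω : Set (E n)) : Prop :=
  Bornology.IsBounded Ω ∧ ∃ (M : ℝ≥0) (N : ℕ), IsLipschitzDomainWith Ω M N

/-- `φ ∈ C_c^∞(ℝⁿ)`. -/
def IsTestFunction {n : ℕ} (φ : E n → ℝ) : Prop :=
  ContDiff ℝ ∞ φ ∧ HasCompactSupport φ

/-- The Sobolev exponent `2n / (n - 2)` (meaningful for `n ≥ 3`). -/
def sobolevExponent (n : ℕ) : ℝ≥0∞ := ENNReal.ofReal (2 * (n : ℝ) / ((n : ℝ) - 2))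

/-- For `u` and `G` locally integrable in `Ω`: `G` is the weak gradient of `u` on `Ω`, i.e. for all `φ ∈ C_c^∞(Ω)`,
`∫_Ω u ∇φ = - ∫_Ω φ G`. -/
def IsWeakGradient {n : ℕ} (Ω : Set (E n)) (u : E n → ℝ) (G : E n → E n) : Prop :=
  ∀ φ : E n → ℝ, IsTestFunction φ → tsupport φ ⊆ Ω →
    ∫ x in Ω, u x • ∇ φ x = - ∫ x in Ω, φ x • G x

/-- `u` represents an element of `Y₁²(Ω)`, the completion of (restrictions to `Ω` of)
`C_c^∞(ℝⁿ)` under `‖u‖_{L^{2n/(n-2)}(Ω)} + ‖∇u‖_{L²(Ω)}`, and `G` is its weak gradient.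
The completion is realized as a space of functions: `u` is the limit in this norm of a sequence
in `C_c^∞(ℝⁿ)`. -/
structure HasYGradient {n : ℕ} (Ω : Set (E n)) (u : E n → ℝ) (G : E n → E n) : Prop where
  memLp : MemLp u (sobolevExponent n) (volume.restrict Ω)
  memLp_gradient : MemLp G 2 (volume.restrict Ω)
  isWeakGradient : IsWeakGradient Ω u G
  approx : ∃ φ : ℕ → E n → ℝ, (∀ k, IsTestFunction (φ k)) ∧
    Tendsto (fun k => eLpNorm (fun x => φ k x - u x) (sobolevExponent n) (volume.restrict Ω))
      atTop (𝓝 0) ∧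
    Tendsto (fun k => eLpNorm (fun x => ∇ (φ k) x - G x) 2 (volume.restrict Ω))
      atTop (𝓝 0)

/-- The bilinear integrand
`A ∇u · ∇φ + b u · ∇φ + c φ · ∇u + d u φ` of the operator
`L u = - div (A ∇u + b u) + c · ∇u + d u`, where `G` stands for `∇u`. -/
def weakIntegrand {n : ℕ} (A : E n → Matrix (Fin n) (Fin n) ℝ) (b c : E n → E n) (d : E n → ℝ)
    (u : E n → ℝ) (G : E n → E n) (φ : E n → ℝ) (x : E n) : ℝ :=
  inner ℝ (Matrix.toEuclideanCLM (n := Fin n) (𝕜 := ℝ) (A x) (G x)) (∇ φ x)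
    + u x * inner ℝ (b x) (∇ φ x) + φ x * inner ℝ (c x) (G x) + d x * u x * φ x

/-- `u ∈ Y₁²(Ω)` is a weak solution of the homogeneous Neumann problem
`- div (A ∇u + b u) + c · ∇u + d u = 0` in `Ω`, `(A ∇u + b u) · ν = 0` on `∂Ω`.
(The test functions need not vanish on `∂Ω`. The integrability clause is automatic for bounded
measurable `A`, `b, c ∈ Lⁿ(Ω)`, `d ∈ L^{n/2}(Ω)`, `n ≥ 3`, `Ω` bounded; the weak gradient `G` of
`u` is unique up to null sets when `Ω` is open.) -/
def IsNeumannSolution {n : ℕ} (Ω : Set (E n)) (A : E n → Matrix (Fin n) (Fin n) ℝ)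
    (b c : E n → E n) (d : E n → ℝ) (u : E n → ℝ) : Prop :=
  ∃ G : E n → E n, HasYGradient Ω u G ∧
    ∀ φ : E n → ℝ, IsTestFunction φ →
      IntegrableOn (weakIntegrand A b c d u G φ) Ω ∧
      ∫ x in Ω, weakIntegrand A b c d u G φ x = 0

/-- `A` is measurable on `Ω`, `λ |ξ|² ≤ A(x) ξ · ξ` for all `x ∈ Ω` and `ξ ∈ ℝⁿ`, and
`‖A‖_{L^∞(Ω)} ≤ Λ`. -/
structure IsUniformlyElliptic {n : ℕ} (Ω : Set (E n)) (A : E n → Matrix (Fin n) (Fin n) ℝ)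
    (lam Lam : ℝ) : Prop where
  lam_pos : 0 < lam
  Lam_pos : 0 < Lam
  aestronglyMeasurable : AEStronglyMeasurable
    (fun x => Matrix.toEuclideanCLM (n := Fin n) (𝕜 := ℝ) (A x)) (volume.restrict Ω)
  elliptic : ∀ x ∈ Ω, ∀ ξ : E n,
    lam * ‖ξ‖ ^ 2 ≤ inner ℝ (Matrix.toEuclideanCLM (n := Fin n) (𝕜 := ℝ) (A x) ξ) ξ
  bounded : eLpNorm (fun x => Matrix.toEuclideanCLM (n := Fin n) (𝕜 := ℝ) (A x)) ⊤
    (volume.restrict Ω) ≤ ENNReal.ofReal Lam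

/-- `∫_Ω b · ∇φ + d φ ≥ 0` for every nonnegative `φ ∈ C_c^∞(ℝⁿ)`. -/
def SignCondition {n : ℕ} (Ω : Set (E n)) (b : E n → E n) (d : E n → ℝ) : Prop :=
  ∀ φ : E n → ℝ, IsTestFunction φ → (∀ x, 0 ≤ φ x) →
    0 ≤ ∫ x in Ω, (inner ℝ (b x) (∇ φ x) + d x * φ x)

/-! ### The spaces as vector spaces of a.e. classes -/

theorem IsTestFunction.gradient_add {n : ℕ} {φ ψ : E n → ℝ} (hφ : IsTestFunction φ)
    (hψ : IsTestFunction ψ) (x : E n) : ∇ (fun y => φ y + ψ y) x = ∇ φ x + ∇ ψ x := by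
  have h1 : DifferentiableAt ℝ φ x := (hφ.1.differentiable (by simp)) x
  have h2 : DifferentiableAt ℝ ψ x := (hψ.1.differentiable (by simp)) x
  simp only [gradient]
  rw [fderiv_fun_add h1 h2, map_add]

theorem IsTestFunction.gradient_const_mul {n : ℕ} {φ : E n → ℝ} (hφ : IsTestFunction φ)
    (a : ℝ) (x : E n) : ∇ (fun y => a * φ y) x = a • ∇ φ x := by
  have h1 : DifferentiableAt ℝ φ x := (hφ.1.differentiable (by simp)) x
  simp only [gradient]
  rw [fderiv_const_mul h1, map_smul]

theorem IsTestFunction.continuous_gradient {n : ℕ} {φ : E n → ℝ} (hφ : IsTestFunction φ) :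
    Continuous (∇ φ) :=
  (InnerProductSpace.toDual ℝ (E n)).symm.continuous.comp (hφ.1.continuous_fderiv (by simp))

theorem IsTestFunction.hasCompactSupport_gradient {n : ℕ} {φ : E n → ℝ}
    (hφ : IsTestFunction φ) : HasCompactSupport (∇ φ) :=
  (hφ.2.fderiv ℝ).comp_left (g := (InnerProductSpace.toDual ℝ (E n)).symm) (map_zero _)

theorem IsTestFunction.integrable_mul_gradient {n : ℕ} {Ω : Set (E n)} {u φ : E n → ℝ}
    {p : ℝ≥0∞} (hp : 1 ≤ p) (hu : MemLp u p (volume.restrict Ω)) (hφ : IsTestFunction φ) :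
    Integrable (fun x => u x • ∇ φ x) (volume.restrict Ω) := by
  have hloc : LocallyIntegrable u (volume.restrict Ω) := hu.locallyIntegrable hp
  exact hloc.integrable_smul_right_of_hasCompactSupport hφ.continuous_gradient
    hφ.hasCompactSupport_gradient

theorem IsTestFunction.integrable_smul {n : ℕ} {Ω : Set (E n)} {φ : E n → ℝ} {G : E n → E n}
    (hG : MemLp G 2 (volume.restrict Ω)) (hφ : IsTestFunction φ) :
    Integrable (fun x => φ x • G x) (volume.restrict Ω) :=
  (hG.locallyIntegrable (by norm_num)).integrable_smul_left_of_hasCompactSupport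
    hφ.1.continuous hφ.2

theorem one_le_sobolevExponent {n : ℕ} (hn : 3 ≤ n) : 1 ≤ sobolevExponent n := by
  have h : (3 : ℝ) ≤ n := by exact_mod_cast hn
  rw [sobolevExponent, ENNReal.one_le_ofReal, le_div_iff₀ (by linarith)]
  linarith

theorem HasYGradient.congr {n : ℕ} {Ω : Set (E n)} {u v : E n → ℝ} {G : E n → E n}
    (h : HasYGradient Ω u G) (huv : u =ᵐ[volume.restrict Ω] v) : HasYGradient Ω v G := by
  refine ⟨h.memLp.ae_eq huv, h.memLp_gradient, fun φ hφ hs => ?_, ?_⟩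
  · rw [← h.isWeakGradient φ hφ hs]
    refine integral_congr_ae ?_
    filter_upwards [huv] with x hx
    rw [hx]
  · obtain ⟨φ, hφ, h1, h2⟩ := h.approx
    refine ⟨φ, hφ, ?_, h2⟩
    refine h1.congr fun k => eLpNorm_congr_ae ?_
    filter_upwards [huv] with x hx
    rw [hx]

theorem HasYGradient.zero {n : ℕ} {Ω : Set (E n)} :
    HasYGradient Ω (fun _ => 0) (fun _ => 0) := by
  refine ⟨MemLp.zero', MemLp.zero', fun φ _ _ => by simp, fun _ _ => 0, fun _ => ?_, ?_, ?_⟩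
  · exact ⟨contDiff_const, HasCompactSupport.zero⟩
  · simp
  · simp [gradient]

theorem HasYGradient.add {n : ℕ} (hn : 3 ≤ n) {Ω : Set (E n)} {u v : E n → ℝ}
    {G H : E n → E n} (hu : HasYGradient Ω u G) (hv : HasYGradient Ω v H) :
    HasYGradient Ω (fun x => u x + v x) (fun x => G x + H x) := by
  have hp := one_le_sobolevExponent hn
  refine ⟨hu.memLp.add hv.memLp, hu.memLp_gradient.add hv.memLp_gradient,
    fun φ hφ hs => ?_, ?_⟩
  · simp only [add_smul, smul_add]
    rw [integral_add (hφ.integrable_mul_gradient hp hu.memLp)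
        (hφ.integrable_mul_gradient hp hv.memLp),
      integral_add (hφ.integrable_smul hu.memLp_gradient) (hφ.integrable_smul hv.memLp_gradient),
      hu.isWeakGradient φ hφ hs, hv.isWeakGradient φ hφ hs, neg_add]
  · obtain ⟨φ, hφ, h1, h2⟩ := hu.approx
    obtain ⟨ψ, hψ, h3, h4⟩ := hv.approx
    refine ⟨fun k x => φ k x + ψ k x,
      fun k => ⟨(hφ k).1.add (hψ k).1, (hφ k).2.add (hψ k).2⟩, ?_, ?_⟩
    · refine tendsto_of_tendsto_of_tendsto_of_le_of_le tendsto_const_nhds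
        (by simpa using h1.add h3) (fun _ => zero_le) fun k => ?_
      refine le_trans (le_of_eq ?_) (eLpNorm_add_le
        ((hφ k).1.continuous.aestronglyMeasurable.sub hu.memLp.1)
        ((hψ k).1.continuous.aestronglyMeasurable.sub hv.memLp.1) hp)
      congr 1
      ext x
      simp only [Pi.add_apply]
      ring
    · refine tendsto_of_tendsto_of_tendsto_of_le_of_le tendsto_const_nhds
        (by simpa using h2.add h4) (fun _ => zero_le) fun k => ?_
      refine le_trans (le_of_eq ?_) (eLpNorm_add_le
        ((hφ k).continuous_gradient.aestronglyMeasurable.sub hu.memLp_gradient.1)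
        ((hψ k).continuous_gradient.aestronglyMeasurable.sub hv.memLp_gradient.1) (by norm_num))
      congr 1
      ext1 x
      simp only [Pi.add_apply, (hφ k).gradient_add (hψ k)]
      abel

theorem HasYGradient.const_mul {n : ℕ} {Ω : Set (E n)} {u : E n → ℝ} {G : E n → E n}
    (hu : HasYGradient Ω u G) (a : ℝ) :
    HasYGradient Ω (fun x => a * u x) (fun x => a • G x) := by
  refine ⟨hu.memLp.const_mul a, hu.memLp_gradient.const_smul a, fun φ hφ hs => ?_, ?_⟩
  · have h1 : ∀ x, (a * u x) • ∇ φ x = a • (u x • ∇ φ x) := fun x => mul_smul _ _ _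
    have h2 : ∀ x, φ x • a • G x = a • (φ x • G x) := fun x => smul_comm _ _ _
    simp only [h1, h2]
    rw [integral_smul, integral_smul, hu.isWeakGradient φ hφ hs, smul_neg]
  · obtain ⟨φ, hφ, h1, h2⟩ := hu.approx
    refine ⟨fun k x => a * φ k x,
      fun k => ⟨contDiff_const.mul (hφ k).1, (hφ k).2.mul_left⟩, ?_, ?_⟩
    · have := ENNReal.Tendsto.const_mul (a := ‖a‖ₑ) h1 (Or.inr (by simp))
      rw [mul_zero] at this
      refine this.congr fun k => ?_
      rw [← eLpNorm_const_smul]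
      congr 1
      ext x
      simp only [Pi.smul_apply, smul_eq_mul]
      ring
    · have := ENNReal.Tendsto.const_mul (a := ‖a‖ₑ) h2 (Or.inr (by simp))
      rw [mul_zero] at this
      refine this.congr fun k => ?_
      rw [← eLpNorm_const_smul]
      congr 1
      ext1 x
      simp only [Pi.smul_apply, (hφ k).gradient_const_mul, smul_sub]

theorem IsNeumannSolution.congr {n : ℕ} {Ω : Set (E n)}
    {A : E n → Matrix (Fin n) (Fin n) ℝ} {b c : E n → E n} {d : E n → ℝ} {u v : E n → ℝ}
    (h : IsNeumannSolution Ω A b c d u) (huv : u =ᵐ[volume.restrict Ω] v) :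
    IsNeumannSolution Ω A b c d v := by
  obtain ⟨G, hG, hs⟩ := h
  refine ⟨G, hG.congr huv, fun φ hφ => ?_⟩
  have h1 : weakIntegrand A b c d u G φ =ᵐ[volume.restrict Ω] weakIntegrand A b c d v G φ := by
    filter_upwards [huv] with x hx
    simp only [weakIntegrand, hx]
  exact ⟨(hs φ hφ).1.congr h1, (integral_congr_ae h1).symm.trans (hs φ hφ).2⟩

theorem IsNeumannSolution.zero {n : ℕ} {Ω : Set (E n)}
    {A : E n → Matrix (Fin n) (Fin n) ℝ} {b c : E n → E n} {d : E n → ℝ} :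
    IsNeumannSolution Ω A b c d (fun _ => 0) := by
  refine ⟨fun _ => 0, .zero, fun φ _ => ?_⟩
  have : weakIntegrand A b c d (fun _ => 0) (fun _ => 0) φ = fun _ => 0 := by
    ext x
    simp [weakIntegrand]
  rw [this]
  exact ⟨integrableOn_zero, by simp⟩

theorem IsNeumannSolution.add {n : ℕ} (hn : 3 ≤ n) {Ω : Set (E n)}
    {A : E n → Matrix (Fin n) (Fin n) ℝ} {b c : E n → E n} {d : E n → ℝ} {u v : E n → ℝ}
    (hu : IsNeumannSolution Ω A b c d u) (hv : IsNeumannSolution Ω A b c d v) :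
    IsNeumannSolution Ω A b c d (fun x => u x + v x) := by
  obtain ⟨G, hG, hs⟩ := hu
  obtain ⟨H, hH, ht⟩ := hv
  refine ⟨_, hG.add hn hH, fun φ hφ => ?_⟩
  have : weakIntegrand A b c d (fun x => u x + v x) (fun x => G x + H x) φ
      = weakIntegrand A b c d u G φ + weakIntegrand A b c d v H φ := by
    ext x
    simp only [weakIntegrand, Pi.add_apply, map_add, inner_add_left, inner_add_right]
    ring
  rw [this]
  refine ⟨(hs φ hφ).1.add (ht φ hφ).1, ?_⟩
  have h2 := integral_add (hs φ hφ).1 (ht φ hφ).1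
  simp only [Pi.add_apply]
  rw [h2, (hs φ hφ).2, (ht φ hφ).2, add_zero]

theorem IsNeumannSolution.const_mul {n : ℕ} {Ω : Set (E n)}
    {A : E n → Matrix (Fin n) (Fin n) ℝ} {b c : E n → E n} {d : E n → ℝ} {u : E n → ℝ}
    (hu : IsNeumannSolution Ω A b c d u) (a : ℝ) :
    IsNeumannSolution Ω A b c d (fun x => a * u x) := by
  obtain ⟨G, hG, hs⟩ := hu
  refine ⟨_, hG.const_mul a, fun φ hφ => ?_⟩
  have : weakIntegrand A b c d (fun x => a * u x) (fun x => a • G x) φ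
      = fun x => a * weakIntegrand A b c d u G φ x := by
    ext x
    simp only [weakIntegrand, map_smul, real_inner_smul_left, real_inner_smul_right]
    ring
  rw [this]
  refine ⟨(hs φ hφ).1.const_mul a, ?_⟩
  rw [integral_const_mul, (hs φ hφ).2, mul_zero]

/-- The space `Y₁²(Ω)`, as a space of a.e. equivalence classes of functions on `Ω`. -/
def Y12 {n : ℕ} (hn : 3 ≤ n) (Ω : Set (E n)) :
    Submodule ℝ (Lp ℝ (sobolevExponent n) (volume.restrict Ω)) where
  carrier := {u | ∃ G, HasYGradient Ω u G}
  zero_mem' := ⟨_, HasYGradient.zero.congr (Lp.coeFn_zero _ _ _).symm⟩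
  add_mem' := by
    rintro u v ⟨G, hG⟩ ⟨H, hH⟩
    exact ⟨_, (hG.add hn hH).congr (Lp.coeFn_add u v).symm⟩
  smul_mem' := by
    rintro a u ⟨G, hG⟩
    exact ⟨_, (hG.const_mul a).congr (Lp.coeFn_smul a u).symm⟩

/-- The space of solutions `u ∈ Y₁²(Ω)` of the homogeneous Neumann problem. -/
def neumannKernel {n : ℕ} (hn : 3 ≤ n) (Ω : Set (E n)) (A : E n → Matrix (Fin n) (Fin n) ℝ)
    (b c : E n → E n) (d : E n → ℝ) : Submodule ℝ (Y12 hn Ω) where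
  carrier := {u | IsNeumannSolution Ω A b c d (u : Lp ℝ (sobolevExponent n) (volume.restrict Ω))}
  zero_mem' := IsNeumannSolution.zero.congr (Lp.coeFn_zero _ _ _).symm
  add_mem' := fun {u v} hu hv =>
    (IsNeumannSolution.add hn hu hv).congr (Lp.coeFn_add u.1 v.1).symm
  smul_mem' := fun a u hu => (IsNeumannSolution.const_mul hu a).congr (Lp.coeFn_smul a u.1).symm

end NeumannProblem

end

/-! Everything reduces to one dichotomy: a solution `u` satisfies `u ≤ 0` a.e. or `u > 0` a.e.
Applying it to `u` and to `-u` gives the sign of a nonzero solution. The integral over `Ω` is then a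
linear functional which vanishes on no nonzero solution, so the solution space has dimension at most
one.

Both sign conditions lead to a strong maximum principle (`IsSupersolution.ae_zero_or_pos`): a
nonnegative supersolution `w` on a connected set is a.e. zero or a.e. positive. Testing with `1 / (w
+ ε)` bounds `∇ log (w + ε)` in `L²`, uniformly in `ε`. By the Poincaré inequality on a ball, `log
((w + ε) / ε)` has bounded mean oscillation there as `ε → 0`. But it is `0` where `w = 0` and tends
to infinity where `w > a > 0`, so one of these sets is null. Connectedness passes from balls to `Ω`.

Condition on `(c, d)`. Testing with `φ σ(j u)`, `σ` a smooth step, shows that `u⁺` is a subsolution: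
the form `L(φ)` at `(u⁺, φ)` is nonpositive for `φ ≥ 0`. The constant `1` is an admissible Neumann
test function, and `L(1) = ∫ c · ∇u⁺ + d u⁺ ≥ 0` by the sign condition. Evaluating `L` at `C ± φ ≥
0` forces `L = 0`. So `u⁺` is a solution and the maximum principle applies to it. The Lipschitz
boundary plays no role in this case.

Condition on `(b, d)`. Test the equation with `(u - k)⁺` and the sign condition with `u (u - k)⁺`.
The difference has no `d`, and gives `λ ‖∇(u - k)⁺‖₂ ≤ ‖(u - k)⁺‖ ‖(c - b) 1_{u > k}‖ₙ`, with the
norm of exponent `2n / (n - 2)` on `(u - k)⁺`. By the Sobolev inequality on `Ω` the right side can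
be absorbed once the indicators of `{u > k}` are small, and then `(u - k)⁺ = 0`. Hence `u` is
bounded above. Let `M` be its least nonnegative upper bound. If `M > 0`, the sign condition makes `M
- u` a nonnegative supersolution, so `u = M` a.e. or `u < M` a.e. In the latter case the indicators
of `{u > k}` tend to `0` as `k` increases to `M`, and the same absorption gives a bound below `M`, a
contradiction.

The Sobolev inequality comes from Gagliardo's argument along line segments which stay in `Ω`; the
cone property of Lipschitz domains provides the segments. -/

noncomputable section

namespace NeumannProblem

/-! ### Exponents -/

/-- The Hölder conjugate `2n / (n + 2)` of the Sobolev exponent. -/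
def dualExponent (n : ℕ) : ℝ≥0∞ := ENNReal.ofReal (2 * (n : ℝ) / ((n : ℝ) + 2))

section Exponents

variable {n : ℕ}

theorem inv_sobolevExponent (hn : 3 ≤ n) :
    (sobolevExponent n)⁻¹ = ENNReal.ofReal (((n : ℝ) - 2) / (2 * n)) := by
  have h : (3 : ℝ) ≤ n := by exact_mod_cast hn
  rw [sobolevExponent, ← ENNReal.ofReal_inv_of_pos (div_pos (by linarith) (by linarith)), inv_div]

theorem inv_dualExponent (hn : 3 ≤ n) :
    (dualExponent n)⁻¹ = ENNReal.ofReal (((n : ℝ) + 2) / (2 * n)) := by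
  have h : (3 : ℝ) ≤ n := by exact_mod_cast hn
  rw [dualExponent, ← ENNReal.ofReal_inv_of_pos (div_pos (by linarith) (by linarith)), inv_div]

theorem inv_natCast_eq_ofReal (hn : 3 ≤ n) : (n : ℝ≥0∞)⁻¹ = ENNReal.ofReal (1 / n) := by
  have h : (3 : ℝ) ≤ n := by exact_mod_cast hn
  rw [← ENNReal.ofReal_natCast, ← ENNReal.ofReal_inv_of_pos (by linarith), one_div]

theorem inv_half_natCast_eq_ofReal (hn : 3 ≤ n) :
    ((n : ℝ≥0∞) / 2)⁻¹ = ENNReal.ofReal (2 / n) := by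
  have h : (3 : ℝ) ≤ n := by exact_mod_cast hn
  rw [← ENNReal.ofReal_natCast, show (2 : ℝ≥0∞) = ENNReal.ofReal 2 by simp,
    ← ENNReal.ofReal_div_of_pos (by norm_num), ← ENNReal.ofReal_inv_of_pos (by linarith), inv_div]

theorem inv_two_eq_ofReal : (2 : ℝ≥0∞)⁻¹ = ENNReal.ofReal (1 / 2) := by
  rw [one_div, ENNReal.ofReal_inv_of_pos (by norm_num)]; simp

/-- This and the next three exponent identities serve, in order, `u b ∈ L²`, `c · ∇u` and `d u` in
the dual exponent, and the pairing of these with a function of the Sobolev class. -/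
theorem holderTriple_sobolev_natCast (hn : 3 ≤ n) :
    ENNReal.HolderTriple (sobolevExponent n) n 2 := by
  have h : (3 : ℝ) ≤ n := by exact_mod_cast hn
  refine ⟨?_⟩
  rw [inv_sobolevExponent hn, inv_natCast_eq_ofReal hn, inv_two_eq_ofReal,
    ← ENNReal.ofReal_add (div_nonneg (by linarith) (by linarith)) (by positivity)]
  congr 1; field_simp; ring

theorem holderTriple_natCast_two (hn : 3 ≤ n) :
    ENNReal.HolderTriple n 2 (dualExponent n) := by
  have h : (3 : ℝ) ≤ n := by exact_mod_cast hn
  refine ⟨?_⟩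
  rw [inv_dualExponent hn, inv_natCast_eq_ofReal hn, inv_two_eq_ofReal,
    ← ENNReal.ofReal_add (by positivity) (by positivity)]
  congr 1; field_simp; ring

theorem holderTriple_half_sobolev (hn : 3 ≤ n) :
    ENNReal.HolderTriple ((n : ℝ≥0∞) / 2) (sobolevExponent n) (dualExponent n) := by
  have h : (3 : ℝ) ≤ n := by exact_mod_cast hn
  refine ⟨?_⟩
  rw [inv_dualExponent hn, inv_half_natCast_eq_ofReal hn, inv_sobolevExponent hn,
    ← ENNReal.ofReal_add (by positivity) (div_nonneg (by linarith) (by linarith))]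
  congr 1; field_simp; ring

theorem holderConjugate_dual_sobolev (hn : 3 ≤ n) :
    ENNReal.HolderTriple (dualExponent n) (sobolevExponent n) 1 := by
  have h : (3 : ℝ) ≤ n := by exact_mod_cast hn
  refine ⟨?_⟩
  rw [inv_dualExponent hn, inv_sobolevExponent hn,
    ← ENNReal.ofReal_add (by positivity) (div_nonneg (by linarith) (by linarith)), inv_one,
    ← ENNReal.ofReal_one]
  congr 1; field_simp; ring

theorem sobolevExponent_ne_top : sobolevExponent n ≠ ⊤ := ENNReal.ofReal_ne_top

theorem two_le_sobolevExponent (hn : 3 ≤ n) : 2 ≤ sobolevExponent n := by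
  have h : (3 : ℝ) ≤ n := by exact_mod_cast hn
  rw [show (2 : ℝ≥0∞) = ENNReal.ofReal 2 by simp, sobolevExponent]
  refine ENNReal.ofReal_le_ofReal ?_
  rw [le_div_iff₀ (by linarith)]
  linarith

theorem sobolevExponent_ne_zero (hn : 3 ≤ n) : sobolevExponent n ≠ 0 :=
  (zero_lt_one.trans_le (one_le_sobolevExponent hn)).ne'

theorem two_le_natCast (hn : 3 ≤ n) : (2 : ℝ≥0∞) ≤ n := by
  exact_mod_cast (by omega : 2 ≤ n)

theorem dualExponent_le_half (hn : 3 ≤ n) : dualExponent n ≤ (n : ℝ≥0∞) / 2 := by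
  have h : (3 : ℝ) ≤ n := by exact_mod_cast hn
  rw [← ENNReal.inv_le_inv, inv_dualExponent hn, inv_half_natCast_eq_ofReal hn]
  refine ENNReal.ofReal_le_ofReal ?_
  rw [div_le_div_iff₀ (by linarith) (by linarith)]
  nlinarith

theorem one_le_half_natCast (hn : 3 ≤ n) : (1 : ℝ≥0∞) ≤ (n : ℝ≥0∞) / 2 := by
  have h : (3 : ℝ) ≤ n := by exact_mod_cast hn
  rw [← ENNReal.inv_le_inv, inv_half_natCast_eq_ofReal hn, inv_one, ← ENNReal.ofReal_one]
  refine ENNReal.ofReal_le_ofReal ?_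
  rw [div_le_one₀ (by linarith)]
  linarith

end Exponents

/-! ### Convergence in `Lᵖ` -/

section Convergence

variable {α X Y : Type*} [MeasurableSpace α] {μ : Measure α} [NormedAddCommGroup X]
  [NormedAddCommGroup Y]

theorem tendsto_eLpNorm_zero_of_dominated {p : ℝ≥0∞} (hp : p ≠ 0) (hp' : p ≠ ⊤) {f : ℕ → α → X}
    {g : α → Y} (hg : MemLp g p μ) {C : ℝ} (hf : ∀ k, AEStronglyMeasurable (f k) μ)
    (hfg : ∀ k, ∀ᵐ x ∂μ, ‖f k x‖ ≤ C * ‖g x‖)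
    (hlim : ∀ᵐ x ∂μ, Tendsto (fun k => f k x) atTop (𝓝 0)) :
    Tendsto (fun k => eLpNorm (f k) p μ) atTop (𝓝 0) := by
  have hp0 : 0 < p.toReal := ENNReal.toReal_pos hp hp'
  have key : Tendsto (fun k => ∫⁻ x, ‖f k x‖ₑ ^ p.toReal ∂μ) atTop (𝓝 (∫⁻ _, 0 ∂μ)) := by
    refine tendsto_lintegral_of_dominated_convergence' (fun x => ‖C * ‖g x‖‖ₑ ^ p.toReal)
      (fun k => (hf k).enorm.pow_const _) (fun k => ?_) ?_ ?_
    · filter_upwards [hfg k] with x hx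
      gcongr
      rw [enorm_le_iff_norm_le]
      exact hx.trans (le_abs_self _)
    · have h := (lintegral_rpow_enorm_lt_top_of_eLpNorm_lt_top hp hp'
        (hg.norm.const_mul C).eLpNorm_lt_top)
      exact h.ne
    · filter_upwards [hlim] with x hx
      have h1 : Tendsto (fun k => ‖f k x‖ₑ) atTop (𝓝 0) := by
        simpa using hx.enorm
      have h2 := (ENNReal.continuous_rpow_const (y := p.toReal)).continuousAt.tendsto.comp h1
      simpa [Function.comp_def, ENNReal.zero_rpow_of_pos hp0] using h2
  simp_rw [eLpNorm_eq_lintegral_rpow_enorm_toReal hp hp']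
  have h3 := (ENNReal.continuous_rpow_const (y := 1 / p.toReal)).continuousAt.tendsto.comp key
  simpa [Function.comp_def, ENNReal.zero_rpow_of_pos (inv_pos.2 hp0)] using h3

theorem tendsto_zero_of_le_mul {u v : ℕ → ℝ≥0∞} {C : ℝ≥0∞} (hC : C ≠ ⊤)
    (hv : Tendsto v atTop (𝓝 0)) (h : ∀ k, u k ≤ C * v k) : Tendsto u atTop (𝓝 0) := by
  have := ENNReal.Tendsto.const_mul (a := C) hv (Or.inr hC)
  rw [mul_zero] at this
  exact tendsto_of_tendsto_of_tendsto_of_le_of_le tendsto_const_nhds this (fun _ => zero_le) h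

theorem tendsto_integral_inner {X : Type*} [NormedAddCommGroup X] [InnerProductSpace ℝ X]
    {p q : ℝ≥0∞} [hpq : ENNReal.HolderTriple p q 1] {f : α → X} (hf : MemLp f p μ)
    {g : ℕ → α → X} {h : α → X} (hg : ∀ k, MemLp (g k) q μ) (hh : MemLp h q μ)
    (hlim : Tendsto (fun k => eLpNorm (fun x => g k x - h x) q μ) atTop (𝓝 0)) :
    (∀ k, Integrable (fun x => inner ℝ (f x) (g k x)) μ) ∧
    Integrable (fun x => inner ℝ (f x) (h x)) μ ∧
    Tendsto (fun k => ∫ x, inner ℝ (f x) (g k x) ∂μ) atTop (𝓝 (∫ x, inner ℝ (f x) (h x) ∂μ)) := by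
  have bound : ∀ w : α → X, MemLp w q μ →
      eLpNorm (fun x => inner ℝ (f x) (w x)) 1 μ ≤ eLpNorm f p μ * eLpNorm w q μ := by
    intro w hw
    have := eLpNorm_le_eLpNorm_mul_eLpNorm_of_nnnorm (p := p) (q := q) (r := 1) hf.1 hw.1
      (fun x y => (inner ℝ x y : ℝ)) 1 (Eventually.of_forall fun x => by
        simpa using nnnorm_inner_le_nnnorm (𝕜 := ℝ) (f x) (w x))
    simpa using this
  have int : ∀ w : α → X, MemLp w q μ → Integrable (fun x => inner ℝ (f x) (w x)) μ := by
    intro w hw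
    refine memLp_one_iff_integrable.1 ⟨hf.1.inner hw.1, (bound w hw).trans_lt ?_⟩
    exact ENNReal.mul_lt_top hf.2 hw.2
  refine ⟨fun k => int _ (hg k), int _ hh, ?_⟩
  refine tendsto_integral_of_L1' _ (int _ hh).1 (Eventually.of_forall fun k => int _ (hg k)) ?_
  refine tendsto_zero_of_le_mul hf.2.ne hlim fun k => ?_
  refine le_trans (le_of_eq ?_) (bound _ ((hg k).sub hh))
  congr 1
  ext x
  simp [inner_sub_right]

theorem integrable_inner_of_memLp {X : Type*} [NormedAddCommGroup X] [InnerProductSpace ℝ X]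
    {p q : ℝ≥0∞} [hpq : ENNReal.HolderTriple p q 1] {f g : α → X} (hf : MemLp f p μ)
    (hg : MemLp g q μ) : Integrable (fun x => inner ℝ (f x) (g x)) μ :=
  (tendsto_integral_inner hf (g := fun _ => g) (fun _ => hg) hg (by simp)).2.1

end Convergence

/-! ### Test functions -/

section TestFunctions

variable {n : ℕ} {φ ψ : E n → ℝ}

theorem IsTestFunction.differentiable (hφ : IsTestFunction φ) : Differentiable ℝ φ :=
  hφ.1.differentiable (by simp)

theorem IsTestFunction.exists_bound (hφ : IsTestFunction φ) :
    ∃ C, 0 ≤ C ∧ (∀ x, |φ x| ≤ C) ∧ ∀ x, ‖∇ φ x‖ ≤ C := by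
  obtain ⟨C, hC⟩ := hφ.1.continuous.bounded_above_of_compact_support hφ.2
  obtain ⟨D, hD⟩ := hφ.continuous_gradient.bounded_above_of_compact_support
    hφ.hasCompactSupport_gradient
  refine ⟨max C D, ((norm_nonneg _).trans (hC 0)).trans (le_max_left _ _), fun x => ?_, fun x => ?_⟩
  · exact (hC x).trans (le_max_left _ _)
  · exact (hD x).trans (le_max_right _ _)

theorem IsTestFunction.memLp (hφ : IsTestFunction φ) (p : ℝ≥0∞) (Ω : Set (E n)) :
    MemLp φ p (volume.restrict Ω) :=
  hφ.1.continuous.memLp_of_hasCompactSupport hφ.2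

theorem IsTestFunction.memLp_gradient (hφ : IsTestFunction φ) (p : ℝ≥0∞) (Ω : Set (E n)) :
    MemLp (∇ φ) p (volume.restrict Ω) :=
  hφ.continuous_gradient.memLp_of_hasCompactSupport hφ.hasCompactSupport_gradient

theorem IsTestFunction.mul_comp (hφ : IsTestFunction φ) (hψ : IsTestFunction ψ) {F : ℝ → ℝ}
    (hF : ContDiff ℝ ∞ F) : IsTestFunction (fun x => φ x * F (ψ x)) :=
  ⟨hφ.1.mul (hF.comp hψ.1), hφ.2.mul_right⟩

theorem IsTestFunction.gradient_mul_comp (hφ : IsTestFunction φ) (hψ : IsTestFunction ψ)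
    {F : ℝ → ℝ} (hF : ContDiff ℝ ∞ F) (x : E n) :
    ∇ (fun x => φ x * F (ψ x)) x = F (ψ x) • ∇ φ x + (φ x * deriv F (ψ x)) • ∇ ψ x := by
  have h1 := (hφ.differentiable x)
  have h2 := (hψ.differentiable x).hasFDerivAt
  have h3 : HasDerivAt F (deriv F (ψ x)) (ψ x) := (hF.differentiable (by simp) _).hasDerivAt
  have h4 := h3.comp_hasFDerivAt x h2
  simp only [gradient]
  have h5 := (h1.hasFDerivAt.mul h4).fderiv
  simp only [Function.comp_def] at h5
  have h6 : fderiv ℝ (fun x => φ x * F (ψ x)) x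
      = fderiv ℝ (φ * fun x => F (ψ x)) x := rfl
  rw [h6, h5, map_add, map_smul, map_smul, map_smul, smul_smul, add_comm]

/-- A nonnegative test function equal to `1` on `Ω` and with vanishing gradient there. -/
theorem exists_cutoff {Ω : Set (E n)} (hΩ : Bornology.IsBounded Ω) :
    ∃ χ : E n → ℝ, IsTestFunction χ ∧ (∀ x, 0 ≤ χ x) ∧
      ∀ x ∈ Ω, χ x = 1 ∧ ∇ χ x = 0 := by
  obtain ⟨R, hR, hsub⟩ := hΩ.subset_ball_lt 0 0
  let χ : ContDiffBump (0 : E n) := ⟨R, R + 1, hR, by linarith⟩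
  refine ⟨χ, ⟨χ.contDiff, χ.hasCompactSupport⟩, fun x => χ.nonneg, fun x hx => ⟨?_, ?_⟩⟩
  · exact χ.one_of_mem_closedBall (Metric.ball_subset_closedBall (hsub hx))
  · have h : (χ : E n → ℝ) =ᶠ[𝓝 x] fun _ => 1 := by
      filter_upwards [Metric.isOpen_ball.mem_nhds (hsub hx)] with y hy
      exact χ.one_of_mem_closedBall (Metric.ball_subset_closedBall hy)
    simp [gradient, h.fderiv_eq]

end TestFunctions

/-! ### Limits of test functions -/

/-- The test functions `ψ k` converge to `v`, and their gradients to `V`, in the norms defining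
`Y₁²(Ω)` and almost everywhere. -/
structure YLim {n : ℕ} (Ω : Set (E n)) (ψ : ℕ → E n → ℝ) (v : E n → ℝ) (V : E n → E n) :
    Prop where
  test : ∀ k, IsTestFunction (ψ k)
  memLp : MemLp v (sobolevExponent n) (volume.restrict Ω)
  memLp_gradient : MemLp V 2 (volume.restrict Ω)
  tendsto : Tendsto (fun k => eLpNorm (fun x => ψ k x - v x) (sobolevExponent n)
    (volume.restrict Ω)) atTop (𝓝 0)
  tendsto_gradient : Tendsto (fun k => eLpNorm (fun x => ∇ (ψ k) x - V x) 2
    (volume.restrict Ω)) atTop (𝓝 0)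
  tendsto_ae : ∀ᵐ x ∂(volume.restrict Ω), Tendsto (fun k => ψ k x) atTop (𝓝 (v x))

section YLim

variable {n : ℕ} {Ω : Set (E n)} {ψ : ℕ → E n → ℝ} {v : E n → ℝ} {V : E n → E n}

/-- Norm convergence gives a.e. convergence along a subsequence. The predicate `Q` carries along a
property of the approximants, in practice nonnegativity, which the sign conditions need. -/
theorem exists_yLim (hn : 3 ≤ n) {Q : (E n → ℝ) → Prop} (hQ : ∀ k, Q (ψ k))
    (hψ : ∀ k, IsTestFunction (ψ k))
    (hv : MemLp v (sobolevExponent n) (volume.restrict Ω)) (hV : MemLp V 2 (volume.restrict Ω))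
    (h1 : Tendsto (fun k => eLpNorm (fun x => ψ k x - v x) (sobolevExponent n)
      (volume.restrict Ω)) atTop (𝓝 0))
    (h2 : Tendsto (fun k => eLpNorm (fun x => ∇ (ψ k) x - V x) 2
      (volume.restrict Ω)) atTop (𝓝 0)) : ∃ ψ', YLim Ω ψ' v V ∧ ∀ k, Q (ψ' k) := by
  have h := tendstoInMeasure_of_tendsto_eLpNorm (sobolevExponent_ne_zero hn)
    (fun k => ((hψ k).memLp 1 Ω).1) hv.1 h1
  obtain ⟨ns, hns, hae⟩ := h.exists_seq_tendsto_ae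
  exact ⟨fun k => ψ (ns k), ⟨fun k => hψ _, hv, hV, h1.comp hns.tendsto_atTop,
    h2.comp hns.tendsto_atTop, hae⟩, fun k => hQ _⟩

theorem HasYGradient.exists_yLim (hn : 3 ≤ n) (h : HasYGradient Ω v V) : ∃ ψ, YLim Ω ψ v V := by
  obtain ⟨ψ, hψ, h1, h2⟩ := h.approx
  obtain ⟨ψ', hψ', -⟩ := NeumannProblem.exists_yLim hn (Q := fun _ => True) (fun _ => trivial) hψ
    h.memLp h.memLp_gradient h1 h2
  exact ⟨ψ', hψ'⟩

theorem abs_sub_le_of_deriv_le {F : ℝ → ℝ} (hF : ContDiff ℝ ∞ F) {K : ℝ}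
    (hK : ∀ t, |deriv F t| ≤ K) (s t : ℝ) : |F s - F t| ≤ K * |s - t| := by
  have hd : Differentiable ℝ F := hF.differentiable (by simp)
  have hl : LipschitzWith K.toNNReal F := lipschitzWith_of_nnnorm_deriv_le hd fun x => by
    rw [← NNReal.coe_le_coe, coe_nnnorm, Real.coe_toNNReal']
    exact (hK x).trans (le_max_left _ _)
  have h := hl.dist_le_mul s t
  rwa [Real.coe_toNNReal _ ((abs_nonneg _).trans (hK 0)), Real.dist_eq, Real.dist_eq] at h

theorem memLp_comp_of_deriv_le [IsFiniteMeasure (volume.restrict Ω)] {p : ℝ≥0∞}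
    (hv : MemLp v p (volume.restrict Ω)) {F : ℝ → ℝ} (hF : ContDiff ℝ ∞ F) {K : ℝ}
    (hK : ∀ t, |deriv F t| ≤ K) : MemLp (fun x => F (v x)) p (volume.restrict Ω) := by
  have h0 : MemLp (fun x => |F 0| + K * |v x|) p (volume.restrict Ω) :=
    (memLp_const |F 0|).add (hv.norm.const_mul K)
  refine h0.mono' (hF.continuous.comp_aestronglyMeasurable hv.1) (Eventually.of_forall fun x => ?_)
  have := abs_sub_le_of_deriv_le hF hK (v x) 0
  rw [sub_zero] at this
  have h3 := abs_sub_abs_le_abs_sub (F (v x)) (F 0)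
  rw [Real.norm_eq_abs]
  linarith

theorem YLim.tendsto_two (hn : 3 ≤ n) [IsFiniteMeasure (volume.restrict Ω)] (h : YLim Ω ψ v V) :
    Tendsto (fun k => eLpNorm (fun x => ψ k x - v x) 2 (volume.restrict Ω)) atTop (𝓝 0) := by
  refine tendsto_zero_of_le_mul
    (C := volume.restrict Ω Set.univ ^ (1 / (2 : ℝ≥0∞).toReal
      - 1 / (sobolevExponent n).toReal)) ?_ h.tendsto fun k => ?_
  · refine ENNReal.rpow_ne_top_of_nonneg ?_ (measure_ne_top _ _)
    rw [sub_nonneg]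
    exact one_div_le_one_div_of_le (by simp)
      (ENNReal.toReal_mono sobolevExponent_ne_top (two_le_sobolevExponent hn))
  · rw [mul_comm]
    exact eLpNorm_le_eLpNorm_mul_rpow_measure_univ (μ := volume.restrict Ω)
      (two_le_sobolevExponent hn)
      ((h.test k).1.continuous.aestronglyMeasurable.sub h.memLp.1)

/-- The chain rule at the level of approximations: `F` is Lipschitz, so the functions converge in
norm, and the gradient error splits into two terms of the same kind and one in which only `F'`
varies. -/
theorem YLim.mul_comp (hn : 3 ≤ n) [IsFiniteMeasure (volume.restrict Ω)] (h : YLim Ω ψ v V)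
    {η : E n → ℝ} (hη : IsTestFunction η) {F : ℝ → ℝ} (hF : ContDiff ℝ ∞ F) {K : ℝ}
    (hK : ∀ t, |deriv F t| ≤ K) :
    YLim Ω (fun k x => η x * F (ψ k x)) (fun x => η x * F (v x))
      (fun x => F (v x) • ∇ η x + (η x * deriv F (v x)) • V x) := by
  obtain ⟨C, hC0, hC, hC'⟩ := hη.exists_bound
  have hK0 : 0 ≤ K := (abs_nonneg _).trans (hK 0)
  have hd : Continuous (deriv F) := hF.continuous_deriv (by simp)
  have hFv := memLp_comp_of_deriv_le h.memLp hF hK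
  have hFv2 : MemLp (fun x => F (v x)) 2 (volume.restrict Ω) :=
    hFv.mono_exponent (two_le_sobolevExponent hn)
  have hηm : AEStronglyMeasurable η (volume.restrict Ω) := hη.1.continuous.aestronglyMeasurable
  have hηm' : AEStronglyMeasurable (∇ η) (volume.restrict Ω) :=
    hη.continuous_gradient.aestronglyMeasurable
  have hdv : AEStronglyMeasurable (fun x => deriv F (v x)) (volume.restrict Ω) :=
    hd.comp_aestronglyMeasurable h.memLp.1
  have hψm : ∀ k, AEStronglyMeasurable (ψ k) (volume.restrict Ω) :=
    fun k => (h.test k).1.continuous.aestronglyMeasurable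
  have hψm' : ∀ k, AEStronglyMeasurable (∇ (ψ k)) (volume.restrict Ω) :=
    fun k => (h.test k).continuous_gradient.aestronglyMeasurable
  refine ⟨fun k => hη.mul_comp (h.test k) hF, ?_, ?_, ?_, ?_, ?_⟩
  · refine MemLp.of_le_mul (c := C) hFv (hηm.mul hFv.1) (Eventually.of_forall fun x => ?_)
    rw [norm_mul]
    exact mul_le_mul_of_nonneg_right (hC x) (norm_nonneg _)
  · refine MemLp.add ?_ ?_
    · refine MemLp.of_le_mul (c := C) hFv2 (hFv2.1.smul hηm') (Eventually.of_forall fun x => ?_)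
      rw [norm_smul, mul_comm]
      exact mul_le_mul_of_nonneg_right (hC' x) (norm_nonneg _)
    · refine MemLp.of_le_mul (c := C * K) h.memLp_gradient
        ((hηm.mul hdv).smul h.memLp_gradient.1) (Eventually.of_forall fun x => ?_)
      rw [norm_smul, norm_mul]
      exact mul_le_mul_of_nonneg_right
        (mul_le_mul (hC x) (hK _) (norm_nonneg _) hC0) (norm_nonneg _)
  · refine tendsto_zero_of_le_mul (C := ENNReal.ofReal (C * K)) ENNReal.ofReal_ne_top h.tendsto
      fun k => eLpNorm_le_mul_eLpNorm_of_ae_le_mul (Eventually.of_forall fun x => ?_) _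
    rw [← mul_sub, norm_mul, mul_assoc]
    exact mul_le_mul (hC x) (abs_sub_le_of_deriv_le hF hK _ _) (norm_nonneg _) hC0
  · have t1 : Tendsto (fun k => eLpNorm (fun x => (F (ψ k x) - F (v x)) • ∇ η x) 2
        (volume.restrict Ω)) atTop (𝓝 0) := by
      refine tendsto_zero_of_le_mul (C := ENNReal.ofReal (K * C)) ENNReal.ofReal_ne_top
        (h.tendsto_two hn)
        fun k => eLpNorm_le_mul_eLpNorm_of_ae_le_mul (Eventually.of_forall fun x => ?_) _
      rw [norm_smul, mul_right_comm]
      exact mul_le_mul (abs_sub_le_of_deriv_le hF hK _ _) (hC' x) (norm_nonneg _) (by positivity)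
    have t2 : Tendsto (fun k => eLpNorm (fun x => (η x * deriv F (ψ k x)) • (∇ (ψ k) x - V x)) 2
        (volume.restrict Ω)) atTop (𝓝 0) := by
      refine tendsto_zero_of_le_mul (C := ENNReal.ofReal (C * K)) ENNReal.ofReal_ne_top
        h.tendsto_gradient
        fun k => eLpNorm_le_mul_eLpNorm_of_ae_le_mul (Eventually.of_forall fun x => ?_) _
      rw [norm_smul, norm_mul]
      exact mul_le_mul_of_nonneg_right
        (mul_le_mul (hC x) (hK _) (norm_nonneg _) hC0) (norm_nonneg _)
    -- No Lipschitz bound on `F'` is available; its mere continuity together with a.e. convergence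
    -- of `ψ k` gives this term by dominated convergence.
    have t3 : Tendsto (fun k => eLpNorm (fun x => (η x * (deriv F (ψ k x) - deriv F (v x))) • V x) 2
        (volume.restrict Ω)) atTop (𝓝 0) := by
      refine tendsto_eLpNorm_zero_of_dominated two_ne_zero ENNReal.ofNat_ne_top h.memLp_gradient
        (C := C * (2 * K)) (fun k => ?_) (fun k => Eventually.of_forall fun x => ?_) ?_
      · exact (hηm.mul ((hd.comp_aestronglyMeasurable (hψm k)).sub hdv)).smul h.memLp_gradient.1
      · rw [norm_smul, norm_mul]
        refine mul_le_mul_of_nonneg_right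
          (mul_le_mul (hC x) ?_ (norm_nonneg _) hC0) (norm_nonneg _)
        refine (norm_sub_le _ _).trans ?_
        rw [Real.norm_eq_abs, Real.norm_eq_abs]
        linarith [hK (ψ k x), hK (v x)]
      · filter_upwards [h.tendsto_ae] with x hx
        have h1 := (hd.tendsto (v x)).comp hx
        have h2 := (((h1.sub_const (deriv F (v x))).const_mul (η x)).smul_const (V x))
        simpa using h2
    refine tendsto_of_tendsto_of_tendsto_of_le_of_le tendsto_const_nhds
      (by simpa using (t1.add t2).add t3) (fun _ => zero_le) fun k => ?_
    have m1 : AEStronglyMeasurable (fun x => (F (ψ k x) - F (v x)) • ∇ η x)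
        (volume.restrict Ω) :=
      ((hF.continuous.comp_aestronglyMeasurable (hψm k)).sub hFv.1).smul hηm'
    have m2 : AEStronglyMeasurable (fun x => (η x * deriv F (ψ k x)) • (∇ (ψ k) x - V x))
        (volume.restrict Ω) :=
      (hηm.mul (hd.comp_aestronglyMeasurable (hψm k))).smul ((hψm' k).sub h.memLp_gradient.1)
    have m3 : AEStronglyMeasurable (fun x => (η x * (deriv F (ψ k x) - deriv F (v x))) • V x)
        (volume.restrict Ω) :=
      (hηm.mul ((hd.comp_aestronglyMeasurable (hψm k)).sub hdv)).smul h.memLp_gradient.1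
    refine le_trans (le_of_eq ?_) ((eLpNorm_add_le (m1.add m2) m3 (by norm_num)).trans
      (add_le_add_left (eLpNorm_add_le m1 m2 (by norm_num)) _))
    congr 1
    ext1 x
    rw [hη.gradient_mul_comp (h.test k) hF]
    simp only [Pi.add_apply]
    module
  · filter_upwards [h.tendsto_ae] with x hx
    exact ((hF.continuous.tendsto _).comp hx).const_mul _

theorem YLim.congr (h : YLim Ω ψ v V) {w : E n → ℝ} {W : E n → E n}
    (hv : v =ᵐ[volume.restrict Ω] w) (hV : V =ᵐ[volume.restrict Ω] W) : YLim Ω ψ w W := by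
  refine ⟨h.test, h.memLp.ae_eq hv, h.memLp_gradient.ae_eq hV, ?_, ?_, ?_⟩
  · refine h.tendsto.congr fun k => eLpNorm_congr_ae ?_
    filter_upwards [hv] with x hx
    rw [hx]
  · refine h.tendsto_gradient.congr fun k => eLpNorm_congr_ae ?_
    filter_upwards [hV] with x hx
    rw [hx]
  · filter_upwards [h.tendsto_ae, hv] with x hx hx'
    rwa [← hx']

/-- If `F 0 ≠ 0` then `F (ψ k)` is not compactly supported. The cutoff `χ` repairs this and is
invisible on `Ω`, where it equals `1` with zero gradient. -/
theorem YLim.comp (hn : 3 ≤ n) [IsFiniteMeasure (volume.restrict Ω)] (hΩ : MeasurableSet Ω)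
    (h : YLim Ω ψ v V)
    {χ : E n → ℝ} (hχ : IsTestFunction χ) (hχ1 : ∀ x ∈ Ω, χ x = 1 ∧ ∇ χ x = 0)
    {F : ℝ → ℝ} (hF : ContDiff ℝ ∞ F) {K : ℝ} (hK : ∀ t, |deriv F t| ≤ K) :
    YLim Ω (fun k x => χ x * F (ψ k x)) (fun x => F (v x)) (fun x => deriv F (v x) • V x) := by
  refine (h.mul_comp hn hχ hF hK).congr ?_ ?_ <;>
  · filter_upwards [ae_restrict_mem hΩ] with x hx
    simp [hχ1 x hx]

/-- A limit of limits of test functions is a limit of test functions. -/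
theorem exists_yLim_of_tendsto (hn : 3 ≤ n) {Φ : ℕ → ℕ → E n → ℝ} {w : ℕ → E n → ℝ}
    {W : ℕ → E n → E n} (h : ∀ j, YLim Ω (Φ j) (w j) (W j))
    {Q : (E n → ℝ) → Prop} (hQ : ∀ j k, Q (Φ j k))
    (hv : MemLp v (sobolevExponent n) (volume.restrict Ω)) (hV : MemLp V 2 (volume.restrict Ω))
    (h1 : Tendsto (fun k => eLpNorm (fun x => w k x - v x) (sobolevExponent n)
      (volume.restrict Ω)) atTop (𝓝 0))
    (h2 : Tendsto (fun k => eLpNorm (fun x => W k x - V x) 2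
      (volume.restrict Ω)) atTop (𝓝 0)) : ∃ ψ, YLim Ω ψ v V ∧ ∀ k, Q (ψ k) := by
  have hp := one_le_sobolevExponent hn
  have key : ∀ j : ℕ, ∃ k, eLpNorm (fun x => Φ j k x - w j x) (sobolevExponent n)
      (volume.restrict Ω) ≤ ((j : ℝ≥0∞) + 1)⁻¹ ∧
      eLpNorm (fun x => ∇ (Φ j k) x - W j x) 2 (volume.restrict Ω) ≤ ((j : ℝ≥0∞) + 1)⁻¹ := by
    intro j
    have hpos : (0 : ℝ≥0∞) < ((j : ℝ≥0∞) + 1)⁻¹ := by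
      rw [ENNReal.inv_pos]; finiteness
    exact (((h j).tendsto.eventually_le_const hpos).and
      ((h j).tendsto_gradient.eventually_le_const hpos)).exists
  choose k hk1 hk2 using key
  have h0 : Tendsto (fun j : ℕ => ((j : ℝ≥0∞) + 1)⁻¹) atTop (𝓝 0) := by
    have := (tendsto_add_atTop_iff_nat 1).2 ENNReal.tendsto_inv_nat_nhds_zero
    simpa using this
  refine exists_yLim hn (fun j => hQ j (k j)) (fun j => (h j).test (k j)) hv hV ?_ ?_
  · refine tendsto_of_tendsto_of_tendsto_of_le_of_le tendsto_const_nhds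
      (by simpa using h0.add h1) (fun _ => zero_le) fun j => ?_
    refine le_trans (le_of_eq ?_) ((eLpNorm_add_le ((((h j).test (k j)).memLp 1 Ω).1.sub
      (h j).memLp.1) ((h j).memLp.1.sub hv.1) hp).trans (add_le_add_left (hk1 j) _))
    congr 1
    ext x
    simp
  · refine tendsto_of_tendsto_of_tendsto_of_le_of_le tendsto_const_nhds
      (by simpa using h0.add h2) (fun _ => zero_le) fun j => ?_
    refine le_trans (le_of_eq ?_) ((eLpNorm_add_le ((((h j).test (k j)).memLp_gradient 1 Ω).1.sub
      (h j).memLp_gradient.1) ((h j).memLp_gradient.1.sub hV.1) (by norm_num)).trans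
      (add_le_add_left (hk2 j) _))
    congr 1
    ext1 x
    simp

/-- A continuous linear functional on `Y₁²(Ω)` passes to the limit. -/
theorem YLim.tendsto_functional (hn : 3 ≤ n) (h : YLim Ω ψ v V) {X : E n → E n} {y : E n → ℝ}
    (hX : MemLp X 2 (volume.restrict Ω)) (hy : MemLp y (dualExponent n) (volume.restrict Ω)) :
    Tendsto (fun k => ∫ x in Ω, (inner ℝ (X x) (∇ (ψ k) x) + y x * ψ k x)) atTop
      (𝓝 (∫ x in Ω, (inner ℝ (X x) (V x) + y x * v x))) := by
  have := holderConjugate_dual_sobolev hn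
  obtain ⟨i1, i2, i3⟩ := tendsto_integral_inner (q := 2) hX
    (fun k => (h.test k).memLp_gradient 2 Ω) h.memLp_gradient h.tendsto_gradient
  obtain ⟨j1, j2, j3⟩ := tendsto_integral_inner hy
    (fun k => (h.test k).memLp (sobolevExponent n) Ω) h.memLp h.tendsto
  have hc : ∀ a b : ℝ, (inner ℝ a b : ℝ) = a * b := fun a b => by simp [mul_comm]
  simp only [hc] at j1 j2 j3
  rw [integral_add i2 j2]
  refine (i3.add j3).congr fun k => ?_
  rw [integral_add (i1 k) (j1 k)]

end YLim

/-! ### The Poincaré inequality on convex sets -/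

section Segments

variable {n : ℕ}

theorem enorm_sub_le_lintegral_segment {X : Type*} [NormedAddCommGroup X] [NormedSpace ℝ X]
    {g : X → ℝ} (hg : ContDiff ℝ 1 g) (x v : X) {s : ℝ} (hs : s ∈ Set.Icc (0 : ℝ) 1) :
    ‖g (x + s • v) - g x‖ₑ ≤ ∫⁻ t in Set.Icc (0 : ℝ) 1, ‖fderiv ℝ g (x + t • v)‖ₑ * ‖v‖ₑ := by
  have hf : ContDiff ℝ 1 (fun t : ℝ => g (x + t • v)) := by fun_prop
  have h := enorm_sub_le_lintegral_deriv_of_contDiffOn_Icc (hf.contDiffOn (s := Set.Icc 0 s)) hs.1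
  simp only [zero_smul, add_zero] at h
  refine h.trans ((lintegral_mono_set (Set.Icc_subset_Icc_right hs.2)).trans
    (lintegral_mono fun t => ?_))
  have h1 : HasDerivAt (fun t : ℝ => x + t • v) v t := by
    simpa using ((hasDerivAt_id t).smul_const v).const_add x
  have h2 := (hg.differentiable (by simp) (x + t • v)).hasFDerivAt.comp_hasDerivAt t h1
  simp only [Function.comp_def] at h2
  rw [h2.deriv]
  exact (fderiv ℝ g (x + t • v)).le_opENorm v

theorem lintegral_comp_smul_add {G : E n → ℝ≥0∞} (hG : Measurable G) {r : ℝ} (hr : r ≠ 0)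
    (c : E n) : ∫⁻ x, G (r • x + c) = ENNReal.ofReal |(r ^ n)⁻¹| * ∫⁻ x, G x := by
  have h1 : ∫⁻ x, G (r • x + c) = ∫⁻ x, G (x + c) ∂(Measure.map (r • ·) volume) := by
    rw [lintegral_map (by fun_prop) (by fun_prop)]
  rw [h1, Measure.map_addHaar_smul volume hr, lintegral_smul_measure,
    lintegral_add_right_eq_self G c]
  simp

theorem enorm_gradient (φ : E n → ℝ) (x : E n) : ‖∇ φ x‖ₑ = ‖fderiv ℝ φ x‖ₑ := by
  rw [gradient, ← ofReal_norm, LinearIsometryEquiv.norm_map, ofReal_norm]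

/-- The segment from `x` to `y` is cut at the midpoint. On the half next to `x`, the point `(1 -
t/2) x + (t/2) y` depends on `x` with ratio at least `1/2`, so substituting in `x` costs at most `2
^ n`. The other half follows by exchanging `x` and `y`. -/
theorem IsTestFunction.lintegral_lintegral_enorm_sub_le {φ : E n → ℝ} (hφ : IsTestFunction φ)
    {B : Set (E n)} (hB : Convex ℝ B) (hBm : MeasurableSet B) {D : ℝ≥0}
    (hD : ∀ x ∈ B, ∀ y ∈ B, ‖y - x‖ₑ ≤ D) :
    ∫⁻ x in B, ∫⁻ y in B, ‖φ x - φ y‖ₑ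
      ≤ 2 * (D * (volume B * (2 ^ n * ∫⁻ x in B, ‖∇ φ x‖ₑ))) := by
  have hc : Continuous φ := hφ.1.continuous
  set G : E n → ℝ≥0∞ := B.indicator fun x => ‖∇ φ x‖ₑ with hG
  have hGm : Measurable G := hφ.continuous_gradient.enorm.measurable.indicator hBm
  have hGint : ∫⁻ x, G x = ∫⁻ x in B, ‖∇ φ x‖ₑ := lintegral_indicator hBm _
  have hm : ∀ x ∈ B, ∀ y ∈ B, ‖φ x - φ ((1 / 2 : ℝ) • (x + y))‖ₑ
      ≤ D * ∫⁻ t in Set.Icc (0 : ℝ) 1, G ((1 - t / 2) • x + (t / 2) • y) := by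
    intro x hx y hy
    have h := enorm_sub_le_lintegral_segment (hφ.1.of_le (by simp)) x ((1 / 2 : ℝ) • (y - x))
      (s := 1) (by simp)
    rw [← lintegral_const_mul' _ _ (by simp)]
    have e1 : x + (1 : ℝ) • (1 / 2 : ℝ) • (y - x) = (1 / 2 : ℝ) • (x + y) := by module
    rw [e1, ← neg_sub, enorm_neg] at h
    refine h.trans (setLIntegral_mono' measurableSet_Icc fun t ht => ?_)
    have e2 : x + t • (1 / 2 : ℝ) • (y - x) = (1 - t / 2) • x + (t / 2) • y := by module
    have hmem : (1 - t / 2) • x + (t / 2) • y ∈ B :=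
      hB hx hy (by linarith [ht.2]) (by linarith [ht.1]) (by ring)
    rw [e2, mul_comm, hG, Set.indicator_of_mem hmem, enorm_gradient]
    gcongr
    refine le_trans ?_ (hD x hx y hy)
    rw [enorm_smul]
    refine mul_le_of_le_one_left zero_le ?_
    rw [← ofReal_norm, ENNReal.ofReal_le_one]
    norm_num
  have half : ∫⁻ x in B, ∫⁻ y in B, ‖φ x - φ ((1 / 2 : ℝ) • (x + y))‖ₑ
      ≤ D * (volume B * (2 ^ n * ∫⁻ x in B, ‖∇ φ x‖ₑ)) := by
    have hF : Measurable fun z : E n × E n × ℝ => G ((1 - z.2.2 / 2) • z.1 + (z.2.2 / 2) • z.2.1) :=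
      hGm.comp (by fun_prop)
    calc ∫⁻ x in B, ∫⁻ y in B, ‖φ x - φ ((1 / 2 : ℝ) • (x + y))‖ₑ
        ≤ ∫⁻ x in B, ∫⁻ y in B,
          D * ∫⁻ t in Set.Icc (0 : ℝ) 1, G ((1 - t / 2) • x + (t / 2) • y) :=
          setLIntegral_mono' hBm fun x hx => setLIntegral_mono' hBm fun y hy => hm x hx y hy
      _ = D * ∫⁻ x in B, ∫⁻ y in B,
          ∫⁻ t in Set.Icc (0 : ℝ) 1, G ((1 - t / 2) • x + (t / 2) • y) := by
          rw [← lintegral_const_mul' _ _ (by simp)]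
          refine lintegral_congr fun x => ?_
          rw [← lintegral_const_mul' _ _ (by simp)]
      _ = D * ∫⁻ y in B, ∫⁻ t in Set.Icc (0 : ℝ) 1,
          ∫⁻ x in B, G ((1 - t / 2) • x + (t / 2) • y) := by
          congr 1
          rw [lintegral_lintegral_swap]
          · refine lintegral_congr fun y => ?_
            rw [lintegral_lintegral_swap]
            exact (hF.comp (f := fun z : E n × ℝ => (z.1, y, z.2)) (by fun_prop)).aemeasurable
          · exact (Measurable.lintegral_prod_right'
              (f := fun z : (E n × E n) × ℝ => G ((1 - z.2 / 2) • z.1.1 + (z.2 / 2) • z.1.2))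
              (hF.comp (f := fun z : (E n × E n) × ℝ => (z.1.1, z.1.2, z.2))
                (by fun_prop))).aemeasurable
      _ ≤ D * ∫⁻ y in B, ∫⁻ t in Set.Icc (0 : ℝ) 1, 2 ^ n * ∫⁻ x, G x := by
          refine mul_le_mul le_rfl (lintegral_mono fun y => setLIntegral_mono' measurableSet_Icc
            fun t ht => ?_) zero_le zero_le
          refine (setLIntegral_le_lintegral _ _).trans ?_
          -- This is where the midpoint matters: on the full segment the ratio would degenerate to
          -- `0`.
          have hr : (1 / 2 : ℝ) ≤ 1 - t / 2 := by linarith [ht.2]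
          rw [lintegral_comp_smul_add hGm (by linarith)]
          gcongr
          rw [← inv_pow, abs_of_nonneg (pow_nonneg (inv_nonneg.2 (by linarith)) _),
            ENNReal.ofReal_pow (inv_nonneg.2 (by linarith))]
          refine pow_le_pow_left' ?_ n
          rw [show (2 : ℝ≥0∞) = ENNReal.ofReal 2 by simp]
          refine ENNReal.ofReal_le_ofReal ?_
          rw [inv_le_comm₀ (by linarith) (by norm_num)]
          linarith
      _ = _ := by
          rw [hGint]
          simp only [lintegral_const, Measure.restrict_apply_univ, Real.volume_Icc, sub_zero,
            ENNReal.ofReal_one, mul_one]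
          rw [mul_comm (volume B)]
  have hswap : ∫⁻ x in B, ∫⁻ y in B, ‖φ ((1 / 2 : ℝ) • (x + y)) - φ y‖ₑ
      = ∫⁻ x in B, ∫⁻ y in B, ‖φ x - φ ((1 / 2 : ℝ) • (x + y))‖ₑ := by
    rw [lintegral_lintegral_swap]
    · refine lintegral_congr fun x => lintegral_congr fun y => ?_
      rw [← enorm_neg, neg_sub, add_comm x y]
    · exact (Continuous.measurable (by fun_prop)).aemeasurable
  calc ∫⁻ x in B, ∫⁻ y in B, ‖φ x - φ y‖ₑ
      ≤ ∫⁻ x in B, ∫⁻ y in B, (‖φ x - φ ((1 / 2 : ℝ) • (x + y))‖ₑ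
        + ‖φ ((1 / 2 : ℝ) • (x + y)) - φ y‖ₑ) := by
        refine lintegral_mono fun x => lintegral_mono fun y => ?_
        refine le_trans (le_of_eq ?_) (enorm_add_le _ _)
        congr 1; ring
    _ = ∫⁻ x in B, ((∫⁻ y in B, ‖φ x - φ ((1 / 2 : ℝ) • (x + y))‖ₑ)
        + ∫⁻ y in B, ‖φ ((1 / 2 : ℝ) • (x + y)) - φ y‖ₑ) :=
        lintegral_congr fun x => lintegral_add_left (Continuous.measurable (by fun_prop)) _
    _ = (∫⁻ x in B, ∫⁻ y in B, ‖φ x - φ ((1 / 2 : ℝ) • (x + y))‖ₑ)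
        + ∫⁻ x in B, ∫⁻ y in B, ‖φ ((1 / 2 : ℝ) • (x + y)) - φ y‖ₑ := by
        refine lintegral_add_left ?_ _
        exact Measurable.lintegral_prod_right'
          (f := fun z : E n × E n => ‖φ z.1 - φ ((1 / 2 : ℝ) • (z.1 + z.2))‖ₑ)
          (Continuous.measurable (by fun_prop))
    _ ≤ _ := by
        rw [hswap, ← two_mul]
        gcongr

/-- The Poincaré inequality for limits of test functions. -/
theorem YLim.lintegral_lintegral_enorm_sub_le {Ω : Set (E n)} {ψ : ℕ → E n → ℝ} {v : E n → ℝ}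
    {V : E n → E n} (h : YLim Ω ψ v V) {B : Set (E n)} (hBΩ : B ⊆ Ω)
    (hB : Convex ℝ B) (hBm : MeasurableSet B) (hBf : volume B ≠ ⊤) {D : ℝ≥0}
    (hD : ∀ x ∈ B, ∀ y ∈ B, ‖y - x‖ₑ ≤ D) :
    ∫⁻ x in B, ∫⁻ y in B, ‖v x - v y‖ₑ
      ≤ 2 * (D * (volume B * (2 ^ n * ∫⁻ x in B, ‖V x‖ₑ))) := by
  have hle : volume.restrict B ≤ volume.restrict Ω := Measure.restrict_mono hBΩ le_rfl
  have : IsFiniteMeasure (volume.restrict B) := ⟨by simpa using hBf.lt_top⟩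
  have hae : ∀ᵐ x ∂(volume.restrict B), Tendsto (fun k => ψ k x) atTop (𝓝 (v x)) :=
    ae_mono hle h.tendsto_ae
  have hL1 : Tendsto (fun k => ∫⁻ x in B, ‖∇ (ψ k) x - V x‖ₑ) atTop (𝓝 0) := by
    have h0 : Tendsto (fun k => eLpNorm (fun x => ∇ (ψ k) x - V x) 2 (volume.restrict B))
        atTop (𝓝 0) :=
      tendsto_of_tendsto_of_tendsto_of_le_of_le tendsto_const_nhds h.tendsto_gradient
        (fun _ => zero_le) fun k => eLpNorm_mono_measure _ hle
    refine tendsto_zero_of_le_mul (C := volume.restrict B Set.univ ^ (1 / (1 : ℝ≥0∞).toReal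
            - 1 / (2 : ℝ≥0∞).toReal)) ?_ h0 fun k => ?_
    · exact ENNReal.rpow_ne_top_of_nonneg (by norm_num) (measure_ne_top _ _)
    · rw [mul_comm, ← eLpNorm_one_eq_lintegral_enorm]
      exact eLpNorm_le_eLpNorm_mul_rpow_measure_univ (by norm_num)
        (((h.test k).continuous_gradient.aestronglyMeasurable).sub
          (h.memLp_gradient.1.mono_measure hle))
  have hR : Tendsto (fun k => 2 * (D * (volume B * (2 ^ n * ((∫⁻ x in B, ‖V x‖ₑ)
      + ∫⁻ x in B, ‖∇ (ψ k) x - V x‖ₑ))))) atTop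
      (𝓝 (2 * (D * (volume B * (2 ^ n * ((∫⁻ x in B, ‖V x‖ₑ) + 0)))))) := by
    refine ENNReal.Tendsto.const_mul ?_ (Or.inr (by simp))
    refine ENNReal.Tendsto.const_mul ?_ (Or.inr (by simp))
    refine ENNReal.Tendsto.const_mul ?_ (Or.inr hBf)
    refine ENNReal.Tendsto.const_mul ?_ (Or.inr (by simp))
    exact tendsto_const_nhds.add hL1
  rw [add_zero] at hR
  have hmeas : ∀ k, Measurable fun z : E n × E n => ‖ψ k z.1 - ψ k z.2‖ₑ := fun k => by
    have := (h.test k).1.continuous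
    exact Continuous.measurable (by fun_prop)
  -- Fatou's lemma in each variable on the left; on the right the gradients converge in `L¹(B)`, as
  -- `B` has finite measure.
  rw [← hR.liminf_eq]
  refine le_trans (b := liminf (fun k => ∫⁻ x in B, ∫⁻ y in B, ‖ψ k x - ψ k y‖ₑ) atTop) ?_
    (liminf_le_liminf (Eventually.of_forall fun k => ?_))
  · calc ∫⁻ x in B, ∫⁻ y in B, ‖v x - v y‖ₑ
        ≤ ∫⁻ x in B, liminf (fun k => ∫⁻ y in B, ‖ψ k x - ψ k y‖ₑ) atTop := by
          refine lintegral_mono_ae ?_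
          filter_upwards [hae] with x hx
          refine le_trans (lintegral_mono_ae ?_) (lintegral_liminf_le fun k =>
            (hmeas k).comp measurable_prodMk_left)
          filter_upwards [hae] with y hy
          exact (hx.sub hy).enorm.liminf_eq.ge
      _ ≤ _ := lintegral_liminf_le fun k => (hmeas k).lintegral_prod_right'
  · refine ((h.test k).lintegral_lintegral_enorm_sub_le hB hBm hD).trans ?_
    gcongr
    rw [← lintegral_add_left' (h.memLp_gradient.1.mono_measure hle).enorm]
    refine lintegral_mono fun x => ?_
    refine le_trans (le_of_eq ?_) (enorm_add_le _ _)
    congr 1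
    abel

end Segments

/-! ### Smooth cutoff functions of one variable -/

section Cutoff

theorem contDiff_smoothTransition_comp (α β : ℝ) :
    ContDiff ℝ ∞ fun t : ℝ => Real.smoothTransition (α * t + β) :=
  Real.smoothTransition.contDiff.comp (by fun_prop)

theorem deriv_smoothTransition_of_notMem {s : ℝ} (hs : s ∉ Set.Icc (0 : ℝ) 1) :
    deriv Real.smoothTransition s = 0 := by
  rcases lt_or_ge s 0 with h | h
  · have : Real.smoothTransition =ᶠ[𝓝 s] fun _ => 0 := by
      filter_upwards [Iio_mem_nhds h] with t ht
      exact Real.smoothTransition.zero_of_nonpos (le_of_lt ht)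
    rw [this.deriv_eq, deriv_const]
  · have h1 : 1 < s := by
      by_contra h2
      exact hs ⟨h, not_lt.1 h2⟩
    have : Real.smoothTransition =ᶠ[𝓝 s] fun _ => 1 := by
      filter_upwards [Ioi_mem_nhds h1] with t ht
      exact Real.smoothTransition.one_of_one_le (le_of_lt ht)
    rw [this.deriv_eq, deriv_const]

/-- The derivative of the step vanishes off `[0, 1]`. At `s = α t + β` the second quantity is `α t
σ'(α t + β)`, so its bound does not depend on the slope `α`; this gives Lipschitz bounds for ramps
of any steepness. -/
theorem exists_bound_deriv_smoothTransition (β : ℝ) : ∃ K, 0 ≤ K ∧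
    ∀ s : ℝ, |deriv Real.smoothTransition s| ≤ K ∧
      |(s - β) * deriv Real.smoothTransition s| ≤ K := by
  have hc : Continuous (deriv Real.smoothTransition) :=
    (Real.smoothTransition.contDiff (n := 1)).continuous_deriv (by simp)
  obtain ⟨K, hK⟩ := isCompact_Icc.exists_bound_of_continuousOn (s := Set.Icc (0 : ℝ) 1)
    hc.continuousOn
  obtain ⟨L, hL⟩ := isCompact_Icc.exists_bound_of_continuousOn (s := Set.Icc (0 : ℝ) 1)
    (f := fun s => (s - β) * deriv Real.smoothTransition s) (by fun_prop)
  have hK0 : 0 ≤ max K L := ((norm_nonneg _).trans (hK 0 (by simp))).trans (le_max_left _ _)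
  refine ⟨max K L, hK0, fun s => ?_⟩
  by_cases hs : s ∈ Set.Icc (0 : ℝ) 1
  · exact ⟨(hK s hs).trans (le_max_left _ _), (hL s hs).trans (le_max_right _ _)⟩
  · simpa [deriv_smoothTransition_of_notMem hs] using hK0

theorem hasDerivAt_smoothTransition_comp (α β t : ℝ) :
    HasDerivAt (fun t : ℝ => Real.smoothTransition (α * t + β))
      (α * deriv Real.smoothTransition (α * t + β)) t := by
  have h1 : HasDerivAt (fun t : ℝ => α * t + β) α t := by
    simpa using ((hasDerivAt_id t).const_mul α).add_const β
  have h2 : HasDerivAt Real.smoothTransition (deriv Real.smoothTransition (α * t + β))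
      (α * t + β) :=
    ((Real.smoothTransition.contDiff (n := 1)).differentiable (by simp) _).hasDerivAt
  rw [mul_comm]
  exact h2.comp t h1

/-- The function `t ↦ t σ(α t + β)`, where `σ` is the smooth transition from `0` to `1`. -/
def ramp (α β t : ℝ) : ℝ := t * Real.smoothTransition (α * t + β)

theorem contDiff_ramp (α β : ℝ) : ContDiff ℝ ∞ (ramp α β) :=
  contDiff_id.mul (contDiff_smoothTransition_comp α β)

theorem deriv_ramp (α β t : ℝ) : deriv (ramp α β) t = Real.smoothTransition (α * t + β)
    + α * t * deriv Real.smoothTransition (α * t + β) := by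
  have := ((hasDerivAt_id t).mul (hasDerivAt_smoothTransition_comp α β t)).deriv
  simp only [id_eq, one_mul] at this
  rw [show ramp α β = id * fun t : ℝ => Real.smoothTransition (α * t + β) from rfl, this]
  ring

theorem exists_bound_deriv_ramp (β : ℝ) : ∃ K, ∀ α t, |deriv (ramp α β) t| ≤ K := by
  obtain ⟨K, hK0, hK⟩ := exists_bound_deriv_smoothTransition β
  refine ⟨1 + K, fun α t => ?_⟩
  rw [deriv_ramp]
  refine (abs_add_le _ _).trans (add_le_add ?_ ?_)
  · rw [abs_of_nonneg (Real.smoothTransition.nonneg _)]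
    exact Real.smoothTransition.le_one _
  · have := (hK (α * t + β)).2
    rwa [add_sub_cancel_right] at this

theorem ramp_of_one_le {α β t : ℝ} (h : 1 ≤ α * t + β) : ramp α β t = t := by
  rw [ramp, Real.smoothTransition.one_of_one_le h, mul_one]

theorem ramp_of_nonpos {α β t : ℝ} (h : α * t + β ≤ 0) : ramp α β t = 0 := by
  rw [ramp, Real.smoothTransition.zero_of_nonpos h, mul_zero]

theorem deriv_ramp_of_one_lt {α β t : ℝ} (h : 1 < α * t + β) : deriv (ramp α β) t = 1 := by
  rw [deriv_ramp, Real.smoothTransition.one_of_one_le h.le,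
    deriv_smoothTransition_of_notMem fun h' => h.not_ge h'.2]
  ring

theorem abs_ramp_le (α β t : ℝ) : |ramp α β t| ≤ |t| := by
  rw [ramp, abs_mul, abs_of_nonneg (Real.smoothTransition.nonneg _)]
  exact mul_le_of_le_one_right (abs_nonneg _) (Real.smoothTransition.le_one _)

/-- A smooth function with bounded derivative which is `t` for `t ≥ 0` and is at least `- ε / 2`. -/
theorem neg_half_le_ramp {ε : ℝ} (hε : 0 < ε) (t : ℝ) : -(ε / 2) ≤ ramp (4 / ε) 2 t := by
  -- The argument `4 t / ε + 2` of the step is `≤ 0` exactly for `t ≤ -ε/2` and `≥ 1` exactly for `t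
  -- ≥ -ε/4`. So the ramp is the identity near every `t ≥ 0`, and its derivative is `1` at `0` too.
  rcases le_or_gt t (-(ε / 2)) with h | h
  · rw [ramp_of_nonpos]
    · linarith
    · have : 4 / ε * t ≤ 4 / ε * (-(ε / 2)) := mul_le_mul_of_nonneg_left h (by positivity)
      have h2 : 4 / ε * (-(ε / 2)) = -2 := by field_simp; norm_num
      linarith
  · rcases le_or_gt 0 t with h0 | h0
    · rw [ramp]
      have := mul_nonneg h0 (Real.smoothTransition.nonneg (4 / ε * t + 2))
      linarith
    · rw [ramp]
      nlinarith [Real.smoothTransition.nonneg (4 / ε * t + 2),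
        Real.smoothTransition.le_one (4 / ε * t + 2)]

theorem ramp_of_nonneg {ε t : ℝ} (hε : 0 < ε) (ht : 0 ≤ t) :
    ramp (4 / ε) 2 t = t ∧ deriv (ramp (4 / ε) 2) t = 1 := by
  have : 0 ≤ 4 / ε * t := by positivity
  exact ⟨ramp_of_one_le (by linarith), deriv_ramp_of_one_lt (by linarith)⟩

/-- A globally smooth version of `1 / (t + ε)`. -/
theorem exists_smooth_inv {ε : ℝ} (hε : 0 < ε) : ∃ (F : ℝ → ℝ) (K : ℝ), ContDiff ℝ ∞ F ∧
    (∀ t, |deriv F t| ≤ K) ∧ (∀ t, 0 ≤ F t) ∧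
    ∀ t, 0 ≤ t → F t = (t + ε)⁻¹ ∧ deriv F t = -((t + ε) ^ 2)⁻¹ := by
  obtain ⟨K, hK⟩ := exists_bound_deriv_ramp 2
  -- The limit is nonnegative but its approximants need not be. Replacing `t` by the ramp keeps the
  -- denominator away from `0` on the whole line.
  have hpos : ∀ t, ε / 2 ≤ ramp (4 / ε) 2 t + ε := fun t => by linarith [neg_half_le_ramp hε t]
  have hpos' : ∀ t, 0 < ramp (4 / ε) 2 t + ε := fun t => (half_pos hε).trans_le (hpos t)
  have hd : ∀ t, HasDerivAt (fun t => (ramp (4 / ε) 2 t + ε)⁻¹)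
      (-deriv (ramp (4 / ε) 2) t / (ramp (4 / ε) 2 t + ε) ^ 2) t := fun t =>
    ((((contDiff_ramp (4 / ε) 2).differentiable (by simp) t).hasDerivAt.add_const ε).inv
      (hpos' t).ne')
  refine ⟨fun t => (ramp (4 / ε) 2 t + ε)⁻¹, K / (ε / 2) ^ 2, ?_, fun t => ?_, fun t => ?_,
    fun t ht => ?_⟩
  · exact ((contDiff_ramp _ _).add contDiff_const).inv fun t => (hpos' t).ne'
  · rw [(hd t).deriv, abs_div, abs_neg, abs_of_pos (pow_pos (hpos' t) 2)]
    have := (abs_nonneg _).trans (hK (4 / ε) t)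
    gcongr
    · exact hK _ t
    · exact hpos t
  · exact inv_nonneg.2 (hpos' t).le
  · simp only [(hd t).deriv, (ramp_of_nonneg hε ht).1, (ramp_of_nonneg hε ht).2]
    exact ⟨trivial, by rw [neg_div, one_div]⟩

/-- A globally smooth version of `log (1 + t / ε)`. -/
theorem exists_smooth_log {ε : ℝ} (hε : 0 < ε) : ∃ (F : ℝ → ℝ) (K : ℝ), ContDiff ℝ ∞ F ∧
    (∀ t, |deriv F t| ≤ K) ∧
    ∀ t, 0 ≤ t → F t = Real.log ((t + ε) / ε) ∧ deriv F t = (t + ε)⁻¹ := by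
  obtain ⟨K, hK⟩ := exists_bound_deriv_ramp 2
  have hpos : ∀ t, ε / 2 ≤ ramp (4 / ε) 2 t + ε := fun t => by linarith [neg_half_le_ramp hε t]
  have hpos' : ∀ t, 0 < ramp (4 / ε) 2 t + ε := fun t => (half_pos hε).trans_le (hpos t)
  have hd : ∀ t, HasDerivAt (fun t => Real.log ((ramp (4 / ε) 2 t + ε) / ε))
      (deriv (ramp (4 / ε) 2) t / ε / ((ramp (4 / ε) 2 t + ε) / ε)) t := fun t =>
    ((((contDiff_ramp (4 / ε) 2).differentiable (by simp) t).hasDerivAt.add_const ε).div_const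
      ε).log (div_pos (hpos' t) hε).ne'
  refine ⟨fun t => Real.log ((ramp (4 / ε) 2 t + ε) / ε), K / (ε / 2), ?_, fun t => ?_,
    fun t ht => ?_⟩
  · exact (((contDiff_ramp _ _).add contDiff_const).div_const ε).log
      fun t => (div_pos (hpos' t) hε).ne'
  · rw [(hd t).deriv, div_div_div_cancel_right₀ hε.ne', abs_div, abs_of_pos (hpos' t)]
    have := (abs_nonneg _).trans (hK (4 / ε) t)
    gcongr
    · exact hK _ t
    · exact hpos t
  · simp only [(hd t).deriv, (ramp_of_nonneg hε ht).1, (ramp_of_nonneg hε ht).2]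
    exact ⟨trivial, by rw [div_div_div_cancel_right₀ hε.ne', one_div]⟩

end Cutoff

/-! ### The bilinear form -/

section Form

variable {n : ℕ} {Ω : Set (E n)} {A : E n → Matrix (Fin n) (Fin n) ℝ} {lam Lam : ℝ}
  {b c : E n → E n} {d : E n → ℝ} {u : E n → ℝ} {G : E n → E n}

/-- The vector field `A ∇u + b u`. -/
def flux (A : E n → Matrix (Fin n) (Fin n) ℝ) (b : E n → E n) (u : E n → ℝ) (G : E n → E n)
    (x : E n) : E n :=
  Matrix.toEuclideanCLM (n := Fin n) (𝕜 := ℝ) (A x) (G x) + u x • b x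

/-- The zeroth order part `c · ∇u + d u`. -/
def source (c : E n → E n) (d : E n → ℝ) (u : E n → ℝ) (G : E n → E n) (x : E n) : ℝ :=
  inner ℝ (c x) (G x) + d x * u x

/-- For fixed `u`, the form is thereby a functional of `φ` with coefficients in `L²` and in the dual
exponent, hence continuous for the norm of `Y₁²(Ω)`. This is what permits testing with limits of
test functions. -/
theorem weakIntegrand_eq (φ : E n → ℝ) (x : E n) : weakIntegrand A b c d u G φ x
    = inner ℝ (flux A b u G x) (∇ φ x) + source c d u G x * φ x := by
  simp only [weakIntegrand, flux, source, inner_add_left, real_inner_smul_left]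
  ring

theorem IsUniformlyElliptic.ae_norm_le (hA : IsUniformlyElliptic Ω A lam Lam) :
    ∀ᵐ x ∂(volume.restrict Ω), ‖Matrix.toEuclideanCLM (n := Fin n) (𝕜 := ℝ) (A x)‖ ≤ Lam := by
  have h := hA.bounded
  rw [eLpNorm_exponent_top] at h
  filter_upwards [ae_le_eLpNormEssSup (μ := volume.restrict Ω)
    (f := fun x => Matrix.toEuclideanCLM (n := Fin n) (𝕜 := ℝ) (A x))] with x hx
  have h2 := hx.trans h
  rw [← ofReal_norm] at h2
  exact (ENNReal.ofReal_le_ofReal_iff hA.Lam_pos.le).1 h2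

theorem IsUniformlyElliptic.memLp_apply (hA : IsUniformlyElliptic Ω A lam Lam)
    (hG : MemLp G 2 (volume.restrict Ω)) :
    MemLp (fun x => Matrix.toEuclideanCLM (n := Fin n) (𝕜 := ℝ) (A x) (G x)) 2
      (volume.restrict Ω) := by
  refine MemLp.of_le_mul (c := Lam) hG (isBoundedBilinearMap_apply.continuous.comp_aestronglyMeasurable
    (hA.aestronglyMeasurable.prodMk hG.1)) ?_
  filter_upwards [hA.ae_norm_le] with x hx
  exact ((Matrix.toEuclideanCLM (n := Fin n) (𝕜 := ℝ) (A x)).le_opNorm _).trans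
    (mul_le_mul_of_nonneg_right hx (norm_nonneg _))

theorem memLp_flux (hn : 3 ≤ n) (hA : IsUniformlyElliptic Ω A lam Lam)
    (hb : MemLp b (n : ℝ≥0∞) (volume.restrict Ω))
    (hu : MemLp u (sobolevExponent n) (volume.restrict Ω))
    (hG : MemLp G 2 (volume.restrict Ω)) : MemLp (flux A b u G) 2 (volume.restrict Ω) := by
  have := holderTriple_sobolev_natCast hn
  exact (hA.memLp_apply hG).add (hb.smul hu)

theorem memLp_source (hn : 3 ≤ n) (hc : MemLp c (n : ℝ≥0∞) (volume.restrict Ω))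
    (hd : MemLp d ((n : ℝ≥0∞) / 2) (volume.restrict Ω))
    (hu : MemLp u (sobolevExponent n) (volume.restrict Ω))
    (hG : MemLp G 2 (volume.restrict Ω)) :
    MemLp (source c d u G) (dualExponent n) (volume.restrict Ω) := by
  have := holderTriple_natCast_two hn
  have := holderTriple_half_sobolev hn
  refine MemLp.add ⟨hc.1.inner hG.1, ?_⟩ (hu.mul hd)
  have h := eLpNorm_le_eLpNorm_mul_eLpNorm_of_nnnorm (p := n) (q := 2) (r := dualExponent n)
    hc.1 hG.1 (fun x y => (inner ℝ x y : ℝ)) 1 (Eventually.of_forall fun x => by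
      simpa using nnnorm_inner_le_nnnorm (𝕜 := ℝ) (c x) (G x))
  refine h.trans_lt (ENNReal.mul_lt_top (ENNReal.mul_lt_top (by simp) hc.2) hG.2)

/-- The integrand of a continuous linear functional on `Y₁²(Ω)` is integrable. -/
theorem integrable_functional (hn : 3 ≤ n) {X : E n → E n} {y v : E n → ℝ} {V : E n → E n}
    (hX : MemLp X 2 (volume.restrict Ω)) (hy : MemLp y (dualExponent n) (volume.restrict Ω))
    (hv : MemLp v (sobolevExponent n) (volume.restrict Ω)) (hV : MemLp V 2 (volume.restrict Ω)) :
    IntegrableOn (fun x => inner ℝ (X x) (V x) + y x * v x) Ω := by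
  have := holderConjugate_dual_sobolev hn
  exact (integrable_inner_of_memLp (q := 2) hX hV).add (hy.integrable_mul hv)

end Form

/-! ### The strong maximum principle -/

section MaximumPrinciple

variable {n : ℕ} {Ω : Set (E n)} {A : E n → Matrix (Fin n) (Fin n) ℝ} {lam Lam : ℝ}
  {b c : E n → E n} {d : E n → ℝ} {ψ : ℕ → E n → ℝ} {w : E n → ℝ} {W : E n → E n}

/-- `L w ≥ 0` in the weak sense, with Neumann boundary values. -/
def IsSupersolution (Ω : Set (E n)) (A : E n → Matrix (Fin n) (Fin n) ℝ) (b c : E n → E n)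
    (d : E n → ℝ) (w : E n → ℝ) (W : E n → E n) : Prop :=
  ∀ φ : E n → ℝ, IsTestFunction φ → (∀ x, 0 ≤ φ x) →
    0 ≤ ∫ x in Ω, (inner ℝ (flux A b w W x) (∇ φ x) + source c d w W x * φ x)

theorem isFiniteMeasure_restrict (hΩb : Bornology.IsBounded Ω) :
    IsFiniteMeasure (volume.restrict Ω) :=
  ⟨by simpa using hΩb.measure_lt_top⟩

/-- The pointwise form of testing with `1 / (w + ε)`: here `t = w`, `N = |∇w|`, and `a`, `β`, `γ`,
`δ` stand for `A∇w · ∇w`, `b · ∇w`, `c · ∇w`, `d`. Since `t / (t + ε) ≤ 1`, the lower order terms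
are at most `(p + q) z + |δ|` with `z = N / (t + ε)`; Young's inequality absorbs the first into half
of the elliptic term. The remainder is free of `ε`. -/
theorem form_inv_le {lam t ε a β γ δ N p q : ℝ} (hlam : 0 < lam) (hε : 0 < ε) (ht : 0 ≤ t)
    (ha : lam * N ^ 2 ≤ a) (hN : 0 ≤ N) (hβ : |β| ≤ p * N) (hγ : |γ| ≤ q * N) :
    -((t + ε) ^ 2)⁻¹ * (a + t * β) + (γ + δ * t) * (t + ε)⁻¹
      ≤ -(lam / 2 * ((t + ε)⁻¹ * N) ^ 2) + ((p + q) ^ 2 / (2 * lam) + |δ|) := by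
  set s := (t + ε)⁻¹ with hs
  have hs0 : 0 < s := by positivity
  have hts : t * s ≤ 1 := by
    rw [hs, ← div_eq_mul_inv, div_le_one (by linarith)]; linarith
  have hts0 : 0 ≤ t * s := by positivity
  set z := s * N with hz
  have hz0 : 0 ≤ z := by positivity
  have e : ((t + ε) ^ 2)⁻¹ = s ^ 2 := by rw [hs, inv_pow]
  rw [e]
  have h1 : lam * z ^ 2 ≤ s ^ 2 * a := by
    have := mul_le_mul_of_nonneg_left ha (sq_nonneg s)
    rw [hz]; nlinarith
  have h2 : -(s ^ 2 * (t * β)) ≤ p * z := by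
    have h3 : |t * s * (s * β)| ≤ 1 * (s * (p * N)) := by
      rw [abs_mul (t * s), abs_of_nonneg hts0]
      have : |s * β| ≤ s * (p * N) := by
        rw [abs_mul, abs_of_pos hs0]
        exact mul_le_mul_of_nonneg_left hβ hs0.le
      exact mul_le_mul hts this (abs_nonneg (s * β)) (by norm_num)
    have := (abs_le.1 h3).1
    rw [hz]; nlinarith
  have h4 : γ * s ≤ q * z := by
    have := mul_le_mul_of_nonneg_right ((le_abs_self γ).trans hγ) hs0.le
    rw [hz]; nlinarith
  have h5 : δ * t * s ≤ |δ| := by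
    have h6 : |δ * (t * s)| ≤ |δ| * 1 := by
      rw [abs_mul, abs_of_nonneg hts0]
      exact mul_le_mul_of_nonneg_left hts (abs_nonneg _)
    have := (le_abs_self _).trans h6
    linarith
  have h7 : (p + q) * z ≤ lam / 2 * z ^ 2 + (p + q) ^ 2 / (2 * lam) := by
    have : lam / 2 * z ^ 2 + (p + q) ^ 2 / (2 * lam) - (p + q) * z
        = (lam * z - (p + q)) ^ 2 / (2 * lam) := by field_simp; ring
    have h8 : 0 ≤ (lam * z - (p + q)) ^ 2 / (2 * lam) := by positivity
    linarith
  nlinarith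

/-- The logarithmic gradient estimate for nonnegative supersolutions. -/
theorem IsSupersolution.exists_lintegral_log_gradient_le (hn : 3 ≤ n) (hΩo : IsOpen Ω)
    (hΩb : Bornology.IsBounded Ω) (hA : IsUniformlyElliptic Ω A lam Lam)
    (hb : MemLp b (n : ℝ≥0∞) (volume.restrict Ω)) (hc : MemLp c (n : ℝ≥0∞) (volume.restrict Ω))
    (hd : MemLp d ((n : ℝ≥0∞) / 2) (volume.restrict Ω)) (hw : YLim Ω ψ w W)
    (hpos : ∀ᵐ x ∂(volume.restrict Ω), 0 ≤ w x) (hsup : IsSupersolution Ω A b c d w W) :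
    ∃ C : ℝ≥0∞, C ≠ ⊤ ∧ ∀ ε : ℝ, 0 < ε → ∫⁻ x in Ω, ‖(w x + ε)⁻¹ • W x‖ₑ ≤ C := by
  have := isFiniteMeasure_restrict hΩb
  obtain ⟨χ, hχ, hχ0, hχ1⟩ := exists_cutoff hΩb
  have hb2 : MemLp b 2 (volume.restrict Ω) := hb.mono_exponent (two_le_natCast hn)
  have hc2 : MemLp c 2 (volume.restrict Ω) := hc.mono_exponent (two_le_natCast hn)
  have hd1 : Integrable d (volume.restrict Ω) := hd.integrable (one_le_half_natCast hn)
  set h : E n → ℝ := fun x => (‖b x‖ + ‖c x‖) ^ 2 / (2 * lam) + |d x| with hh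
  have hint : IntegrableOn h Ω :=
    ((hb2.norm.add hc2.norm).integrable_sq.div_const _).add hd1.abs
  -- The test gives `λ/2 ∫ |Z|² ≤ ∫ h` for `Z = ∇w / (w + ε)`, and `|Z| ≤ 1 + |Z|²` turns this into
  -- an `L¹` bound, which is all that the Poincaré inequality needs.
  refine ⟨volume Ω + ENNReal.ofReal (2 / lam * ∫ x in Ω, h x), ?_, fun ε hε => ?_⟩
  · have := hΩb.measure_lt_top (μ := volume)
    finiteness
  obtain ⟨F, K, hF, hK, hF0, hFw⟩ := exists_smooth_inv hε
  obtain ⟨F', K', hF', hK', hFw'⟩ := exists_smooth_log hε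
  have hlim := hw.comp hn hΩo.measurableSet hχ hχ1 hF hK
  have hlog := hw.comp hn hΩo.measurableSet hχ hχ1 hF' hK'
  have hX := memLp_flux hn hA hb hw.memLp hw.memLp_gradient
  have hy := memLp_source hn hc hd hw.memLp hw.memLp_gradient
  have h0 : 0 ≤ ∫ x in Ω, (inner ℝ (flux A b w W x) (deriv F (w x) • W x)
      + source c d w W x * F (w x)) :=
    ge_of_tendsto' (hlim.tendsto_functional hn hX hy) fun k =>
      hsup _ (hlim.test k) fun x => mul_nonneg (hχ0 x) (hF0 _)
  have hZ : MemLp (fun x => (w x + ε)⁻¹ • W x) 2 (volume.restrict Ω) := by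
    refine hlog.memLp_gradient.ae_eq ?_
    filter_upwards [hpos] with x hx
    rw [(hFw' _ hx).2]
  have hZ2 : IntegrableOn (fun x => ‖(w x + ε)⁻¹ • W x‖ ^ 2) Ω := hZ.norm.integrable_sq
  have h1 : ∫ x in Ω, (inner ℝ (flux A b w W x) (deriv F (w x) • W x)
      + source c d w W x * F (w x))
      ≤ ∫ x in Ω, (-(lam / 2 * ‖(w x + ε)⁻¹ • W x‖ ^ 2) + h x) := by
    refine integral_mono_ae (integrable_functional hn hX hy hlim.memLp hlim.memLp_gradient)
      ((hZ2.const_mul _).neg.add hint) ?_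
    filter_upwards [hpos, ae_restrict_mem hΩo.measurableSet] with x hx hxΩ
    rw [(hFw _ hx).1, (hFw _ hx).2, real_inner_smul_right, norm_smul, Real.norm_eq_abs,
      abs_of_pos (inv_pos.2 (by linarith : 0 < w x + ε))]
    have := form_inv_le (β := inner ℝ (b x) (W x)) (γ := inner ℝ (c x) (W x)) (δ := d x)
      hA.lam_pos hε hx (hA.elliptic x hxΩ (W x)) (norm_nonneg _) (abs_real_inner_le_norm _ _) (abs_real_inner_le_norm _ _)
    simpa only [flux, source, inner_add_left, real_inner_smul_left] using this
  rw [integral_add (f := fun x => -(lam / 2 * ‖(w x + ε)⁻¹ • W x‖ ^ 2)) (hZ2.const_mul _).neg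
    hint, integral_neg, integral_const_mul] at h1
  have h2 : ∫ x in Ω, ‖(w x + ε)⁻¹ • W x‖ ^ 2 ≤ 2 / lam * ∫ x in Ω, h x := by
    have := hA.lam_pos
    rw [div_mul_eq_mul_div, le_div_iff₀ this]
    linarith
  calc ∫⁻ x in Ω, ‖(w x + ε)⁻¹ • W x‖ₑ
      ≤ ∫⁻ x in Ω, (1 + ENNReal.ofReal (‖(w x + ε)⁻¹ • W x‖ ^ 2)) := by
        refine lintegral_mono fun x => ?_
        rw [← ofReal_norm, ← ENNReal.ofReal_one, ← ENNReal.ofReal_add zero_le_one (by positivity)]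
        refine ENNReal.ofReal_le_ofReal ?_
        nlinarith [sq_nonneg (‖(w x + ε)⁻¹ • W x‖ - 1)]
    _ = volume Ω + ENNReal.ofReal (∫ x in Ω, ‖(w x + ε)⁻¹ • W x‖ ^ 2) := by
        rw [lintegral_add_left measurable_const, ofReal_integral_eq_lintegral_ofReal hZ2
          (Eventually.of_forall fun x => by positivity)]
        simp
    _ ≤ _ := by gcongr

/-- If both alternatives failed, `{w = 0}` and some `{w > a}` with `a > 0` would have positive
measure. On their product the integrand is at least `log ((a + ε) / ε)`, which is unbounded as `ε →
0`. -/
theorem ae_zero_or_pos_of_log_bound {B : Set (E n)}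
    (hw : Measurable w) (hpos : ∀ᵐ x ∂(volume.restrict B), 0 ≤ w x) {C : ℝ≥0∞} (hC : C ≠ ⊤)
    (hlog : ∀ ε : ℝ, 0 < ε → ∫⁻ x in B, ∫⁻ y in B,
      ‖Real.log ((w x + ε) / ε) - Real.log ((w y + ε) / ε)‖ₑ ≤ C) :
    (∀ᵐ x ∂(volume.restrict B), w x = 0) ∨ (∀ᵐ x ∂(volume.restrict B), 0 < w x) := by
  by_contra hcon
  rw [not_or] at hcon
  obtain ⟨h1, h2⟩ := hcon
  set Z := {x | w x = 0} with hZdef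
  have hZm : MeasurableSet Z := hw (measurableSet_singleton 0)
  have hZ : volume.restrict B Z ≠ 0 := by
    intro h0
    apply h2
    filter_upwards [hpos, measure_eq_zero_iff_ae_notMem.1 h0] with x hx hx'
    exact lt_of_le_of_ne hx fun h => hx' h.symm
  have hP : volume.restrict B {x | 0 < w x} ≠ 0 := by
    intro h0
    apply h1
    filter_upwards [hpos, measure_eq_zero_iff_ae_notMem.1 h0] with x hx hx'
    exact le_antisymm (not_lt.1 hx') hx
  obtain ⟨k, hk⟩ : ∃ k : ℕ, volume.restrict B {x | 1 / ((k : ℝ) + 1) < w x} ≠ 0 := by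
    by_contra! hall
    apply hP
    refine measure_mono_null (fun x hx => ?_) (measure_iUnion_null hall)
    rw [Set.mem_ofPred_eq] at hx
    obtain ⟨k, hk⟩ := exists_nat_one_div_lt hx
    exact Set.mem_iUnion.2 ⟨k, hk⟩
  set a : ℝ := 1 / ((k : ℝ) + 1) with ha
  have ha0 : 0 < a := by positivity
  set P := {x | a < w x} with hPdef
  have hPm : MeasurableSet P := measurableSet_lt measurable_const hw
  have key : ∀ ε : ℝ, 0 < ε → volume.restrict B Z * volume.restrict B P
      * ENNReal.ofReal (Real.log ((a + ε) / ε)) ≤ C := by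
    intro ε hε
    refine le_trans ?_ (hlog ε hε)
    calc volume.restrict B Z * volume.restrict B P * ENNReal.ofReal (Real.log ((a + ε) / ε))
        = ∫⁻ x in Z, ∫⁻ y in P, ENNReal.ofReal (Real.log ((a + ε) / ε)) ∂(volume.restrict B)
            ∂(volume.restrict B) := by
          simp only [lintegral_const, Measure.restrict_apply_univ]
          ring
      _ ≤ ∫⁻ x in Z, ∫⁻ y in P, ‖Real.log ((w x + ε) / ε) - Real.log ((w y + ε) / ε)‖ₑ
            ∂(volume.restrict B) ∂(volume.restrict B) := by
          refine setLIntegral_mono' hZm fun x hx => setLIntegral_mono' hPm fun y hy => ?_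
          rw [hZdef, Set.mem_ofPred_eq] at hx
          rw [hPdef, Set.mem_ofPred_eq] at hy
          rw [hx, zero_add, div_self hε.ne', Real.log_one, zero_sub, enorm_neg, ← ofReal_norm]
          refine ENNReal.ofReal_le_ofReal ((Real.log_le_log (by positivity) ?_).trans
            (le_abs_self _))
          gcongr
      _ ≤ _ := (setLIntegral_le_lintegral _ _).trans
          (lintegral_mono fun x => setLIntegral_le_lintegral _ _)
  have hm : volume.restrict B Z * volume.restrict B P ≠ 0 := mul_ne_zero hZ hk
  -- With `ε = a / (j + 1)` the ratio `(a + ε) / ε` is exactly `j + 2`.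
  have hlim : Tendsto (fun j : ℕ => ENNReal.ofReal (Real.log ((a + a / (j + 1)) / (a / (j + 1)))))
      atTop (𝓝 ⊤) := by
    refine ENNReal.tendsto_ofReal_nhds_top.2 ?_
    refine Real.tendsto_log_atTop.comp ?_
    have : Tendsto (fun j : ℕ => (j : ℝ)) atTop atTop := tendsto_natCast_atTop_atTop
    refine tendsto_atTop_mono (fun j => ?_) this
    have hj : (0 : ℝ) < (j : ℝ) + 1 := by positivity
    rw [show (a + a / (j + 1)) / (a / (j + 1)) = (j : ℝ) + 2 by field_simp; ring]
    linarith
  have hlim2 := ENNReal.Tendsto.const_mul (a := volume.restrict B Z * volume.restrict B P) hlim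
    (Or.inl (by simp))
  rw [ENNReal.mul_top hm] at hlim2
  exact hC (top_le_iff.1 (le_of_tendsto' hlim2 fun j => key _ (by positivity)))

/-- On a connected set, the local alternative between vanishing and positivity is global. -/
theorem ae_zero_or_pos_of_local (hΩo : IsOpen Ω) (hΩc : IsPreconnected Ω)
    (h : ∀ x ∈ Ω, ∃ r > 0, Metric.ball x r ⊆ Ω ∧
      ((∀ᵐ y ∂(volume.restrict (Metric.ball x r)), w y = 0) ∨
        (∀ᵐ y ∂(volume.restrict (Metric.ball x r)), 0 < w y))) :
    (∀ᵐ x ∂(volume.restrict Ω), w x = 0) ∨ (∀ᵐ x ∂(volume.restrict Ω), 0 < w x) := by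
  set U : Set (E n) := {x | ∃ r > 0, ∀ᵐ y ∂(volume.restrict (Metric.ball x r)), w y = 0}
    with hU
  set V : Set (E n) := {x | ∃ r > 0, ∀ᵐ y ∂(volume.restrict (Metric.ball x r)), 0 < w y}
    with hV
  have hopen : ∀ Q : ℝ → Prop,
      IsOpen {x : E n | ∃ r > 0, ∀ᵐ y ∂(volume.restrict (Metric.ball x r)), Q (w y)} := by
    intro Q
    rw [Metric.isOpen_iff]
    rintro x ⟨r, hr, hx⟩
    refine ⟨r / 2, half_pos hr, fun y hy => ⟨r / 2, half_pos hr, ?_⟩⟩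
    refine ae_mono (Measure.restrict_mono (Metric.ball_subset_ball' ?_) le_rfl) hx
    rw [Metric.mem_ball] at hy
    linarith
  have hglobal : ∀ Q : ℝ → Prop,
      (∀ x ∈ Ω, ∃ r > 0, ∀ᵐ y ∂(volume.restrict (Metric.ball x r)), Q (w y)) →
      ∀ᵐ x ∂(volume.restrict Ω), Q (w x) := by
    intro Q hQ
    rw [ae_restrict_iff' hΩo.measurableSet, ae_iff]
    refine measure_null_of_locally_null _ fun x hx => ?_
    rw [Set.mem_ofPred_eq, Classical.not_imp] at hx
    obtain ⟨r, hr, hae⟩ := hQ x hx.1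
    rw [ae_restrict_iff' measurableSet_ball, ae_iff] at hae
    refine ⟨_, ?_, hae⟩
    filter_upwards [mem_nhdsWithin_of_mem_nhds (Metric.ball_mem_nhds x hr), self_mem_nhdsWithin]
      with y hy hy'
    exact fun h => hy' fun _ => h hy
  by_cases hne : (Ω ∩ U).Nonempty ∧ (Ω ∩ V).Nonempty
  · have hcov : Ω ⊆ U ∪ V := by
      intro x hx
      obtain ⟨r, hr, -, h1 | h1⟩ := h x hx
      · exact Or.inl ⟨r, hr, h1⟩
      · exact Or.inr ⟨r, hr, h1⟩
    obtain ⟨x, -, ⟨r, hr, h1⟩, ⟨s, hs, h2⟩⟩ := hΩc U V (hopen (· = 0)) (hopen (0 < ·)) hcov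
      hne.1 hne.2
    exfalso
    have hm : 0 < min r s := lt_min hr hs
    have h1' : ∀ᵐ y ∂(volume.restrict (Metric.ball x (min r s))), w y = 0 :=
      ae_mono (Measure.restrict_mono (Metric.ball_subset_ball (min_le_left _ _)) le_rfl) h1
    have h2' : ∀ᵐ y ∂(volume.restrict (Metric.ball x (min r s))), 0 < w y :=
      ae_mono (Measure.restrict_mono (Metric.ball_subset_ball (min_le_right _ _)) le_rfl) h2
    have h3 : ∀ᵐ y ∂(volume.restrict (Metric.ball x (min r s))), False := by
      filter_upwards [h1', h2'] with y h4 h5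
      exact h5.ne' h4
    rw [ae_iff] at h3
    simp only [not_false_eq_true, Set.ofPred_true, Measure.restrict_apply_univ] at h3
    exact (Metric.measure_ball_pos volume x hm).ne' h3
  · rw [not_and_or] at hne
    rcases hne with hne | hne
    · right
      refine hglobal (0 < ·) fun x hx => ?_
      obtain ⟨r, hr, -, h1 | h1⟩ := h x hx
      · exact (hne ⟨x, hx, r, hr, h1⟩).elim
      · exact ⟨r, hr, h1⟩
    · left
      refine hglobal (· = 0) fun x hx => ?_
      obtain ⟨r, hr, -, h1 | h1⟩ := h x hx
      · exact ⟨r, hr, h1⟩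
      · exact (hne ⟨x, hx, r, hr, h1⟩).elim

/-- A nonnegative supersolution on a connected set vanishes or is positive. -/
theorem IsSupersolution.ae_zero_or_pos (hn : 3 ≤ n) (hΩo : IsOpen Ω) (hΩc : IsPreconnected Ω)
    (hΩb : Bornology.IsBounded Ω) (hA : IsUniformlyElliptic Ω A lam Lam)
    (hb : MemLp b (n : ℝ≥0∞) (volume.restrict Ω)) (hc : MemLp c (n : ℝ≥0∞) (volume.restrict Ω))
    (hd : MemLp d ((n : ℝ≥0∞) / 2) (volume.restrict Ω)) (hw : YLim Ω ψ w W)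
    (hpos : ∀ᵐ x ∂(volume.restrict Ω), 0 ≤ w x) (hsup : IsSupersolution Ω A b c d w W) :
    (∀ᵐ x ∂(volume.restrict Ω), w x = 0) ∨ (∀ᵐ x ∂(volume.restrict Ω), 0 < w x) := by
  have := isFiniteMeasure_restrict hΩb
  obtain ⟨χ, hχ, hχ0, hχ1⟩ := exists_cutoff hΩb
  obtain ⟨C, hC, hCle⟩ := hsup.exists_lintegral_log_gradient_le hn hΩo hΩb hA hb hc hd hw hpos
  -- The level sets in the logarithmic argument must be measurable, so a measurable representative
  -- is used.
  set w' := hw.memLp.1.mk w with hw'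
  have hww' : w =ᵐ[volume.restrict Ω] w' := hw.memLp.1.ae_eq_mk
  have hw'm : Measurable w' := hw.memLp.1.stronglyMeasurable_mk.measurable
  have main : (∀ᵐ x ∂(volume.restrict Ω), w' x = 0) ∨ (∀ᵐ x ∂(volume.restrict Ω), 0 < w' x) := by
    refine ae_zero_or_pos_of_local hΩo hΩc fun x hx => ?_
    obtain ⟨r, hr, hsub⟩ := Metric.isOpen_iff.1 hΩo x hx
    refine ⟨r, hr, hsub, ?_⟩
    have hle : volume.restrict (Metric.ball x r) ≤ volume.restrict Ω :=
      Measure.restrict_mono hsub le_rfl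
    refine ae_zero_or_pos_of_log_bound hw'm ?_
      (C := 2 * ((2 * r).toNNReal * (volume (Metric.ball x r) * (2 ^ n * C)))) ?_ fun ε hε => ?_
    · filter_upwards [ae_mono hle hpos, ae_mono hle hww'] with y h1 h2
      rwa [← h2]
    · have := measure_ball_lt_top (μ := volume) (x := x) (r := r)
      finiteness
    · obtain ⟨F, K, hF, hK, hFw⟩ := exists_smooth_log hε
      have hlog := hw.comp hn hΩo.measurableSet hχ hχ1 hF hK
      have hP := hlog.lintegral_lintegral_enorm_sub_le hsub (convex_ball x r) measurableSet_ball
        measure_ball_lt_top.ne (D := (2 * r).toNNReal) (fun y hy z hz => by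
          rw [← ofReal_norm, ← ENNReal.ofReal]
          refine ENNReal.ofReal_le_ofReal ?_
          rw [← dist_eq_norm]
          rw [Metric.mem_ball] at hy hz
          linarith [dist_triangle_right z y x])
      have hae : ∀ᵐ y ∂(volume.restrict (Metric.ball x r)),
          F (w y) = Real.log ((w' y + ε) / ε) := by
        filter_upwards [ae_mono hle hpos, ae_mono hle hww'] with y h1 h2
        rw [← h2, (hFw _ h1).1]
      refine le_trans (le_of_eq ?_) (hP.trans ?_)
      · refine lintegral_congr_ae ?_
        filter_upwards [hae] with y hy
        refine lintegral_congr_ae ?_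
        filter_upwards [hae] with z hz
        rw [hy, hz]
      · gcongr
        refine le_trans ?_ (hCle ε hε)
        refine le_trans (lintegral_mono' hle le_rfl) (le_of_eq (lintegral_congr_ae ?_))
        filter_upwards [hpos] with y hy
        rw [(hFw _ hy).2]
  refine main.imp (fun h => ?_) (fun h => ?_) <;>
  · filter_upwards [h, hww'] with x h1 h2
    rwa [h2]

end MaximumPrinciple

/-! ### Positive parts -/

section PosPart

variable {n : ℕ} {Ω : Set (E n)} {A : E n → Matrix (Fin n) (Fin n) ℝ} {lam Lam : ℝ}
  {b c : E n → E n} {d : E n → ℝ} {ψ : ℕ → E n → ℝ} {u : E n → ℝ} {G : E n → E n}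

theorem deriv_smoothTransition_of_nonpos {s : ℝ} (hs : s ≤ 0) :
    deriv Real.smoothTransition s = 0 := by
  refine IsLocalMin.deriv_eq_zero (Eventually.of_forall fun t => ?_)
  rw [Real.smoothTransition.zero_of_nonpos hs]
  exact Real.smoothTransition.nonneg t

theorem tendsto_smoothTransition_mul (t : ℝ) : Tendsto (fun j : ℕ =>
    Real.smoothTransition (j * t)) atTop (𝓝 (if 0 < t then 1 else 0)) := by
  split_ifs with ht
  · have : Tendsto (fun j : ℕ => (j : ℝ) * t) atTop atTop :=
      tendsto_natCast_atTop_atTop.atTop_mul_const ht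
    refine tendsto_const_nhds.congr' ?_
    filter_upwards [this.eventually_ge_atTop 1] with j hj
    exact (Real.smoothTransition.one_of_one_le hj).symm
  · refine tendsto_const_nhds.congr fun j => ?_
    exact (Real.smoothTransition.zero_of_nonpos
      (mul_nonpos_of_nonneg_of_nonpos (by positivity) (not_lt.1 ht))).symm

/-- For `t > 0` the argument `j t` eventually leaves `[0, 1]`, and for `t ≤ 0` the derivative is
already zero. Thanks to this limit the `b`-term created by differentiating `σ(j u)` disappears. -/
theorem tendsto_mul_deriv_smoothTransition_mul (t : ℝ) : Tendsto (fun j : ℕ =>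
    j * t * deriv Real.smoothTransition (j * t)) atTop (𝓝 0) := by
  rcases lt_or_ge 0 t with ht | ht
  · have : Tendsto (fun j : ℕ => (j : ℝ) * t) atTop atTop :=
      tendsto_natCast_atTop_atTop.atTop_mul_const ht
    refine tendsto_const_nhds.congr' ?_
    filter_upwards [this.eventually_gt_atTop 1] with j hj
    rw [deriv_smoothTransition_of_notMem fun h => h.2.not_gt hj, mul_zero]
  · refine tendsto_const_nhds.congr fun j => ?_
    rw [deriv_smoothTransition_of_nonpos
      (mul_nonpos_of_nonneg_of_nonpos (by positivity) ht), mul_zero]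

theorem ramp_nonneg (α t : ℝ) (hα : 0 ≤ α) : 0 ≤ ramp α 0 t := by
  rcases le_or_gt t 0 with ht | ht
  · rw [ramp_of_nonpos (by rw [add_zero]; exact mul_nonpos_of_nonneg_of_nonpos hα ht)]
  · exact mul_nonneg ht.le (Real.smoothTransition.nonneg _)

theorem tendsto_ramp (t : ℝ) : Tendsto (fun j : ℕ => ramp j 0 t) atTop (𝓝 (max t 0)) := by
  have h := (tendsto_smoothTransition_mul t).const_mul t
  have e : t * (if 0 < t then 1 else 0) = max t 0 := by
    split_ifs with ht
    · rw [max_eq_left ht.le, mul_one]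
    · rw [max_eq_right (not_lt.1 ht), mul_zero]
  rw [e] at h
  simpa only [ramp, add_zero] using h

theorem tendsto_deriv_ramp (t : ℝ) : Tendsto (fun j : ℕ => deriv (ramp j 0) t) atTop
    (𝓝 (if 0 < t then 1 else 0)) := by
  have h := (tendsto_smoothTransition_mul t).add (tendsto_mul_deriv_smoothTransition_mul t)
  rw [add_zero] at h
  simpa only [deriv_ramp, add_zero] using h

/-- The gradient of the positive part of `u`, where `G` stands for `∇u`. -/
def posGrad (u : E n → ℝ) (G : E n → E n) (x : E n) : E n := (if 0 < u x then (1 : ℝ) else 0) • G x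

theorem memLp_posGrad (hu : AEStronglyMeasurable u (volume.restrict Ω))
    (hG : MemLp G 2 (volume.restrict Ω)) : MemLp (posGrad u G) 2 (volume.restrict Ω) := by
  have hm : Measurable fun t : ℝ => if 0 < t then (1 : ℝ) else 0 :=
    Measurable.ite measurableSet_Ioi measurable_const measurable_const
  refine hG.mono ((hm.comp_aemeasurable hu.aemeasurable).aestronglyMeasurable.smul hG.1)
    (Eventually.of_forall fun x => ?_)
  rw [posGrad]
  split_ifs <;> simp

theorem memLp_posPart {p : ℝ≥0∞} (hu : MemLp u p (volume.restrict Ω)) :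
    MemLp (fun x => max (u x) 0) p (volume.restrict Ω) := by
  refine hu.mono (hu.1.sup aestronglyMeasurable_const) (Eventually.of_forall fun x => ?_)
  rw [Real.norm_eq_abs, Real.norm_eq_abs, abs_of_nonneg (le_max_right _ _)]
  exact max_le (le_abs_self _) (abs_nonneg _)

/-- The ramps `t σ(j t)` have derivatives bounded uniformly in `j` and converge to the positive part
with their derivatives, so dominated convergence applies. They are nonnegative, so the approximants
may be inserted in a sign condition. -/
theorem YLim.exists_posPart (hn : 3 ≤ n) (hΩo : IsOpen Ω) (hΩb : Bornology.IsBounded Ω)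
    (h : YLim Ω ψ u G) : ∃ ψ', YLim Ω ψ' (fun x => max (u x) 0) (posGrad u G) ∧
      ∀ k, ∀ x, 0 ≤ ψ' k x := by
  have := isFiniteMeasure_restrict hΩb
  obtain ⟨χ, hχ, hχ0, hχ1⟩ := exists_cutoff hΩb
  obtain ⟨K, hK⟩ := exists_bound_deriv_ramp 0
  have hY : ∀ j : ℕ, YLim Ω (fun k x => χ x * ramp j 0 (ψ k x)) (fun x => ramp j 0 (u x))
      (fun x => deriv (ramp j 0) (u x) • G x) := fun j =>
    h.comp hn hΩo.measurableSet hχ hχ1 (contDiff_ramp _ _) (hK j)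
  refine exists_yLim_of_tendsto hn hY (Q := fun φ => ∀ x, 0 ≤ φ x)
    (fun j k x => mul_nonneg (hχ0 x) (ramp_nonneg _ _ (by positivity)))
    (memLp_posPart h.memLp) (memLp_posGrad h.memLp.1 h.memLp_gradient) ?_ ?_
  · refine tendsto_eLpNorm_zero_of_dominated (sobolevExponent_ne_zero hn) sobolevExponent_ne_top
      h.memLp (C := 2) (fun j => ((hY j).memLp.sub (memLp_posPart h.memLp)).1)
      (fun j => Eventually.of_forall fun x => ?_) (Eventually.of_forall fun x => ?_)
    · have h1 := abs_ramp_le j 0 (u x)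
      have h2 : |max (u x) 0| ≤ |u x| := by
        rw [abs_of_nonneg (le_max_right _ _)]
        exact max_le (le_abs_self _) (abs_nonneg _)
      rw [Real.norm_eq_abs, Real.norm_eq_abs]
      exact (abs_sub _ _).trans (by linarith)
    · simpa using (tendsto_ramp (u x)).sub_const (max (u x) 0)
  · refine tendsto_eLpNorm_zero_of_dominated two_ne_zero ENNReal.ofNat_ne_top
      h.memLp_gradient (C := K + 1)
      (fun j => ((hY j).memLp_gradient.sub (memLp_posGrad h.memLp.1 h.memLp_gradient)).1)
      (fun j => Eventually.of_forall fun x => ?_) (Eventually.of_forall fun x => ?_)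
    · rw [posGrad, ← sub_smul, norm_smul]
      refine mul_le_mul_of_nonneg_right ((norm_sub_le _ _).trans
        (add_le_add (hK j _) ?_)) (norm_nonneg _)
      split_ifs <;> simp
    · simpa [posGrad] using ((tendsto_deriv_ramp (u x)).smul_const (G x)).sub_const
        (posGrad u G x)

/-- `L u = 0` in the weak sense, with Neumann boundary values. -/
def IsWeakSolution (Ω : Set (E n)) (A : E n → Matrix (Fin n) (Fin n) ℝ) (b c : E n → E n)
    (d : E n → ℝ) (u : E n → ℝ) (G : E n → E n) : Prop :=
  ∀ φ : E n → ℝ, IsTestFunction φ →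
    ∫ x in Ω, (inner ℝ (flux A b u G x) (∇ φ x) + source c d u G x * φ x) = 0

theorem functional_posPart_eq (φ : E n → ℝ) (Φ : E n → E n) (x : E n) :
    inner ℝ (flux A b (fun x => max (u x) 0) (posGrad u G) x) (Φ x)
      + source c d (fun x => max (u x) 0) (posGrad u G) x * φ x
    = (if 0 < u x then (1 : ℝ) else 0)
      * (inner ℝ (flux A b u G x) (Φ x) + source c d u G x * φ x) := by
  by_cases hx : 0 < u x
  · simp only [flux, source, posGrad, hx, if_true, max_eq_left hx.le, one_smul, one_mul]
  · simp only [flux, source, posGrad, hx, if_false, max_eq_right (not_lt.1 hx), zero_smul, map_zero,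
      inner_zero_left, inner_zero_right, mul_zero, zero_mul, add_zero]

/-- The positive part of a solution is a subsolution. -/
theorem IsWeakSolution.posPart_nonpos (hn : 3 ≤ n) (hΩo : IsOpen Ω) (hΩb : Bornology.IsBounded Ω)
    (hA : IsUniformlyElliptic Ω A lam Lam)
    (hb : MemLp b (n : ℝ≥0∞) (volume.restrict Ω)) (hc : MemLp c (n : ℝ≥0∞) (volume.restrict Ω))
    (hd : MemLp d ((n : ℝ≥0∞) / 2) (volume.restrict Ω)) (hu : YLim Ω ψ u G)
    (hsol : IsWeakSolution Ω A b c d u G) {φ : E n → ℝ} (hφ : IsTestFunction φ)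
    (hφ0 : ∀ x, 0 ≤ φ x) :
    ∫ x in Ω, (inner ℝ (flux A b (fun x => max (u x) 0) (posGrad u G) x) (∇ φ x)
      + source c d (fun x => max (u x) 0) (posGrad u G) x * φ x) ≤ 0 := by
  have := isFiniteMeasure_restrict hΩb
  have hX := memLp_flux hn hA hb hu.memLp hu.memLp_gradient
  have hy := memLp_source hn hc hd hu.memLp hu.memLp_gradient
  have hb2 : MemLp b 2 (volume.restrict Ω) := hb.mono_exponent (two_le_natCast hn)
  have hbG : Integrable (fun x => inner ℝ (b x) (G x)) (volume.restrict Ω) :=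
    integrable_inner_of_memLp (p := 2) (q := 2) hb2 hu.memLp_gradient
  obtain ⟨C, hC0, hC, -⟩ := hφ.exists_bound
  obtain ⟨K, hK0, hK⟩ := exists_bound_deriv_smoothTransition 0
  set J : E n → ℝ := fun x => inner ℝ (flux A b u G x) (∇ φ x) + source c d u G x * φ x with hJ
  have hJi : IntegrableOn J Ω :=
    integrable_functional hn hX hy (hφ.memLp _ Ω) (hφ.memLp_gradient _ Ω)
  -- This is the integrand of the equation tested with `φ σ(j u)`, minus the nonnegative elliptic
  -- term `φ j σ'(j u) A∇u · ∇u`. The equation makes the full integral zero, so `∫ I j ≤ 0`; and `I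
  -- j` tends to `J` restricted to `{u > 0}`.
  set I : ℕ → E n → ℝ := fun j x => Real.smoothTransition (j * u x) * J x
    + φ x * (j * u x * deriv Real.smoothTransition (j * u x)) * inner ℝ (b x) (G x) with hI
  have hcd : Continuous (deriv Real.smoothTransition) :=
    (Real.smoothTransition.contDiff (n := 1)).continuous_deriv (by simp)
  have hum : AEStronglyMeasurable u (volume.restrict Ω) := hu.memLp.1
  have hIm : ∀ j, AEStronglyMeasurable (I j) (volume.restrict Ω) := by
    intro j
    refine AEStronglyMeasurable.add ?_ ?_
    · exact (Real.smoothTransition.continuous.comp_aestronglyMeasurable (hum.const_mul _)).mul hJi.1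
    · exact (hφ.1.continuous.aestronglyMeasurable.mul ((hum.const_mul _).mul
        (hcd.comp_aestronglyMeasurable (hum.const_mul _)))).mul hbG.1
  have hIb : ∀ j, ∀ᵐ x ∂(volume.restrict Ω), ‖I j x‖ ≤ ‖J x‖ + C * K * ‖inner ℝ (b x) (G x)‖ := by
    intro j
    refine Eventually.of_forall fun x => (norm_add_le _ _).trans (add_le_add ?_ ?_)
    · rw [norm_mul, Real.norm_eq_abs, abs_of_nonneg (Real.smoothTransition.nonneg _)]
      exact mul_le_of_le_one_left (norm_nonneg _) (Real.smoothTransition.le_one _)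
    · rw [norm_mul, norm_mul]
      refine mul_le_mul_of_nonneg_right (mul_le_mul (hC x) ?_ (norm_nonneg _) hC0) (norm_nonneg _)
      have := (hK (j * u x)).2
      rwa [sub_zero] at this
  have hbound : Integrable (fun x => ‖J x‖ + C * K * ‖inner ℝ (b x) (G x)‖)
      (volume.restrict Ω) := hJi.norm.add (hbG.norm.const_mul _)
  have hlim : Tendsto (fun j => ∫ x in Ω, I j x) atTop
      (𝓝 (∫ x in Ω, (if 0 < u x then (1 : ℝ) else 0) * J x)) := by
    refine tendsto_integral_of_dominated_convergence _ hIm hbound hIb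
      (Eventually.of_forall fun x => ?_)
    have h1 := (tendsto_smoothTransition_mul (u x)).mul_const (J x)
    have h2 := ((tendsto_mul_deriv_smoothTransition_mul (u x)).const_mul (φ x)).mul_const
      (inner ℝ (b x) (G x) : ℝ)
    simpa [hI] using h1.add h2
  simp only [functional_posPart_eq]
  refine le_of_tendsto' hlim fun j => ?_
  have hd' : ∀ t : ℝ, deriv (fun t : ℝ => Real.smoothTransition (j * t)) t
      = j * deriv Real.smoothTransition (j * t) := fun t => by
    have := (hasDerivAt_smoothTransition_comp j 0 t).deriv
    simpa only [add_zero] using this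
  have hF : ContDiff ℝ ∞ fun t : ℝ => Real.smoothTransition (j * t) := by
    simpa only [add_zero] using contDiff_smoothTransition_comp j 0
  have hY := hu.mul_comp hn hφ hF (K := j * K) fun t => by
    rw [hd', abs_mul, abs_of_nonneg (by positivity : (0 : ℝ) ≤ j)]
    exact mul_le_mul_of_nonneg_left (hK _).1 (by positivity)
  have hzero := tendsto_nhds_unique (hY.tendsto_functional hn hX hy)
    (tendsto_const_nhds.congr fun k => (hsol _ (hY.test k)).symm)
  rw [← hzero]
  refine integral_mono_ae (hbound.mono' (hIm j) (hIb j))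
    (integrable_functional hn hX hy hY.memLp hY.memLp_gradient) ?_
  filter_upwards [ae_restrict_mem hΩo.measurableSet] with x hx
  have hmono : 0 ≤ deriv Real.smoothTransition (j * u x) :=
    Real.smoothTransition.monotone.deriv_nonneg
  have hell := (mul_nonneg hA.lam_pos.le (sq_nonneg ‖G x‖)).trans (hA.elliptic x hx (G x))
  have hnn := mul_nonneg (mul_nonneg (hφ0 x) (mul_nonneg (by positivity : (0 : ℝ) ≤ j) hmono)) hell
  simp only [hI, hJ, hd', flux, inner_add_left, inner_add_right, real_inner_smul_left,
    real_inner_smul_right]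
  nlinarith

/-- Under the sign condition on `(c, d)`, the positive part of a solution is a solution. -/
theorem IsWeakSolution.posPart (hn : 3 ≤ n) (hΩo : IsOpen Ω) (hΩb : Bornology.IsBounded Ω)
    (hA : IsUniformlyElliptic Ω A lam Lam)
    (hb : MemLp b (n : ℝ≥0∞) (volume.restrict Ω)) (hc : MemLp c (n : ℝ≥0∞) (volume.restrict Ω))
    (hd : MemLp d ((n : ℝ≥0∞) / 2) (volume.restrict Ω)) (hsign : SignCondition Ω c d)
    (hu : YLim Ω ψ u G) (hsol : IsWeakSolution Ω A b c d u G) :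
    IsWeakSolution Ω A b c d (fun x => max (u x) 0) (posGrad u G) := by
  have := isFiniteMeasure_restrict hΩb
  obtain ⟨χ, hχ, hχ0, hχ1⟩ := exists_cutoff hΩb
  obtain ⟨ψ', hY, hψ'⟩ := hu.exists_posPart hn hΩo hΩb
  have hX := memLp_flux hn hA hb hY.memLp hY.memLp_gradient
  have hy := memLp_source hn hc hd hY.memLp hY.memLp_gradient
  have hc2 : MemLp c 2 (volume.restrict Ω) := hc.mono_exponent (two_le_natCast hn)
  have hdq : MemLp d (dualExponent n) (volume.restrict Ω) :=
    hd.mono_exponent (dualExponent_le_half hn)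
  -- `S` is the value of the form at `(u⁺, 1)`; it equals the sign condition's integral evaluated at
  -- `u⁺`.
  set S : ℝ := ∫ x in Ω, source c d (fun x => max (u x) 0) (posGrad u G) x with hS
  have hS0 : 0 ≤ S :=
    ge_of_tendsto' (hY.tendsto_functional hn hc2 hdq) fun k => hsign _ (hY.test k) (hψ' k)
  -- The test function is `χ (a + s φ)`, which agrees with `a + s φ` on `Ω`; the subsolution
  -- inequality becomes linear in `(a, s)`.
  have key : ∀ (φ : E n → ℝ), IsTestFunction φ → ∀ a s : ℝ, (∀ x, 0 ≤ a + s * φ x) →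
      a * S + s * ∫ x in Ω, (inner ℝ (flux A b (fun x => max (u x) 0) (posGrad u G) x) (∇ φ x)
        + source c d (fun x => max (u x) 0) (posGrad u G) x * φ x) ≤ 0 := by
    intro φ hφ a s has
    have hF : ContDiff ℝ ∞ fun t : ℝ => a + s * t := by fun_prop
    have hFd : ∀ t, deriv (fun t : ℝ => a + s * t) t = s := fun t => by
      simp
    have h1 := hsol.posPart_nonpos hn hΩo hΩb hA hb hc hd hu (hχ.mul_comp hφ hF)
      fun x => mul_nonneg (hχ0 x) (has x)
    have hyi : IntegrableOn (source c d (fun x => max (u x) 0) (posGrad u G)) Ω := by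
      have := integrable_functional hn hX hy (hχ.memLp _ Ω) (hχ.memLp_gradient _ Ω)
      refine this.congr ?_
      filter_upwards [ae_restrict_mem hΩo.measurableSet] with x hx
      simp [hχ1 x hx]
    refine le_trans (le_of_eq ?_) h1
    rw [hS, ← integral_const_mul, ← integral_const_mul, ← integral_add (hyi.const_mul a)
      ((integrable_functional hn hX hy (hφ.memLp _ Ω) (hφ.memLp_gradient _ Ω)).const_mul s)]
    refine integral_congr_ae ?_
    filter_upwards [ae_restrict_mem hΩo.measurableSet] with x hx
    rw [hχ.gradient_mul_comp hφ hF, hFd, (hχ1 x hx).1, (hχ1 x hx).2]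
    simp only [smul_zero, one_mul, zero_add, real_inner_smul_right]
    ring
  intro φ hφ
  obtain ⟨C, hC0, hC, -⟩ := hφ.exists_bound
  -- With `C` a bound for `|φ|`, both `C + φ` and `C - φ` are admissible. As `C S ≥ 0`, the form at
  -- `φ` is at most `0` and at least `0`.
  have h1 := key φ hφ C 1 fun x => by linarith [neg_abs_le (φ x), hC x]
  have h2 := key φ hφ C (-1) fun x => by linarith [le_abs_self (φ x), hC x]
  have h3 := mul_nonneg hC0 hS0
  linarith

/-- Under the sign condition on `(c, d)`, every solution vanishes or has a sign. -/
theorem IsWeakSolution.sign_of_signCondition_c (hn : 3 ≤ n) (hΩo : IsOpen Ω)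
    (hΩc : IsPreconnected Ω) (hΩb : Bornology.IsBounded Ω)
    (hA : IsUniformlyElliptic Ω A lam Lam)
    (hb : MemLp b (n : ℝ≥0∞) (volume.restrict Ω)) (hc : MemLp c (n : ℝ≥0∞) (volume.restrict Ω))
    (hd : MemLp d ((n : ℝ≥0∞) / 2) (volume.restrict Ω)) (hsign : SignCondition Ω c d)
    (hu : YLim Ω ψ u G) (hsol : IsWeakSolution Ω A b c d u G) :
    (∀ᵐ x ∂(volume.restrict Ω), u x ≤ 0) ∨ (∀ᵐ x ∂(volume.restrict Ω), 0 < u x) := by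
  obtain ⟨ψ', hY, -⟩ := hu.exists_posPart hn hΩo hΩb
  have hpos := hsol.posPart hn hΩo hΩb hA hb hc hd hsign hu
  have hsup : IsSupersolution Ω A b c d (fun x => max (u x) 0) (posGrad u G) :=
    fun φ hφ _ => (hpos φ hφ).ge
  refine (hsup.ae_zero_or_pos hn hΩo hΩc hΩb hA hb hc hd hY
    (Eventually.of_forall fun x => le_max_right _ _)).imp (fun h => ?_) (fun h => ?_)
  · filter_upwards [h] with x hx
    exact (le_max_left _ _).trans hx.le
  · filter_upwards [h] with x hx
    exact (lt_max_iff.1 hx).resolve_right (lt_irrefl 0)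

end PosPart

/-! ### Lipschitz domains have the cone property -/

section Cone

variable {n : ℕ} {Ω : Set (E n)}

/-- A nonempty open set contains a basis: take the vectors `p + τ e_l` near one of its points `p`.
They are independent when `τ` and `τ + ∑ p_i` are nonzero, as summing the coordinates of a linear
relation shows. -/
theorem exists_linearEquiv_single_mem {U : Set (E n)} (hU : IsOpen U) (hne : U.Nonempty) :
    ∃ T : (Fin n → ℝ) ≃ₗ[ℝ] E n, ∀ l, T (Pi.single l 1) ∈ U := by
  obtain ⟨p, hp⟩ := hne
  obtain ⟨ρ, hρ, hball⟩ := Metric.isOpen_iff.1 hU p hp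
  -- Only one value of `τ` is excluded, so one of `ρ / 2` and `ρ / 3` works.
  obtain ⟨τ, hτ0, hτρ, hτ⟩ : ∃ τ : ℝ, 0 < τ ∧ τ < ρ ∧ τ + ∑ i, p i ≠ 0 := by
    by_cases h : ρ / 2 + ∑ i, p i = 0
    · exact ⟨ρ / 3, by linarith, by linarith, fun h' => by linarith⟩
    · exact ⟨ρ / 2, by linarith, by linarith, h⟩
  let f : (Fin n → ℝ) →ₗ[ℝ] E n :=
    { toFun := fun y => τ • WithLp.toLp 2 y + (∑ i, y i) • p
      map_add' := fun y z => by
        simp only [WithLp.toLp_add, Pi.add_apply, Finset.sum_add_distrib]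
        module
      map_smul' := fun a y => by
        simp only [WithLp.toLp_smul, Pi.smul_apply, smul_eq_mul, ← Finset.mul_sum, RingHom.id_apply]
        module }
  have hf : ∀ y i, f y i = τ * y i + (∑ i, y i) * p i := fun y i => by simp [f]
  have hinj : Function.Injective f := by
    rw [injective_iff_map_eq_zero]
    intro y hy
    have h1 : ∀ i, τ * y i + (∑ i, y i) * p i = 0 := fun i => by rw [← hf, hy]; rfl
    have h2 : (∑ i, y i) * (τ + ∑ i, p i) = 0 := by
      have h3 : ∑ i, (τ * y i + (∑ i, y i) * p i) = 0 := Finset.sum_eq_zero fun i _ => h1 i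
      rw [Finset.sum_add_distrib, ← Finset.mul_sum, ← Finset.mul_sum] at h3
      linarith
    have h4 := (mul_eq_zero.1 h2).resolve_right hτ
    funext i
    have h5 := h1 i
    rw [h4, zero_mul, add_zero] at h5
    exact (mul_eq_zero.1 h5).resolve_left hτ0.ne'
  refine ⟨LinearEquiv.ofInjectiveOfFinrankEq f hinj (by simp), fun l => hball ?_⟩
  have h6 : f (Pi.single l 1) - p = τ • EuclideanSpace.single l (1 : ℝ) := by
    have : ∑ i, (Pi.single l 1 : Fin n → ℝ) i = 1 := by simp
    ext i
    rw [PiLp.sub_apply, hf, this]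
    simp [Pi.single_apply]
  rw [Metric.mem_ball, dist_eq_norm]
  change ‖f (Pi.single l 1) - p‖ < ρ
  rw [h6, norm_smul]
  simpa [abs_of_pos hτ0] using hτρ

/-- Above the graph of an `M`-Lipschitz function, one may move by any short vector `v` with `M |v'|
< vₙ` without leaving the domain. Such vectors form an open set and hence contain a basis, one for
each boundary ball. What the boundary balls leave of the closure of `Ω` is a compact subset of `Ω`,
where any sufficiently short basis will do. -/
theorem exists_cone_pieces (hΩ : IsBoundedLipschitzDomain Ω) :
    ∃ (m : ℕ) (S : Fin m → Set (E n)) (T : Fin m → ((Fin n → ℝ) ≃ₗ[ℝ] E n)),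
      (∀ i, MeasurableSet (S i)) ∧ Ω ⊆ ⋃ i, S i ∧
      ∀ i, ∀ x ∈ S i ∩ Ω, ∀ l, ∀ t ∈ Set.Icc (0 : ℝ) 1, x + t • T i (Pi.single l 1) ∈ Ω := by
  obtain ⟨hbd, M, N, hopen, -, r, hr, q, -, hcov, hgraph⟩ := hΩ
  set K : Set (E n) := closure Ω \ ⋃ i, Metric.ball (q i) r with hK
  have hKc : IsCompact K := hbd.isCompact_closure.diff (isOpen_iUnion fun i => Metric.isOpen_ball)
  have hKΩ : K ⊆ Ω := by
    intro x hx
    by_contra hxΩ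
    refine hx.2 (hcov ?_)
    rw [hopen.frontier_eq]
    exact ⟨hx.1, hxΩ⟩
  obtain ⟨δ, hδ, hthick⟩ := hKc.exists_thickening_subset_open hopen hKΩ
  obtain ⟨T0, hT0⟩ := exists_linearEquiv_single_mem (n := n) (U := Metric.ball 0 δ)
    Metric.isOpen_ball ⟨0, by simpa using hδ⟩
  have hT : ∀ i, ∃ T : (Fin n → ℝ) ≃ₗ[ℝ] E n, ∀ x ∈ Metric.ball (q i) r ∩ Ω, ∀ l,
      ∀ t ∈ Set.Icc (0 : ℝ) 1, x + t • T (Pi.single l 1) ∈ Ω := by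
    intro i
    obtain ⟨ψ, hψ, -, R, hR⟩ := hgraph i
    obtain ⟨T, hT⟩ := exists_linearEquiv_single_mem (n := n)
      (U := {v | M * ‖(R v).fst‖ < (R v).snd} ∩ Metric.ball 0 r)
      ((isOpen_lt (by fun_prop) (by fun_prop)).inter Metric.isOpen_ball)
      -- The open set of admissible directions contains the vertical vector of length `r / 2`.
      ⟨R.symm (WithLp.toLp 2 (0, r / 2)), by
        constructor
        · simp [hr]
        · rw [mem_ball_zero_iff, LinearIsometryEquiv.norm_map, WithLp.prod_norm_eq_of_L2]
          rw [Real.sqrt_lt' hr]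
          have e1 : ‖(WithLp.toLp 2 ((0 : E (n - 1)), r / 2)).fst‖ = 0 := norm_zero
          have e2 : ‖(WithLp.toLp 2 ((0 : E (n - 1)), r / 2)).snd‖ ^ 2 = (r / 2) ^ 2 := sq_abs _
          rw [e1, e2]
          nlinarith⟩
    refine ⟨T, fun x hx l t ht => ?_⟩
    obtain ⟨hcone, hnorm⟩ := hT l
    set v := T (Pi.single l 1)
    rw [Set.mem_ofPred_eq] at hcone
    rw [mem_ball_zero_iff] at hnorm
    have hxb : dist x (q i) < r := hx.1
    -- The point `x` is within `r` of `q i` and the displacement has length at most `r`, so the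
    -- moved point, within `2 r` of `q i`, still lies in the ball of the graph description.
    have hMr : (10 : ℝ) * r ≤ 10 * ((M : ℝ) + 1) * r := by
      have : 0 ≤ (M : ℝ) * r := by positivity
      linarith
    have htv : ‖t • v‖ ≤ r := by
      rw [norm_smul, Real.norm_eq_abs, abs_of_nonneg ht.1]
      nlinarith [norm_nonneg v, ht.2]
    have hx1 : x ∈ Metric.ball (q i) (10 * ((M : ℝ) + 1) * r) := by
      rw [Metric.mem_ball]; linarith
    have hx2 : x + t • v ∈ Metric.ball (q i) (10 * ((M : ℝ) + 1) * r) := by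
      rw [Metric.mem_ball]
      have := dist_triangle (x + t • v) x (q i)
      rw [dist_eq_norm (x + t • v) x, add_sub_cancel_left] at this
      linarith
    rw [hR _ hx2]
    have h1 := (hR _ hx1).1 hx.2
    have e : R (x + t • v - q i) = R (x - q i) + t • R v := by
      rw [← LinearIsometryEquiv.map_smul, ← LinearIsometryEquiv.map_add]; congr 1; abel
    rw [e, WithLp.add_fst, WithLp.add_snd, WithLp.smul_fst, WithLp.smul_snd]
    have h2 := hψ.dist_le_mul ((R (x - q i)).fst + t • (R v).fst) (R (x - q i)).fst
    rw [dist_eq_norm ((R (x - q i)).fst + _), add_sub_cancel_left, norm_smul, Real.norm_eq_abs t,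
      abs_of_nonneg ht.1, Real.dist_eq] at h2
    have h3 := (le_abs_self _).trans h2
    have h4 : t * (M * ‖(R v).fst‖) ≤ t * (R v).snd := mul_le_mul_of_nonneg_left hcone.le ht.1
    rw [smul_eq_mul]
    linarith
  choose T hT using hT
  refine ⟨N + 1, Fin.cons K fun i => Metric.ball (q i) r, Fin.cons T0 T, ?_, ?_, ?_⟩
  · intro i
    refine Fin.cases ?_ (fun i => ?_) i
    · exact hKc.measurableSet
    · exact measurableSet_ball
  · intro x hx
    by_cases h : x ∈ ⋃ i, Metric.ball (q i) r
    · obtain ⟨i, hi⟩ := Set.mem_iUnion.1 h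
      exact Set.mem_iUnion.2 ⟨i.succ, hi⟩
    · exact Set.mem_iUnion.2 ⟨0, subset_closure hx, h⟩
  · intro i
    refine Fin.cases ?_ (fun i => ?_) i
    · intro x hx l t ht
      refine hthick (Metric.mem_thickening_iff.2 ⟨x, hx.1, ?_⟩)
      have := hT0 l
      rw [mem_ball_zero_iff] at this
      rw [dist_eq_norm, Fin.cons_zero, add_sub_cancel_left, norm_smul, Real.norm_eq_abs,
        abs_of_nonneg ht.1]
      exact (mul_le_of_le_one_left (norm_nonneg _) ht.2).trans_lt this
    · exact hT i

end Cone

/-! ### The Gagliardo–Nirenberg–Sobolev inequality on domains with the cone property -/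

section Sobolev

variable {n : ℕ} {Ω : Set (E n)}

/-- Gagliardo's argument in the coordinates given by `T`. Each of the `n` segments at `x` lies in
`Ω` and bounds `|g x|` by a line integral of `|g| + D |∇g|` over `Ω`; the `l`-th of these does not
depend on the `l`-th coordinate. The grid-lines inequality `lintegral_prod_lintegral_pow_le`
integrates their product; the constant `κ` is the factor by which `T` changes volume. -/
theorem lintegral_cone_piece_le (hn : 3 ≤ n) (hΩo : IsOpen Ω) {S : Set (E n)}
    (hS : MeasurableSet S) (T : (Fin n → ℝ) ≃ₗ[ℝ] E n)
    (hT : ∀ x ∈ S ∩ Ω, ∀ l, ∀ t ∈ Set.Icc (0 : ℝ) 1, x + t • T (Pi.single l 1) ∈ Ω) :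
    ∃ C : ℝ≥0∞, C ≠ ⊤ ∧ ∀ g : E n → ℝ, ContDiff ℝ 1 g →
      ∫⁻ x in S ∩ Ω, ‖g x‖ₑ ^ ((n : ℝ) / (n - 1))
        ≤ C * (∫⁻ x in Ω, (‖g x‖ₑ + ‖fderiv ℝ g x‖ₑ)) ^ ((n : ℝ) / (n - 1)) := by
  have hn3 : (3 : ℝ) ≤ n := by exact_mod_cast hn
  set p : ℝ := (n : ℝ) / (n - 1) with hp
  have hp0 : 0 ≤ p := div_nonneg (by linarith) (by linarith)
  -- `D` dominates the length of every segment, and the summand `1` lets it also dominate the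
  -- coefficient of `|g|`.
  set D : ℝ≥0 := 1 + ∑ l, ‖T (Pi.single l 1)‖₊ with hD
  have hDl : ∀ l, ‖T (Pi.single l 1)‖ₑ ≤ D := fun l => by
    rw [enorm_eq_nnnorm, ENNReal.coe_le_coe, hD]
    exact (Finset.single_le_sum (f := fun l => ‖T (Pi.single l 1)‖₊) (fun _ _ => zero_le)
      (Finset.mem_univ l)).trans le_add_self
  have hD1 : (1 : ℝ≥0∞) ≤ D := by
    rw [hD]; push_cast; exact le_self_add
  have hTc : Continuous T := T.toLinearMap.continuous_of_finiteDimensional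
  obtain ⟨κ, hκ0, hκ⟩ : ∃ κ : ℝ≥0, κ ≠ 0 ∧
      Measure.map T (volume : Measure (Fin n → ℝ)) = κ • (volume : Measure (E n)) := by
    have : (Measure.map T (volume : Measure (Fin n → ℝ))).IsAddHaarMeasure :=
      T.toContinuousLinearEquiv.isAddHaarMeasure_map volume
    exact ⟨_, (Measure.addHaarScalarFactor_pos_of_isAddHaarMeasure _ volume).ne',
      Measure.isAddLeftInvariant_eq_smul _ volume⟩
  refine ⟨(κ : ℝ≥0∞)⁻¹ * (κ * D) ^ p, ?_, fun g hg => ?_⟩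
  · have : (κ : ℝ≥0∞) ≠ 0 := by simpa using hκ0
    finiteness
  set F : E n → ℝ≥0∞ := Ω.indicator fun x => ‖g x‖ₑ + ‖fderiv ℝ g x‖ₑ * D with hF
  have hFm : Measurable F := by
    refine Measurable.indicator ?_ hΩo.measurableSet
    have h1 := hg.continuous
    have h2 := hg.continuous_fderiv (by simp)
    exact (h1.enorm.measurable).add (h2.enorm.measurable.mul_const _)
  have hseg : ∀ x ∈ S ∩ Ω, ∀ l, ‖g x‖ₑ ≤ ∫⁻ t : ℝ, F (x + t • T (Pi.single l 1)) := by
    intro x hx l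
    set v := T (Pi.single l 1) with hv
    refine le_trans ?_ (setLIntegral_le_lintegral (Set.Icc (0 : ℝ) 1) _)
    -- The fundamental theorem of calculus is averaged over the endpoint `x + s v`, because `g` need
    -- not vanish anywhere on the segment.
    have h1 : ∀ s ∈ Set.Icc (0 : ℝ) 1, ‖g x‖ₑ
        ≤ ‖g (x + s • v)‖ₑ + ∫⁻ t in Set.Icc (0 : ℝ) 1, ‖fderiv ℝ g (x + t • v)‖ₑ * ‖v‖ₑ := by
      intro s hs
      have h2 := enorm_sub_le_lintegral_segment hg x v hs
      refine le_trans ?_ (add_le_add_right h2 _)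
      rw [← enorm_neg (g (x + s • v) - g x)]
      refine le_trans (le_of_eq ?_) (enorm_add_le _ _)
      congr 1; ring
    have hgc := hg.continuous
    calc ‖g x‖ₑ = ∫⁻ s in Set.Icc (0 : ℝ) 1, ‖g x‖ₑ := by simp
      _ ≤ ∫⁻ s in Set.Icc (0 : ℝ) 1, (‖g (x + s • v)‖ₑ
          + ∫⁻ t in Set.Icc (0 : ℝ) 1, ‖fderiv ℝ g (x + t • v)‖ₑ * ‖v‖ₑ) :=
          setLIntegral_mono' measurableSet_Icc h1
      _ = ∫⁻ s in Set.Icc (0 : ℝ) 1, (‖g (x + s • v)‖ₑ + ‖fderiv ℝ g (x + s • v)‖ₑ * ‖v‖ₑ) := by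
          have hm : Measurable fun s : ℝ => ‖g (x + s • v)‖ₑ :=
            Continuous.measurable (by fun_prop)
          rw [lintegral_add_left hm, lintegral_add_left hm]
          simp
      _ ≤ _ := by
          refine setLIntegral_mono' measurableSet_Icc fun s hs => ?_
          rw [hF, Set.indicator_of_mem (hT x hx l s hs)]
          gcongr
          exact hDl l
  have hline : ∀ y : Fin n → ℝ, T y ∈ S ∩ Ω → ∀ l,
      ‖g (T y)‖ₑ ≤ ∫⁻ s : ℝ, F (T (Function.update y l s)) := by
    intro y hy l
    refine (hseg _ hy l).trans (le_of_eq ?_)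
    rw [← lintegral_add_right_eq_self (fun s : ℝ => F (T (Function.update y l s))) (y l)]
    refine lintegral_congr fun t => ?_
    have : Function.update y l (t + y l) = y + t • Pi.single l 1 := by
      ext i
      by_cases hi : i = l
      · subst hi; simp [add_comm]
      · simp [hi]
    rw [this, map_add, map_smul]
  have hgrid := lintegral_prod_lintegral_pow_le (ι := Fin n) (fun _ => (volume : Measure ℝ))
    (p := p) (by
      rw [Fintype.card_fin]
      exact Real.HolderConjugate.conjExponent (by linarith)) (f := fun y => F (T y))
    (hFm.comp hTc.measurable)
  rw [Fintype.card_fin, ← volume_pi] at hgrid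
  -- The exponent `n / (n - 1)` is shared equally among the `n` directions, each estimated by its
  -- own line integral.
  have hpow : ∀ a : ℝ≥0∞, a ^ p = ∏ _l : Fin n, a ^ (1 / ((n : ℝ) - 1)) := by
    intro a
    rw [Finset.prod_const, Finset.card_univ, Fintype.card_fin, ← ENNReal.rpow_natCast,
      ← ENNReal.rpow_mul, hp]
    congr 1
    ring
  have hmap : ∀ H : E n → ℝ≥0∞, Measurable H → ∫⁻ y, H (T y) = κ * ∫⁻ x, H x := by
    intro H hH
    rw [← lintegral_map hH hTc.measurable, hκ, lintegral_smul_measure]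
    rfl
  have hSΩ : MeasurableSet (S ∩ Ω) := hS.inter hΩo.measurableSet
  have h1 : κ * ∫⁻ x in S ∩ Ω, ‖g x‖ₑ ^ p ≤ (κ * ∫⁻ x, F x) ^ p := by
    rw [← hmap F hFm, ← lintegral_indicator hSΩ, ← hmap]
    · refine le_trans (lintegral_mono fun y => ?_) hgrid
      by_cases hy : T y ∈ S ∩ Ω
      · rw [Set.indicator_of_mem hy, hpow]
        refine Finset.prod_le_prod' fun l _ => ?_
        exact ENNReal.rpow_le_rpow (hline y hy l) (div_nonneg zero_le_one (by linarith))
      · rw [Set.indicator_of_notMem hy]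
        exact zero_le
    · exact (hg.continuous.enorm.measurable.pow_const _).indicator hSΩ
  have h2 : ∫⁻ x, F x ≤ D * ∫⁻ x in Ω, (‖g x‖ₑ + ‖fderiv ℝ g x‖ₑ) := by
    rw [hF, lintegral_indicator hΩo.measurableSet, ← lintegral_const_mul' _ _ (by simp)]
    refine lintegral_mono fun x => ?_
    rw [mul_add, mul_comm (‖fderiv ℝ g x‖ₑ)]
    gcongr
    exact le_mul_of_one_le_left zero_le hD1
  have hκ' : (κ : ℝ≥0∞) ≠ 0 := by simpa using hκ0
  rw [mul_assoc, ← ENNReal.mul_rpow_of_nonneg _ _ hp0, ← ENNReal.mul_le_iff_le_inv hκ' (by simp)]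
  refine h1.trans ?_
  rw [mul_assoc]
  gcongr

theorem exists_lintegral_rpow_le (hn : 3 ≤ n) (hΩ : IsBoundedLipschitzDomain Ω) :
    ∃ C : ℝ≥0∞, C ≠ ⊤ ∧ ∀ g : E n → ℝ, ContDiff ℝ 1 g →
      ∫⁻ x in Ω, ‖g x‖ₑ ^ ((n : ℝ) / (n - 1))
        ≤ C * (∫⁻ x in Ω, (‖g x‖ₑ + ‖fderiv ℝ g x‖ₑ)) ^ ((n : ℝ) / (n - 1)) := by
  obtain ⟨m, S, T, hS, hcov, hT⟩ := exists_cone_pieces hΩ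
  have hΩo : IsOpen Ω := by
    obtain ⟨-, -, -, h, -⟩ := hΩ
    exact h
  choose C hC hCle using fun i => lintegral_cone_piece_le hn hΩo (hS i) (T i) (hT i)
  refine ⟨∑ i, C i, by simp [hC], fun g hg => ?_⟩
  rw [Finset.sum_mul]
  refine le_trans ?_ (Finset.sum_le_sum fun i _ => hCle i g hg)
  have : Ω ⊆ ⋃ i, S i ∩ Ω := fun x hx => by
    obtain ⟨i, hi⟩ := Set.mem_iUnion.1 (hcov hx)
    exact Set.mem_iUnion.2 ⟨i, hi, hx⟩
  refine (lintegral_mono_set this).trans ((lintegral_iUnion_le _ _).trans ?_)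
  rw [tsum_fintype]

/-- The Sobolev inequality on bounded Lipschitz domains. -/
theorem IsTestFunction.exists_sobolev (hn : 3 ≤ n) (hΩ : IsBoundedLipschitzDomain Ω) :
    ∃ C : ℝ≥0∞, C ≠ ⊤ ∧ ∀ φ : E n → ℝ, IsTestFunction φ →
      eLpNorm φ (sobolevExponent n) (volume.restrict Ω)
        ≤ C * (eLpNorm φ 2 (volume.restrict Ω) + eLpNorm (∇ φ) 2 (volume.restrict Ω)) := by
  have hn3 : (3 : ℝ) ≤ n := by exact_mod_cast hn
  obtain ⟨C, hC, hCle⟩ := exists_lintegral_rpow_le hn hΩ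
  obtain ⟨N, hN⟩ : ∃ N : ℝ, (n : ℝ) = N := ⟨_, rfl⟩
  rw [hN] at hn3 hCle
  set p : ℝ := 2 * N / (N - 2) with hp
  set p' : ℝ := N / (N - 1) with hp'
  -- The `L¹` inequality is applied to `|φ|^γ`. This `γ` equals `2 (n - 1) / (n - 2)`: then `γ p' =
  -- p`, and `γ - 1 = p / 2` makes Cauchy–Schwarz produce the square root of `∫ |φ|^p`.
  set γ : ℝ := p / 2 + 1 with hγ
  have hN2 : 0 < N - 2 := by linarith
  have hN1 : 0 < N - 1 := by linarith
  have hp0 : 0 < p := by positivity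
  have hγ1 : 1 < γ := by rw [hγ]; linarith
  have hγp : γ * p' = p := by rw [hγ, hp, hp']; field_simp; ring
  have hptoReal : (sobolevExponent n).toReal = p := by
    rw [sobolevExponent, hN]
    exact ENNReal.toReal_ofReal hp0.le
  set Γ : ℝ≥0∞ := ENNReal.ofReal γ with hΓ
  have hΓ1 : 1 ≤ Γ := ENNReal.one_le_ofReal.2 hγ1.le
  refine ⟨C ^ (1 / p') * Γ, by finiteness, fun φ hφ => ?_⟩
  set I : ℝ≥0∞ := ∫⁻ x in Ω, ‖φ x‖ₑ ^ p with hI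
  have hnorm : eLpNorm φ (sobolevExponent n) (volume.restrict Ω) = I ^ (1 / p) := by
    rw [eLpNorm_eq_lintegral_rpow_enorm_toReal (sobolevExponent_ne_zero hn) sobolevExponent_ne_top,
      hptoReal]
  have hItop : I ≠ ⊤ := by
    have := lintegral_rpow_enorm_lt_top_of_eLpNorm_lt_top (sobolevExponent_ne_zero hn)
      sobolevExponent_ne_top (hφ.memLp (sobolevExponent n) Ω).2
    rw [hptoReal] at this
    exact this.ne
  set M : ℝ≥0∞ := eLpNorm φ 2 (volume.restrict Ω) + eLpNorm (∇ φ) 2 (volume.restrict Ω) with hM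
  have hφc := hφ.1.continuous
  have hgrad := hφ.continuous_gradient
  -- the inequality for `|φ| ^ γ`
  set g : E n → ℝ := fun x => |φ x| ^ γ with hg
  have hder : ∀ x, HasFDerivAt g ((γ * |φ x| ^ (γ - 2) * φ x) • fderiv ℝ φ x) x := fun x =>
    (hasDerivAt_abs_rpow (φ x) hγ1).comp_hasFDerivAt x (hφ.differentiable x).hasFDerivAt
  have hg1 : ContDiff ℝ 1 g := (hφ.1.of_le (by simp)).norm_rpow hγ1
  have e0 : ∀ x, ‖g x‖ₑ = ‖φ x‖ₑ ^ γ := fun x => by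
    rw [hg, Real.enorm_rpow_of_nonneg (abs_nonneg _) (by linarith), Real.enorm_abs]
  have e1 : ∀ x, ‖g x‖ₑ ^ p' = ‖φ x‖ₑ ^ p := fun x => by
    rw [e0, ← ENNReal.rpow_mul, hγp]
  have e2 : ∀ x, ‖g x‖ₑ + ‖fderiv ℝ g x‖ₑ ≤ ‖φ x‖ₑ ^ (p / 2) * (Γ * (‖φ x‖ₑ + ‖∇ φ x‖ₑ)) := by
    intro x
    have h1 : ‖γ * |φ x| ^ (γ - 2) * φ x‖ₑ = Γ * ‖φ x‖ₑ ^ (p / 2) := by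
      have h2 : ‖γ * |φ x| ^ (γ - 2) * φ x‖ = γ * |φ x| ^ (p / 2) := by
        rw [norm_mul, norm_mul, Real.norm_of_nonneg (by linarith : 0 ≤ γ),
          Real.norm_of_nonneg (by positivity : 0 ≤ |φ x| ^ (γ - 2)), Real.norm_eq_abs, mul_assoc]
        congr 1
        rcases eq_or_ne (φ x) 0 with h | h
        · rw [h, abs_zero, mul_zero, Real.zero_rpow (by positivity)]
        · rw [← Real.rpow_add_one (abs_ne_zero.2 h)]
          congr 1
          rw [hγ]; ring
      rw [← ofReal_norm, h2, ENNReal.ofReal_mul (by linarith), ← Real.enorm_abs (φ x),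
        ← Real.enorm_rpow_of_nonneg (abs_nonneg _) (by positivity),
        Real.enorm_of_nonneg (by positivity)]
    rw [e0, (hder x).fderiv, enorm_smul, h1, enorm_gradient, hγ,
      ENNReal.rpow_add_of_nonneg _ _ (by positivity) zero_le_one, ENNReal.rpow_one, mul_add, mul_add]
    refine add_le_add ?_ (le_of_eq (by ring))
    rw [mul_left_comm]
    exact le_mul_of_one_le_left zero_le hΓ1
  have hHolder : ∫⁻ x in Ω, (‖g x‖ₑ + ‖fderiv ℝ g x‖ₑ) ≤ I ^ (1 / 2 : ℝ) * (Γ * M) := by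
    have hm1 : AEMeasurable (fun x => ‖φ x‖ₑ ^ (p / 2)) (volume.restrict Ω) :=
      (hφc.enorm.measurable.pow_const _).aemeasurable
    have hm2 : AEMeasurable (fun x => ‖φ x‖ₑ) (volume.restrict Ω) :=
      hφc.enorm.measurable.aemeasurable
    have hm3 : AEMeasurable (fun x => ‖∇ φ x‖ₑ) (volume.restrict Ω) :=
      hgrad.enorm.measurable.aemeasurable
    have h1 := ENNReal.lintegral_mul_le_Lp_mul_Lq (volume.restrict Ω) Real.HolderConjugate.two_two
      hm1 (hm2.add hm3)
    have h2 := ENNReal.lintegral_Lp_add_le (p := 2) hm2 hm3 (by norm_num)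
    have h3 : ∀ x, (‖φ x‖ₑ ^ (p / 2)) ^ (2 : ℝ) = ‖φ x‖ₑ ^ p := fun x => by
      rw [← ENNReal.rpow_mul]; congr 1; ring
    have h4 : M = (∫⁻ x in Ω, ‖φ x‖ₑ ^ (2 : ℝ)) ^ (1 / 2 : ℝ)
        + (∫⁻ x in Ω, ‖∇ φ x‖ₑ ^ (2 : ℝ)) ^ (1 / 2 : ℝ) := by
      rw [hM, eLpNorm_eq_lintegral_rpow_enorm_toReal two_ne_zero ENNReal.ofNat_ne_top,
        eLpNorm_eq_lintegral_rpow_enorm_toReal two_ne_zero ENNReal.ofNat_ne_top]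
      simp
    simp only [h3] at h1
    calc ∫⁻ x in Ω, (‖g x‖ₑ + ‖fderiv ℝ g x‖ₑ)
        ≤ ∫⁻ x in Ω, Γ * (‖φ x‖ₑ ^ (p / 2) * (‖φ x‖ₑ + ‖∇ φ x‖ₑ)) :=
          lintegral_mono fun x => (e2 x).trans (le_of_eq (by ring))
      _ = Γ * ∫⁻ x in Ω, ‖φ x‖ₑ ^ (p / 2) * (‖φ x‖ₑ + ‖∇ φ x‖ₑ) :=
          lintegral_const_mul' _ _ ENNReal.ofReal_ne_top
      _ ≤ Γ * (I ^ (1 / 2 : ℝ) * M) := by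
          refine mul_le_mul le_rfl (h1.trans ?_) zero_le zero_le
          rw [h4]
          exact mul_le_mul le_rfl h2 zero_le zero_le
      _ = _ := by ring
  have hmain : I ≤ C * (I ^ (1 / 2 : ℝ) * (Γ * M)) ^ p' := by
    refine le_trans (le_of_eq ?_) ((hCle g hg1).trans ?_)
    · exact lintegral_congr fun x => (e1 x).symm
    · gcongr
  have hp'0 : 0 < p' := by positivity
  rw [hnorm]
  rcases eq_or_ne I 0 with h0 | h0
  · rw [h0, ENNReal.zero_rpow_of_pos (by positivity)]
    exact zero_le
  have h1 : I ^ (1 / p') ≤ C ^ (1 / p') * (I ^ (1 / 2 : ℝ) * (Γ * M)) := by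
    have := ENNReal.rpow_le_rpow hmain (by positivity : 0 ≤ 1 / p')
    rwa [ENNReal.mul_rpow_of_nonneg _ _ (by positivity), ← ENNReal.rpow_mul _ p',
      mul_one_div_cancel hp'0.ne', ENNReal.rpow_one] at this
  have h2 : I ^ (1 / p') = I ^ (1 / 2 : ℝ) * I ^ (1 / p) := by
    rw [← ENNReal.rpow_add _ _ h0 hItop]
    congr 1
    rw [hp, hp']; field_simp; ring
  rw [h2, mul_left_comm] at h1
  have h3 : I ^ (1 / 2 : ℝ) ≠ 0 := by simp [ENNReal.rpow_eq_zero_iff, h0, hItop]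
  have h4 : I ^ (1 / 2 : ℝ) ≠ ⊤ := by finiteness
  rw [mul_assoc]
  exact (ENNReal.mul_le_mul_iff_right h3 h4).1 h1

end Sobolev

/-! ### The sign condition on `(b, d)` -/

section SignB

variable {n : ℕ} {Ω : Set (E n)} {A : E n → Matrix (Fin n) (Fin n) ℝ} {lam Lam : ℝ}
  {b c : E n → E n} {d : E n → ℝ} {ψ : ℕ → E n → ℝ} {u v : E n → ℝ} {G V : E n → E n}

/-- The Sobolev inequality for limits of test functions. -/
theorem YLim.exists_sobolev (hn : 3 ≤ n) (hΩ : IsBoundedLipschitzDomain Ω) :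
    ∃ C : ℝ≥0∞, C ≠ ⊤ ∧ ∀ (ψ : ℕ → E n → ℝ) (v : E n → ℝ) (V : E n → E n), YLim Ω ψ v V →
      eLpNorm v (sobolevExponent n) (volume.restrict Ω)
        ≤ C * (eLpNorm v 2 (volume.restrict Ω) + eLpNorm V 2 (volume.restrict Ω)) := by
  have := isFiniteMeasure_restrict hΩ.1
  obtain ⟨C, hC, hCle⟩ := IsTestFunction.exists_sobolev hn hΩ
  refine ⟨C, hC, fun ψ v V h => ?_⟩
  have hlim : Tendsto (fun k => C * ((eLpNorm (fun x => ψ k x - v x) 2 (volume.restrict Ω)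
      + eLpNorm v 2 (volume.restrict Ω)) + (eLpNorm (fun x => ∇ (ψ k) x - V x) 2
        (volume.restrict Ω) + eLpNorm V 2 (volume.restrict Ω)))
      + eLpNorm (fun x => ψ k x - v x) (sobolevExponent n) (volume.restrict Ω)) atTop
      (𝓝 (C * ((0 + eLpNorm v 2 (volume.restrict Ω)) + (0 + eLpNorm V 2 (volume.restrict Ω)))
        + 0)) := by
    refine Tendsto.add (ENNReal.Tendsto.const_mul ?_ (Or.inr hC)) h.tendsto
    exact ((h.tendsto_two hn).add_const _).add (h.tendsto_gradient.add_const _)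
  simp only [zero_add, add_zero] at hlim
  refine ge_of_tendsto' hlim fun k => ?_
  have hψm := ((h.test k).memLp 1 Ω).1
  have hψm' := ((h.test k).memLp_gradient 1 Ω).1
  have h1 : eLpNorm v (sobolevExponent n) (volume.restrict Ω)
      ≤ eLpNorm (ψ k) (sobolevExponent n) (volume.restrict Ω)
        + eLpNorm (fun x => ψ k x - v x) (sobolevExponent n) (volume.restrict Ω) := by
    refine le_trans (le_of_eq ?_)
      (eLpNorm_sub_le hψm (hψm.sub h.memLp.1) (one_le_sobolevExponent hn))
    congr 1
    ext x
    simp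
  refine h1.trans (add_le_add_left ((hCle _ (h.test k)).trans ?_) _)
  refine mul_le_mul le_rfl (add_le_add ?_ ?_) zero_le zero_le
  · refine le_trans (le_of_eq ?_) (eLpNorm_add_le (hψm.sub h.memLp.1) h.memLp.1 (by norm_num))
    congr 1
    ext x
    simp
  · refine le_trans (le_of_eq ?_)
      (eLpNorm_add_le (hψm'.sub h.memLp_gradient.1) h.memLp_gradient.1 (by norm_num))
    congr 1
    ext1 x
    simp

/-- A compactly supported smooth approximation of `t ↦ max (t - k) 0`. -/
def truncRamp (k m t : ℝ) : ℝ := ramp m 0 (t - k) * (1 - Real.smoothTransition (m⁻¹ * t + (-1)))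

theorem contDiff_truncRamp (k m : ℝ) : ContDiff ℝ ∞ (truncRamp k m) :=
  ((contDiff_ramp m 0).comp (contDiff_id.sub contDiff_const)).mul
    (contDiff_const.sub (contDiff_smoothTransition_comp _ _))

theorem deriv_truncRamp (k m t : ℝ) : deriv (truncRamp k m) t
    = deriv (ramp m 0) (t - k) * (1 - Real.smoothTransition (m⁻¹ * t + (-1)))
      - ramp m 0 (t - k) * (m⁻¹ * deriv Real.smoothTransition (m⁻¹ * t + (-1))) := by
  have h1 : HasDerivAt (fun t => ramp m 0 (t - k)) (deriv (ramp m 0) (t - k)) t :=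
    HasDerivAt.comp_sub_const t k ((contDiff_ramp m 0).differentiable (by simp) _).hasDerivAt
  have h2 := (hasDerivAt_smoothTransition_comp m⁻¹ (-1) t).const_sub 1
  have h3 := (h1.mul h2).deriv
  rw [show truncRamp k m = (fun t => ramp m 0 (t - k)) *
    fun t => 1 - Real.smoothTransition (m⁻¹ * t + (-1)) from rfl, h3]
  ring

theorem ramp_sub_le {k m t : ℝ} (hk : 0 ≤ k) (hm : 0 ≤ m) : ramp m 0 (t - k) ≤ |t| := by
  rcases le_or_gt t k with h | h
  · rw [ramp_of_nonpos (by rw [add_zero]; exact mul_nonpos_of_nonneg_of_nonpos hm (by linarith))]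
    exact abs_nonneg _
  · refine (le_abs_self _).trans ((abs_ramp_le _ _ _).trans ?_)
    rw [abs_of_pos (by linarith), abs_of_pos (by linarith)]
    linarith

theorem truncRamp_nonneg {k m : ℝ} (hm : 0 ≤ m) (t : ℝ) : 0 ≤ truncRamp k m t :=
  mul_nonneg (ramp_nonneg _ _ hm) (by linarith [Real.smoothTransition.le_one (m⁻¹ * t + (-1))])

theorem truncRamp_le {k m : ℝ} (hk : 0 ≤ k) (hm : 0 ≤ m) (t : ℝ) : truncRamp k m t ≤ |t| := by
  refine le_trans ?_ (ramp_sub_le (k := k) hk hm)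
  refine mul_le_of_le_one_right (ramp_nonneg _ _ hm) ?_
  linarith [Real.smoothTransition.nonneg (m⁻¹ * t + (-1))]

theorem truncRamp_eq_zero {k m t : ℝ} (hk : 0 ≤ k) (hm : 0 < m) (ht : t ∉ Set.Icc 0 (2 * m)) :
    truncRamp k m t = 0 := by
  rw [Set.mem_Icc, not_and_or, not_le, not_le] at ht
  rcases ht with ht | ht
  · rw [truncRamp, ramp_of_nonpos, zero_mul]
    rw [add_zero]
    exact mul_nonpos_of_nonneg_of_nonpos hm.le (by linarith)
  · rw [truncRamp, Real.smoothTransition.one_of_one_le, sub_self, mul_zero]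
    have : 2 ≤ m⁻¹ * t := by
      rw [inv_mul_eq_div, le_div_iff₀ hm]; exact ht.le
    linarith

/-- Cutting off at scale `m` costs `|t| m⁻¹ |σ'(t / m - 1)|`, which is bounded independently of `m`.
The uniform bound is the domination needed when `m → ∞`. -/
theorem exists_bound_deriv_truncRamp {k : ℝ} (hk : 0 ≤ k) :
    ∃ K, ∀ m t : ℝ, 0 < m → |deriv (truncRamp k m) t| ≤ K := by
  obtain ⟨K, hK⟩ := exists_bound_deriv_ramp 0
  obtain ⟨L, hL0, hL⟩ := exists_bound_deriv_smoothTransition (-1)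
  refine ⟨K + L, fun m t hm => ?_⟩
  rw [deriv_truncRamp]
  refine (abs_sub _ _).trans (add_le_add ?_ ?_)
  · rw [abs_mul]
    have h1 := Real.smoothTransition.nonneg (m⁻¹ * t + (-1))
    have h2 := Real.smoothTransition.le_one (m⁻¹ * t + (-1))
    refine (mul_le_of_le_one_right (abs_nonneg _) ?_).trans (hK _ _)
    rw [abs_of_nonneg (by linarith)]
    linarith
  · have h1 := (hL (m⁻¹ * t + (-1))).2
    rw [add_sub_cancel_right] at h1
    refine le_trans ?_ h1
    rw [abs_mul, abs_mul, abs_mul, abs_mul, abs_of_nonneg (ramp_nonneg _ _ hm.le), ← mul_assoc,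
      mul_comm (|m⁻¹|)]
    gcongr
    exact ramp_sub_le hk hm.le

/-- The sign condition is tested with `u F(u)`. For `F(t) = (t - k)⁺` this grows quadratically, so
its derivative is unbounded; the compact support of the truncated ramp removes the problem. The
bound may depend on `m`, which is fixed at that stage. -/
theorem exists_bound_deriv_mul_truncRamp {k m : ℝ} (hk : 0 ≤ k) (hm : 0 < m) :
    ∃ K, ∀ t, |deriv (fun t => t * truncRamp k m t) t| ≤ K := by
  have hc : ContDiff ℝ ∞ fun t => t * truncRamp k m t := contDiff_id.mul (contDiff_truncRamp k m)
  have hs : HasCompactSupport fun t => t * truncRamp k m t :=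
    HasCompactSupport.intro (K := Set.Icc 0 (2 * m)) isCompact_Icc fun t ht => by
      rw [truncRamp_eq_zero hk hm ht, mul_zero]
  exact (hc.continuous_deriv (by simp)).bounded_above_of_compact_support hs.deriv

theorem tendsto_truncRamp (k t : ℝ) :
    Tendsto (fun j : ℕ => truncRamp k ((j + 1 : ℕ) : ℝ) t) atTop (𝓝 (max (t - k) 0)) ∧
    Tendsto (fun j : ℕ => deriv (truncRamp k ((j + 1 : ℕ) : ℝ)) t) atTop
      (𝓝 (if 0 < t - k then 1 else 0)) := by
  have h1 := (tendsto_ramp (t - k)).comp (tendsto_add_atTop_nat 1)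
  have h2 := (tendsto_deriv_ramp (t - k)).comp (tendsto_add_atTop_nat 1)
  have hev : ∀ᶠ j : ℕ in atTop, (((j + 1 : ℕ) : ℝ))⁻¹ * t + (-1) ≤ 0 := by
    have : Tendsto (fun j : ℕ => ((j + 1 : ℕ) : ℝ)) atTop atTop :=
      tendsto_natCast_atTop_atTop.comp (tendsto_add_atTop_nat 1)
    filter_upwards [this.eventually_ge_atTop t] with j hj
    have hpos : (0 : ℝ) < ((j + 1 : ℕ) : ℝ) := by positivity
    have : (((j + 1 : ℕ) : ℝ))⁻¹ * t ≤ 1 := by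
      rw [inv_mul_eq_div, div_le_one hpos]; exact hj
    linarith
  refine ⟨h1.congr' ?_, h2.congr' ?_⟩
  · filter_upwards [hev] with j hj
    rw [truncRamp, Real.smoothTransition.zero_of_nonpos hj, sub_zero, mul_one]
    rfl
  · filter_upwards [hev] with j hj
    rw [deriv_truncRamp, Real.smoothTransition.zero_of_nonpos hj,
      deriv_smoothTransition_of_nonpos hj]
    simp

/-- Testing the equation with a function of the solution, using the sign condition on `(b, d)`. -/
theorem IsWeakSolution.integral_comp_nonpos (hn : 3 ≤ n) (hΩo : IsOpen Ω)
    (hΩb : Bornology.IsBounded Ω) (hA : IsUniformlyElliptic Ω A lam Lam)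
    (hb : MemLp b (n : ℝ≥0∞) (volume.restrict Ω)) (hc : MemLp c (n : ℝ≥0∞) (volume.restrict Ω))
    (hd : MemLp d ((n : ℝ≥0∞) / 2) (volume.restrict Ω)) (hsign : SignCondition Ω b d)
    (hu : YLim Ω ψ u G) (hsol : IsWeakSolution Ω A b c d u G) {F : ℝ → ℝ} (hF : ContDiff ℝ ∞ F)
    {K K' : ℝ} (hK : ∀ t, |deriv F t| ≤ K) (hK' : ∀ t, |deriv (fun t => t * F t) t| ≤ K')
    (hF0 : ∀ t, 0 ≤ t * F t) :
    ∫ x in Ω, (deriv F (u x) * inner ℝ (Matrix.toEuclideanCLM (n := Fin n) (𝕜 := ℝ) (A x) (G x))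
      (G x) + F (u x) * inner ℝ (c x - b x) (G x)) ≤ 0 := by
  have := isFiniteMeasure_restrict hΩb
  obtain ⟨χ, hχ, hχ0, hχ1⟩ := exists_cutoff hΩb
  have hX := memLp_flux hn hA hb hu.memLp hu.memLp_gradient
  have hy := memLp_source hn hc hd hu.memLp hu.memLp_gradient
  have hb2 : MemLp b 2 (volume.restrict Ω) := hb.mono_exponent (two_le_natCast hn)
  have hdq : MemLp d (dualExponent n) (volume.restrict Ω) :=
    hd.mono_exponent (dualExponent_le_half hn)
  have hY1 := hu.comp hn hΩo.measurableSet hχ hχ1 hF hK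
  have hY2 := hu.comp hn hΩo.measurableSet hχ hχ1 (contDiff_id.mul hF) hK'
  have h1 := tendsto_nhds_unique (hY1.tendsto_functional hn hX hy)
    (tendsto_const_nhds.congr fun k => (hsol _ (hY1.test k)).symm)
  have h2 := ge_of_tendsto' (hY2.tendsto_functional hn hb2 hdq) fun k =>
    hsign _ (hY2.test k) fun x => mul_nonneg (hχ0 x) (hF0 _)
  -- The equation tested with `F(u)` minus the sign functional tested with `u F(u)`: the terms in
  -- `d` and those in `u F'(u) b · ∇u` cancel, leaving only `c - b` in the first order part.
  have h3 := integral_sub (integrable_functional hn hX hy hY1.memLp hY1.memLp_gradient)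
    (integrable_functional hn hb2 hdq hY2.memLp hY2.memLp_gradient)
  rw [h1, zero_sub] at h3
  refine le_trans (le_of_eq ?_) (h3.trans_le (neg_nonpos.2 h2))
  refine integral_congr_ae (Eventually.of_forall fun x => ?_)
  have hdQ : deriv (fun t => t * F t) (u x) = F (u x) + u x * deriv F (u x) := by
    have h : HasDerivAt (fun t => t * F t) (1 * F (u x) + u x * deriv F (u x)) (u x) :=
      (hasDerivAt_id' (u x)).mul (hF.differentiable (by simp) (u x)).hasDerivAt
    rw [h.deriv, one_mul]
  simp only [id_eq, hdQ, flux, source, inner_add_left, inner_sub_left, real_inner_smul_left,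
    real_inner_smul_right]
  ring

/-- The case `F(t) = (t - k)⁺`, as a limit of compactly supported smooth `F`. A majorant is `K |A∇u
· ∇u| + |u (c - b) · ∇u|`, integrable because `u (c - b) ∈ L²`. Nonnegativity of `t F(t)` relies on
`k ≥ 0`. -/
theorem IsWeakSolution.integral_truncation_nonpos (hn : 3 ≤ n) (hΩo : IsOpen Ω)
    (hΩb : Bornology.IsBounded Ω) (hA : IsUniformlyElliptic Ω A lam Lam)
    (hb : MemLp b (n : ℝ≥0∞) (volume.restrict Ω)) (hc : MemLp c (n : ℝ≥0∞) (volume.restrict Ω))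
    (hd : MemLp d ((n : ℝ≥0∞) / 2) (volume.restrict Ω)) (hsign : SignCondition Ω b d)
    (hu : YLim Ω ψ u G) (hsol : IsWeakSolution Ω A b c d u G) {k : ℝ} (hk : 0 ≤ k) :
    ∫ x in Ω, ((if 0 < u x - k then (1 : ℝ) else 0)
      * inner ℝ (Matrix.toEuclideanCLM (n := Fin n) (𝕜 := ℝ) (A x) (G x)) (G x)
        + max (u x - k) 0 * inner ℝ (c x - b x) (G x)) ≤ 0 := by
  have := isFiniteMeasure_restrict hΩb
  have := holderTriple_sobolev_natCast hn
  obtain ⟨K, hK⟩ := exists_bound_deriv_truncRamp hk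
  have hum : AEStronglyMeasurable u (volume.restrict Ω) := hu.memLp.1
  have hi1 : Integrable (fun x => inner ℝ (Matrix.toEuclideanCLM (n := Fin n) (𝕜 := ℝ) (A x) (G x))
      (G x)) (volume.restrict Ω) :=
    integrable_inner_of_memLp (p := 2) (q := 2) (hA.memLp_apply hu.memLp_gradient)
      hu.memLp_gradient
  have hcb : MemLp (u • (c - b)) 2 (volume.restrict Ω) := (hc.sub hb).smul hu.memLp
  have hi2 : Integrable (fun x => u x * inner ℝ (c x - b x) (G x)) (volume.restrict Ω) := by
    have := integrable_inner_of_memLp (p := 2) (q := 2) hcb hu.memLp_gradient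
    simpa [real_inner_smul_left] using this
  have him : AEStronglyMeasurable (fun x => (inner ℝ (c x - b x) (G x) : ℝ))
      (volume.restrict Ω) := (hc.1.sub hb.1).inner hu.memLp_gradient.1
  refine le_of_tendsto' (tendsto_integral_of_dominated_convergence
    (F := fun (j : ℕ) x => deriv (truncRamp k ((j + 1 : ℕ) : ℝ)) (u x)
      * inner ℝ (Matrix.toEuclideanCLM (n := Fin n) (𝕜 := ℝ) (A x) (G x)) (G x)
        + truncRamp k ((j + 1 : ℕ) : ℝ) (u x) * inner ℝ (c x - b x) (G x))
    (fun x => K * ‖inner ℝ (Matrix.toEuclideanCLM (n := Fin n) (𝕜 := ℝ) (A x) (G x)) (G x)‖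
      + ‖u x * inner ℝ (c x - b x) (G x)‖) (fun j => ?_)
    ((hi1.norm.const_mul K).add hi2.norm) (fun j => Eventually.of_forall fun x => ?_)
    (Eventually.of_forall fun x => ?_)) fun j => ?_
  · have h1 : Continuous (deriv (truncRamp k ((j + 1 : ℕ) : ℝ))) :=
      (contDiff_truncRamp _ _).continuous_deriv (by simp)
    have h2 : Continuous (truncRamp k ((j + 1 : ℕ) : ℝ)) := (contDiff_truncRamp _ _).continuous
    exact ((h1.comp_aestronglyMeasurable hum).mul hi1.1).add
      ((h2.comp_aestronglyMeasurable hum).mul him)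
  · refine (norm_add_le _ _).trans (add_le_add ?_ ?_)
    · rw [norm_mul]
      exact mul_le_mul_of_nonneg_right (hK _ _ (by positivity)) (norm_nonneg _)
    · rw [norm_mul, norm_mul, Real.norm_of_nonneg (truncRamp_nonneg (by positivity) _)]
      exact mul_le_mul_of_nonneg_right (truncRamp_le hk (by positivity) _) (norm_nonneg _)
  · exact ((tendsto_truncRamp k (u x)).2.mul_const _).add
      ((tendsto_truncRamp k (u x)).1.mul_const _)
  · obtain ⟨K', hK'⟩ := exists_bound_deriv_mul_truncRamp (k := k) (m := ((j + 1 : ℕ) : ℝ)) hk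
      (by positivity)
    refine hsol.integral_comp_nonpos hn hΩo hΩb hA hb hc hd hsign hu (contDiff_truncRamp _ _)
      (fun t => hK _ t (by positivity)) hK' fun t => ?_
    by_cases ht : t ∈ Set.Icc 0 (2 * ((j + 1 : ℕ) : ℝ))
    · exact mul_nonneg ht.1 (truncRamp_nonneg (by positivity) _)
    · rw [truncRamp_eq_zero hk (by positivity) ht, mul_zero]

end SignB

/-! ### Energy estimate for truncations, and the dichotomy under the sign condition on `(b, d)` -/

section Absorption

variable {n : ℕ} {Ω : Set (E n)} {A : E n → Matrix (Fin n) (Fin n) ℝ} {lam Lam : ℝ}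
  {b c : E n → E n} {d : E n → ℝ} {ψ : ℕ → E n → ℝ} {u : E n → ℝ} {G : E n → E n}

/-- The indicator function of the set where `u > k`. -/
def superlevel (u : E n → ℝ) (k : ℝ) (x : E n) : ℝ := if 0 < u x - k then 1 else 0

theorem aestronglyMeasurable_superlevel (hu : AEStronglyMeasurable u (volume.restrict Ω)) (k : ℝ) :
    AEStronglyMeasurable (superlevel u k) (volume.restrict Ω) := by
  have hm : Measurable fun t : ℝ => if 0 < t - k then (1 : ℝ) else 0 :=
    Measurable.ite (measurableSet_lt measurable_const (by fun_prop)) measurable_const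
      measurable_const
  exact (hm.comp_aemeasurable hu.aemeasurable).aestronglyMeasurable

theorem norm_superlevel_le (u : E n → ℝ) (k : ℝ) (x : E n) : ‖superlevel u k x‖ ≤ 1 := by
  rw [superlevel]
  split_ifs <;> simp

theorem max_mul_superlevel (u : E n → ℝ) (k : ℝ) (x : E n) :
    max (u x - k) 0 * superlevel u k x = max (u x - k) 0 := by
  rw [superlevel]
  split_ifs with h
  · rw [mul_one]
  · rw [mul_zero, max_eq_right (not_lt.1 h)]

/-- The energy estimate for the truncation `(u - k)⁺`. -/
theorem IsWeakSolution.eLpNorm_posGrad_le (hn : 3 ≤ n) (hΩo : IsOpen Ω)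
    (hΩb : Bornology.IsBounded Ω) (hA : IsUniformlyElliptic Ω A lam Lam)
    (hb : MemLp b (n : ℝ≥0∞) (volume.restrict Ω)) (hc : MemLp c (n : ℝ≥0∞) (volume.restrict Ω))
    (hd : MemLp d ((n : ℝ≥0∞) / 2) (volume.restrict Ω)) (hsign : SignCondition Ω b d)
    (hu : YLim Ω ψ u G) (hsol : IsWeakSolution Ω A b c d u G) {k : ℝ} (hk : 0 ≤ k) :
    ENNReal.ofReal lam * eLpNorm (posGrad (fun x => u x - k) G) 2 (volume.restrict Ω)
      ≤ eLpNorm (fun x => max (u x - k) 0) (sobolevExponent n) (volume.restrict Ω)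
        * eLpNorm (fun x => superlevel u k x • (c x - b x)) n (volume.restrict Ω) := by
  have := isFiniteMeasure_restrict hΩb
  have := holderTriple_sobolev_natCast hn
  have hum := hu.memLp.1
  set V := posGrad (fun x => u x - k) G with hV
  set v : E n → ℝ := fun x => max (u x - k) 0 with hv
  have hv_mem : MemLp v (sobolevExponent n) (volume.restrict Ω) :=
    memLp_posPart (u := fun x => u x - k) (hu.memLp.sub (memLp_const k))
  have hVm : MemLp V 2 (volume.restrict Ω) :=
    memLp_posGrad (hum.sub aestronglyMeasurable_const) hu.memLp_gradient
  have hg : MemLp (fun x => superlevel u k x • (c x - b x)) n (volume.restrict Ω) := by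
    refine (hc.sub hb).mono ((aestronglyMeasurable_superlevel hum k).smul (hc.1.sub hb.1))
      (Eventually.of_forall fun x => ?_)
    rw [norm_smul]
    exact mul_le_of_le_one_left (norm_nonneg _) (norm_superlevel_le _ _ _)
  set Z : E n → E n := v • fun x => superlevel u k x • (c x - b x) with hZ
  have hZm : MemLp Z 2 (volume.restrict Ω) := hg.smul hv_mem
  have hZle := eLpNorm_smul_le_mul_eLpNorm (p := sobolevExponent n) (q := n) (r := 2) hg.1 hv_mem.1
  refine le_trans ?_ hZle
  set N := eLpNorm V 2 (volume.restrict Ω) with hN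
  -- What the truncated inequality gives is quadratic, `λ N² ≤ ‖Z‖₂ N`; one finite nonzero factor
  -- `N` is cancelled.
  rcases eq_or_ne N 0 with h0 | h0
  · rw [h0, mul_zero]
    exact zero_le
  have hNtop : N ≠ ⊤ := hVm.2.ne
  rw [← ENNReal.mul_le_mul_iff_left h0 hNtop]
  have hi1 : Integrable (fun x => superlevel u k x
      * inner ℝ (Matrix.toEuclideanCLM (n := Fin n) (𝕜 := ℝ) (A x) (G x)) (G x))
      (volume.restrict Ω) := by
    refine (integrable_inner_of_memLp (p := 2) (q := 2) (hA.memLp_apply hu.memLp_gradient)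
      hu.memLp_gradient).bdd_mul (c := 1) (aestronglyMeasurable_superlevel hum k)
      (Eventually.of_forall (norm_superlevel_le u k))
  have hi2 : Integrable (fun x => inner ℝ (Z x) (V x)) (volume.restrict Ω) :=
    integrable_inner_of_memLp (p := 2) (q := 2) hZm hVm
  have hV2 : Integrable (fun x => ‖V x‖ ^ 2) (volume.restrict Ω) := hVm.norm.integrable_sq
  have e : ∀ x, max (u x - k) 0 * inner ℝ (c x - b x) (G x) = (inner ℝ (Z x) (V x) : ℝ) := by
    intro x
    simp only [hZ, hV, hv, posGrad, superlevel, Pi.smul_apply', real_inner_smul_left,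
      real_inner_smul_right]
    split_ifs with h
    · ring
    · rw [max_eq_right (not_lt.1 h)]; ring
  have hmain := hsol.integral_truncation_nonpos hn hΩo hΩb hA hb hc hd hsign hu hk
  simp only [e] at hmain
  have h1 := integral_add hi1 hi2
  simp only [superlevel] at h1
  rw [h1] at hmain
  have h2 : ∫ x in Ω, lam * ‖V x‖ ^ 2 ≤ ∫ x in Ω, superlevel u k x
      * inner ℝ (Matrix.toEuclideanCLM (n := Fin n) (𝕜 := ℝ) (A x) (G x)) (G x) := by
    refine integral_mono_ae (hV2.const_mul _) hi1 ?_
    filter_upwards [ae_restrict_mem hΩo.measurableSet] with x hx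
    simp only [hV, posGrad, superlevel]
    split_ifs with h
    · rw [one_smul, one_mul]
      exact hA.elliptic x hx (G x)
    · simp
  simp only [superlevel] at h2
  have h3 : ∫ x in Ω, lam * ‖V x‖ ^ 2 ≤ ‖∫ x in Ω, inner ℝ (Z x) (V x)‖ := by
    rw [Real.norm_eq_abs]
    linarith [neg_abs_le (∫ x in Ω, inner ℝ (Z x) (V x))]
  have h4 : ‖∫ x in Ω, inner ℝ (Z x) (V x)‖ₑ ≤ eLpNorm Z 2 (volume.restrict Ω) * N := by
    refine (enorm_integral_le_lintegral_enorm _).trans ?_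
    rw [← eLpNorm_one_eq_lintegral_enorm]
    have := eLpNorm_le_eLpNorm_mul_eLpNorm_of_nnnorm (p := 2) (q := 2) (r := 1) hZm.1 hVm.1
      (fun x y => (inner ℝ x y : ℝ)) 1 (Eventually.of_forall fun x => by
        simpa using nnnorm_inner_le_nnnorm (𝕜 := ℝ) (Z x) (V x))
    simpa using this
  have h5 : N * N = ENNReal.ofReal (∫ x in Ω, ‖V x‖ ^ 2) := by
    rw [ofReal_integral_eq_lintegral_ofReal hV2 (Eventually.of_forall fun x => by positivity), hN,
      eLpNorm_eq_lintegral_rpow_enorm_toReal two_ne_zero ENNReal.ofNat_ne_top, ← sq,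
      ← ENNReal.rpow_natCast, ← ENNReal.rpow_mul]
    norm_num
  rw [mul_assoc, h5, ← ENNReal.ofReal_mul hA.lam_pos.le, ← integral_const_mul]
  refine (ENNReal.ofReal_le_ofReal h3).trans ?_
  rwa [ofReal_norm]

/-- If `u ≤ k j` eventually, almost everywhere, then `u ≤ k j` almost everywhere for some `j`. -/
theorem IsWeakSolution.exists_ae_le (hn : 3 ≤ n) (hΩ : IsBoundedLipschitzDomain Ω)
    (hΩo : IsOpen Ω) (hA : IsUniformlyElliptic Ω A lam Lam)
    (hb : MemLp b (n : ℝ≥0∞) (volume.restrict Ω)) (hc : MemLp c (n : ℝ≥0∞) (volume.restrict Ω))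
    (hd : MemLp d ((n : ℝ≥0∞) / 2) (volume.restrict Ω)) (hsign : SignCondition Ω b d)
    (hu : YLim Ω ψ u G) (hsol : IsWeakSolution Ω A b c d u G) {k : ℕ → ℝ} (hk : ∀ j, 0 ≤ k j)
    (hev : ∀ᵐ x ∂(volume.restrict Ω), ∀ᶠ j in atTop, u x ≤ k j) :
    ∃ j, ∀ᵐ x ∂(volume.restrict Ω), u x ≤ k j := by
  have hΩb := hΩ.1
  have := isFiniteMeasure_restrict hΩb
  have := holderTriple_sobolev_natCast hn
  obtain ⟨χ, hχ, hχ0, hχ1⟩ := exists_cutoff hΩb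
  obtain ⟨C, hC, hCle⟩ := YLim.exists_sobolev hn hΩ
  have hum := hu.memLp.1
  have hn0 : (n : ℝ≥0∞) ≠ 0 := by
    have : n ≠ 0 := by omega
    exact_mod_cast this
  have hlam : ENNReal.ofReal lam ≠ 0 := by simpa using hA.lam_pos
  set m : ℕ → ℝ≥0∞ := fun j => eLpNorm (superlevel u (k j)) n (volume.restrict Ω) with hm
  set γ : ℕ → ℝ≥0∞ := fun j => eLpNorm (fun x => superlevel u (k j) x • (c x - b x)) n
    (volume.restrict Ω) with hγ
  have hzero : ∀ᵐ x ∂(volume.restrict Ω), Tendsto (fun j => superlevel u (k j) x) atTop (𝓝 0) := by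
    filter_upwards [hev] with x hx
    refine tendsto_const_nhds.congr' ?_
    filter_upwards [hx] with j hj
    rw [superlevel, if_neg (by linarith)]
  have hm0 : Tendsto m atTop (𝓝 0) :=
    tendsto_eLpNorm_zero_of_dominated hn0 (by simp) (memLp_const (1 : ℝ)) (C := 1)
      (fun j => aestronglyMeasurable_superlevel hum _)
      (fun j => Eventually.of_forall fun x => by simpa using norm_superlevel_le u (k j) x) hzero
  have hγ0 : Tendsto γ atTop (𝓝 0) := by
    refine tendsto_eLpNorm_zero_of_dominated hn0 (by simp) (hc.sub hb) (C := 1)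
      (fun j => (aestronglyMeasurable_superlevel hum _).smul (hc.1.sub hb.1))
      (fun j => Eventually.of_forall fun x => ?_) ?_
    · rw [norm_smul]
      exact mul_le_mul_of_nonneg_right (norm_superlevel_le u (k j) x) (norm_nonneg _)
    · filter_upwards [hzero] with x hx
      simpa using hx.smul_const (c x - b x)
  have hlim : Tendsto (fun j => C * (m j + (ENNReal.ofReal lam)⁻¹ * γ j)) atTop
      (𝓝 (C * (0 + (ENNReal.ofReal lam)⁻¹ * 0))) :=
    ENNReal.Tendsto.const_mul (hm0.add (ENNReal.Tendsto.const_mul hγ0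
      (Or.inr (ENNReal.inv_ne_top.2 hlam)))) (Or.inr hC)
  simp only [mul_zero, add_zero] at hlim
  obtain ⟨j, hj⟩ := (hlim.eventually_lt_const zero_lt_one).exists
  refine ⟨j, ?_⟩
  have hY : YLim Ω _ (fun x => u x - k j) (fun x => deriv (fun t : ℝ => t - k j) (u x) • G x) :=
    hu.comp hn hΩo.measurableSet hχ hχ1 (F := fun t => t - k j) (K := 1) (by fun_prop)
      (fun t => by simp)
  simp only [deriv_sub_const_fun, deriv_id'', one_smul] at hY
  obtain ⟨ψ', hY', -⟩ := hY.exists_posPart hn hΩo hΩb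
  have hS := hCle _ _ _ hY'
  have hE := hsol.eLpNorm_posGrad_le hn hΩo hΩb hA hb hc hd hsign hu (hk j)
  set P := eLpNorm (fun x => max (u x - k j) 0) (sobolevExponent n) (volume.restrict Ω) with hP
  have hE' : eLpNorm (posGrad (fun x => u x - k j) G) 2 (volume.restrict Ω)
      ≤ (ENNReal.ofReal lam)⁻¹ * (P * γ j) :=
    (ENNReal.mul_le_iff_le_inv hlam ENNReal.ofReal_ne_top).1 hE
  -- Hölder's inequality after writing `(u - k)⁺` as itself times the indicator of `{u > k}`, so
  -- that the zeroth order term of the Sobolev inequality also gets a small factor.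
  have h2 : eLpNorm (fun x => max (u x - k j) 0) 2 (volume.restrict Ω) ≤ P * m j := by
    have := eLpNorm_smul_le_mul_eLpNorm (p := sobolevExponent n) (q := n) (r := 2) (aestronglyMeasurable_superlevel hum (k j))
      hY'.memLp.1
    refine le_trans (le_of_eq ?_) this
    congr 1
    ext x
    exact (max_mul_superlevel u (k j) x).symm
  -- The factor in front of `P` is below `1` by the choice of `j`, and `P` is finite, so `P = 0`.
  have hle : P ≤ C * (m j + (ENNReal.ofReal lam)⁻¹ * γ j) * P := by
    refine hS.trans ((mul_le_mul le_rfl (add_le_add h2 hE') zero_le zero_le).trans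
      (le_of_eq ?_))
    ring
  have hP0 : P = 0 := by
    by_contra h0
    have := ENNReal.mul_lt_mul_left h0 hY'.memLp.2.ne hj
    rw [one_mul] at this
    exact (hle.trans_lt this).false
  rw [hP, eLpNorm_eq_zero_iff hY'.memLp.1 (sobolevExponent_ne_zero hn)] at hP0
  filter_upwards [hP0] with x hx
  have : u x - k j ≤ 0 := (le_max_left _ _).trans hx.le
  linarith

/-- Under the sign condition on `(b, d)`, every solution vanishes or has a sign. -/
theorem IsWeakSolution.sign_of_signCondition_b (hn : 3 ≤ n) (hΩ : IsBoundedLipschitzDomain Ω)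
    (hΩo : IsOpen Ω) (hΩc : IsPreconnected Ω) (hA : IsUniformlyElliptic Ω A lam Lam)
    (hb : MemLp b (n : ℝ≥0∞) (volume.restrict Ω)) (hc : MemLp c (n : ℝ≥0∞) (volume.restrict Ω))
    (hd : MemLp d ((n : ℝ≥0∞) / 2) (volume.restrict Ω)) (hsign : SignCondition Ω b d)
    (hu : YLim Ω ψ u G) (hsol : IsWeakSolution Ω A b c d u G) :
    (∀ᵐ x ∂(volume.restrict Ω), u x ≤ 0) ∨ (∀ᵐ x ∂(volume.restrict Ω), 0 < u x) := by
  have hΩb := hΩ.1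
  have := isFiniteMeasure_restrict hΩb
  obtain ⟨χ, hχ, hχ0, hχ1⟩ := exists_cutoff hΩb
  -- Only nonnegative upper bounds are considered: the truncation estimate needs `k ≥ 0`, and so
  -- does the supersolution property of `M - u`.
  set B : Set ℝ := {k | 0 ≤ k ∧ ∀ᵐ x ∂(volume.restrict Ω), u x ≤ k} with hB
  have hBne : B.Nonempty := by
    obtain ⟨j, hj⟩ := hsol.exists_ae_le hn hΩ hΩo hA hb hc hd hsign hu (k := fun j => (j : ℝ))
      (fun j => by positivity)
      (Eventually.of_forall fun x => tendsto_natCast_atTop_atTop.eventually_ge_atTop (u x))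
    exact ⟨j, by positivity, hj⟩
  have hBbd : BddBelow B := ⟨0, fun k hk => hk.1⟩
  set M := sInf B with hM
  have hM0 : 0 ≤ M := le_csInf hBne fun k hk => hk.1
  have huM : ∀ᵐ x ∂(volume.restrict Ω), u x ≤ M := by
    have : ∀ j : ℕ, ∀ᵐ x ∂(volume.restrict Ω), u x ≤ M + 1 / ((j : ℝ) + 1) := by
      intro j
      obtain ⟨k, hk, hkM⟩ := exists_lt_of_csInf_lt hBne
        (lt_add_of_pos_right M (by positivity : (0 : ℝ) < 1 / ((j : ℝ) + 1)))
      filter_upwards [hk.2] with x hx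
      exact hx.trans hkM.le
    filter_upwards [ae_all_iff.2 this] with x hx
    have h := tendsto_one_div_add_atTop_nhds_zero_nat (𝕜 := ℝ).const_add M
    rw [add_zero] at h
    exact ge_of_tendsto' h hx
  rcases hM0.eq_or_lt with h0 | hMpos
  · left
    rwa [← h0] at huM
  right
  have hY : YLim Ω _ (fun x => M - u x) (fun x => deriv (fun t : ℝ => M - t) (u x) • G x) :=
    hu.comp hn hΩo.measurableSet hχ hχ1 (F := fun t => M - t) (K := 1) (by fun_prop)
      (fun t => by simp)
  have hdF : ∀ t : ℝ, deriv (fun t : ℝ => M - t) t = -1 := fun t => by simp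
  simp only [hdF] at hY
  have hb2 : MemLp b 2 (volume.restrict Ω) := hb.mono_exponent (two_le_natCast hn)
  have hdq : MemLp d (dualExponent n) (volume.restrict Ω) :=
    hd.mono_exponent (dualExponent_le_half hn)
  have hX := memLp_flux hn hA hb hu.memLp hu.memLp_gradient
  have hy := memLp_source hn hc hd hu.memLp hu.memLp_gradient
  -- The form at the constant `M` is `M` times the integral in the sign condition, and the form at
  -- `u` vanishes.
  have hsup : IsSupersolution Ω A b c d (fun x => M - u x) (fun x => (-1 : ℝ) • G x) := by
    intro φ hφ hφ0
    have h1 := integral_sub ((integrable_functional hn hb2 hdq (hφ.memLp _ Ω)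
      (hφ.memLp_gradient _ Ω)).const_mul M)
      (integrable_functional hn hX hy (hφ.memLp _ Ω) (hφ.memLp_gradient _ Ω))
    rw [hsol φ hφ, sub_zero, integral_const_mul] at h1
    refine (mul_nonneg hM0 (hsign φ hφ hφ0)).trans (h1.symm.le.trans (le_of_eq ?_))
    refine integral_congr_ae (Eventually.of_forall fun x => ?_)
    simp only [flux, source, map_smul, inner_add_left, real_inner_smul_left, real_inner_smul_right]
    ring
  rcases hsup.ae_zero_or_pos hn hΩo hΩc hΩb hA hb hc hd hY
    (by filter_upwards [huM] with x hx; linarith) with h | h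
  · filter_upwards [h] with x hx
    linarith
  · exfalso
    -- Since `u < M` a.e., levels increasing to `M` are eventually above `u x`, and absorption
    -- produces an upper bound strictly below `M`. The maximum with `0` keeps the levels admissible.
    obtain ⟨j, hj⟩ := hsol.exists_ae_le hn hΩ hΩo hA hb hc hd hsign hu
      (k := fun j => max 0 (M - 1 / ((j : ℝ) + 1))) (fun j => le_max_left _ _) (by
        filter_upwards [h] with x hx
        have hl := tendsto_one_div_add_atTop_nhds_zero_nat (𝕜 := ℝ).eventually_le_const hx
        filter_upwards [hl] with j hj
        exact (by linarith : u x ≤ M - 1 / ((j : ℝ) + 1)).trans (le_max_right _ _))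
    have hlt : max 0 (M - 1 / ((j : ℝ) + 1)) < M := by
      refine max_lt hMpos ?_
      have : (0 : ℝ) < 1 / ((j : ℝ) + 1) := by positivity
      linarith
    exact (csInf_le hBbd ⟨le_max_left _ _, hj⟩).not_gt hlt

end Absorption

/-! ### The space of solutions -/

section Kernel

variable {n : ℕ} {Ω : Set (E n)} {A : E n → Matrix (Fin n) (Fin n) ℝ} {lam Lam : ℝ}
  {b c : E n → E n} {d : E n → ℝ}

theorem IsNeumannSolution.nonpos_or_pos (hn : 3 ≤ n) (hΩ : IsBoundedLipschitzDomain Ω)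
    (hA : IsUniformlyElliptic Ω A lam Lam)
    (hb : MemLp b (n : ℝ≥0∞) (volume.restrict Ω)) (hc : MemLp c (n : ℝ≥0∞) (volume.restrict Ω))
    (hd : MemLp d ((n : ℝ≥0∞) / 2) (volume.restrict Ω))
    (hsign : SignCondition Ω b d ∨ SignCondition Ω c d) {u : E n → ℝ}
    (hu : IsNeumannSolution Ω A b c d u) :
    (∀ᵐ x ∂(volume.restrict Ω), u x ≤ 0) ∨ (∀ᵐ x ∂(volume.restrict Ω), 0 < u x) := by
  obtain ⟨G, hG, hs⟩ := hu
  obtain ⟨ψ, hψ⟩ := hG.exists_yLim hn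
  have hsol : IsWeakSolution Ω A b c d u G := fun φ hφ => by
    rw [← (hs φ hφ).2]
    simp only [weakIntegrand_eq]
  have ⟨hΩb, _, _, hΩo, hΩc, _⟩ := hΩ
  rcases hsign with hsign | hsign
  · exact hsol.sign_of_signCondition_b hn hΩ hΩo hΩc.isPreconnected hA hb hc hd hsign hψ
  · exact hsol.sign_of_signCondition_c hn hΩo hΩc.isPreconnected hΩb hA hb hc hd hsign hψ

theorem neumannKernel_pos_or_neg (hn : 3 ≤ n) (hΩ : IsBoundedLipschitzDomain Ω)
    (hA : IsUniformlyElliptic Ω A lam Lam)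
    (hb : MemLp b (n : ℝ≥0∞) (volume.restrict Ω)) (hc : MemLp c (n : ℝ≥0∞) (volume.restrict Ω))
    (hd : MemLp d ((n : ℝ≥0∞) / 2) (volume.restrict Ω))
    (hsign : SignCondition Ω b d ∨ SignCondition Ω c d) {u : Y12 hn Ω}
    (hu : u ∈ neumannKernel hn Ω A b c d) (hu0 : u ≠ 0) :
    (∀ᵐ x ∂(volume.restrict Ω), 0 < u.1 x) ∨ (∀ᵐ x ∂(volume.restrict Ω), u.1 x < 0) := by
  rcases IsNeumannSolution.nonpos_or_pos hn hΩ hA hb hc hd hsign hu with h1 | h1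
  swap
  · exact Or.inl h1
  rcases IsNeumannSolution.nonpos_or_pos hn hΩ hA hb hc hd hsign
    (hu.const_mul (-1)) with h2 | h2
  · refine (hu0 (Subtype.ext ((Lp.eq_zero_iff_ae_eq_zero).2 ?_))).elim
    filter_upwards [h1, h2] with x hx hx'
    rw [neg_one_mul] at hx'
    exact le_antisymm hx (neg_nonpos.1 hx')
  · right
    filter_upwards [h2] with x hx
    linarith

theorem integral_ne_zero_of_neumannKernel (hn : 3 ≤ n) (hΩ : IsBoundedLipschitzDomain Ω)
    (hA : IsUniformlyElliptic Ω A lam Lam)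
    (hb : MemLp b (n : ℝ≥0∞) (volume.restrict Ω)) (hc : MemLp c (n : ℝ≥0∞) (volume.restrict Ω))
    (hd : MemLp d ((n : ℝ≥0∞) / 2) (volume.restrict Ω))
    (hsign : SignCondition Ω b d ∨ SignCondition Ω c d) {u : Y12 hn Ω}
    (hu : u ∈ neumannKernel hn Ω A b c d) (hu0 : u ≠ 0) : ∫ x in Ω, u.1 x ≠ 0 := by
  have ⟨hΩb, _, _, hΩo, hΩc, _⟩ := hΩ
  have := isFiniteMeasure_restrict hΩb
  have hpos : volume Ω ≠ 0 := (hΩo.measure_pos volume hΩc.nonempty).ne'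
  have hint : Integrable u.1 (volume.restrict Ω) :=
    (Lp.memLp u.1).integrable (one_le_sobolevExponent hn)
  have key : ∀ f : E n → ℝ, Integrable f (volume.restrict Ω) →
      (∀ᵐ x ∂(volume.restrict Ω), 0 < f x) → ∫ x in Ω, f x ≠ 0 := by
    intro f hf hfpos h0
    rw [integral_eq_zero_iff_of_nonneg_ae (hfpos.mono fun x hx => hx.le) hf] at h0
    have hfalse : ∀ᵐ x ∂(volume.restrict Ω), False := by
      filter_upwards [h0, hfpos] with x hx hx'
      exact hx'.ne' hx
    rw [ae_iff] at hfalse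
    exact hpos (by simpa using hfalse)
  rcases neumannKernel_pos_or_neg hn hΩ hA hb hc hd hsign hu hu0 with h | h
  · exact key _ hint h
  · have := key (fun x => -u.1 x) hint.neg (h.mono fun x hx => by linarith)
    rwa [integral_neg, neg_ne_zero] at this

/-- If `v ≠ 0`, the combination `u - (I u / I v) • v` is annihilated by `I`, hence is zero. It is
applied with the integral over `Ω`, which is nonzero on functions of one strict sign. -/
theorem rank_le_one_of_functional {V : Type*} [AddCommGroup V] [Module ℝ V] (I : V → ℝ)
    (hI : ∀ (u v : V) (t : ℝ), I (u - t • v) = I u - t * I v) (h0 : ∀ v, v ≠ 0 → I v ≠ 0) :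
    Module.rank ℝ V ≤ 1 := by
  rw [rank_le_one_iff]
  by_cases hall : ∀ v : V, v = 0
  · exact ⟨0, fun v => ⟨0, by rw [smul_zero, hall v]⟩⟩
  push Not at hall
  obtain ⟨v, hv⟩ := hall
  refine ⟨v, fun u => ⟨I u / I v, ?_⟩⟩
  by_contra hne
  refine h0 (u - (I u / I v) • v) (fun h => hne (sub_eq_zero.1 h).symm) ?_
  rw [hI, div_mul_cancel₀ _ (h0 v hv), sub_self]

theorem rank_neumannKernel_le_one (hn : 3 ≤ n) (hΩ : IsBoundedLipschitzDomain Ω)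
    (hA : IsUniformlyElliptic Ω A lam Lam)
    (hb : MemLp b (n : ℝ≥0∞) (volume.restrict Ω)) (hc : MemLp c (n : ℝ≥0∞) (volume.restrict Ω))
    (hd : MemLp d ((n : ℝ≥0∞) / 2) (volume.restrict Ω))
    (hsign : SignCondition Ω b d ∨ SignCondition Ω c d) :
    Module.rank ℝ (neumannKernel hn Ω A b c d) ≤ 1 := by
  have := isFiniteMeasure_restrict hΩ.1
  have hint : ∀ u : Lp ℝ (sobolevExponent n) (volume.restrict Ω),
      Integrable u (volume.restrict Ω) := fun u =>
    (Lp.memLp u).integrable (one_le_sobolevExponent hn)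
  have hlin : ∀ (u v : Lp ℝ (sobolevExponent n) (volume.restrict Ω)) (t : ℝ),
      ∫ x in Ω, (u - t • v) x = (∫ x in Ω, u x) - t * ∫ x in Ω, v x := by
    intro u v t
    rw [← integral_const_mul, ← integral_sub (hint u) ((hint v).const_mul t)]
    refine integral_congr_ae ?_
    filter_upwards [Lp.coeFn_sub u (t • v), Lp.coeFn_smul t v] with x h1 h2
    rw [h1, Pi.sub_apply, h2, Pi.smul_apply, smul_eq_mul]
  refine rank_le_one_of_functional (fun u => ∫ x in Ω, u.1.1 x) (fun u v t => hlin _ _ t)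
    fun v hv => ?_
  exact integral_ne_zero_of_neumannKernel hn hΩ hA hb hc hd hsign v.2
    fun h => hv (Subtype.ext h)

end Kernel

end NeumannProblem

end

theorem mainTheorem2 {n : ℕ} (hn : 3 ≤ n) (Ω : Set (NeumannProblem.E n))
    (hΩ : NeumannProblem.IsBoundedLipschitzDomain Ω)
    (A : NeumannProblem.E n → Matrix (Fin n) (Fin n) ℝ) (lam Lam : ℝ)
    (hA : NeumannProblem.IsUniformlyElliptic Ω A lam Lam)
    (b c : NeumannProblem.E n → NeumannProblem.E n) (d : NeumannProblem.E n → ℝ)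
    (hb : MemLp b (n : ℝ≥0∞) (volume.restrict Ω))
    (hc : MemLp c (n : ℝ≥0∞) (volume.restrict Ω))
    (hd : MemLp d ((n : ℝ≥0∞) / 2) (volume.restrict Ω))
    (hsign : NeumannProblem.SignCondition Ω b d ∨ NeumannProblem.SignCondition Ω c d) :
    (∀ u ∈ NeumannProblem.neumannKernel hn Ω A b c d, u ≠ 0 →
      (∀ᵐ x ∂(volume.restrict Ω), 0 < u.1 x) ∨ (∀ᵐ x ∂(volume.restrict Ω), u.1 x < 0)) ∧
    Module.rank ℝ (NeumannProblem.neumannKernel hn Ω A b c d) ≤ 1 := by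
  exact ⟨fun u hu hu0 => NeumannProblem.neumannKernel_pos_or_neg hn hΩ hA hb hc hd hsign hu hu0,
    NeumannProblem.rank_neumannKernel_le_one hn hΩ hA hb hc hd hsign⟩
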